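/- \textbf{Setting.} Let $(X,d)$ be a locally compact separable metric space with a Borel measure $\mu$ that is finite on compact sets, strictly positive on non-empty open sets, and doubling: $\mu(B(x,2r))\lesssim \mu(B(x,r))$ for all $x\in X$, $r>0$. Write $L^q=L^q(X,\mu)$ (complex valued), $|E|=\mu(E)$, $\lambda B$ for the ball concentric with $B$ and of $\lambda$ times its radius, and let $d(B_1,B_2)$ be the infimum distance of two balls. Let $\Gamma$ be a sublinear operator with values in $L^2$ and dense domain $\mathcal F\subset L^2$ ($|\Gamma(f+g)|\le|\Gamma f|+|\Gamma g|$ and $|\Gamma(cf)|=|c||\Gamma f|$ a.e.), which is local ($\operatorname{supp}\Gamma f\subseteq\operatorname{supp} f$) and satisfies the relative Faber--Krahn inequality: for some $\delta\in(0,1)$, $\left(\int_B|f|^2\,d\mu\right)^{1/2}\lesssim r\left(\int_B|\Gamma f|^2\,d\mu\right)^{1/2}$ for every ball $B$ of radius $r\le\delta\operatorname{diam}(X)$ and every $f\in\mathcal F$ supported in $B$. Let $L$ be an injective, maximal $\omega$-accretive operator on $L^2$ with $0\le\omega<\pi/2$ (that is, $L$ is closed and densely defined, $|\arg\langle Lf,f\rangle|\le\omega$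 for all $f\in\mathcal D(L)$, and $I+L$ is onto), with $\mathcal D(L)\subset\mathcal F$, such that $\|\Gamma f\|_2\lesssim\|L^{1/2}f\|_2$ for all $f\in\mathcal D(L)$, and such that for some $c>0$, all $r>0$ and all balls $B_1,B_2$ of radius $r$, $$\|e^{-r^2L}\|_{L^2(B_1)\to L^2(B_2)}+\|r\Gamma e^{-r^2L}\|_{L^2(B_1)\to L^2(B_2)}\lesssim e^{-c\,d(B_1,B_2)^2/r^2}.$$ Let $p^L$ be the supremum of all $q\in[2,\infty)$ for which there are $C,c>0$ such that, for all $t>0$, all balls $B_1,B_2$ of radius $\sqrt t$ and all $f\in L^2$ vanishing outside $B_1$, $$\left(\frac1{|B_2|}\int_{B_2}|e^{-tL}f|^q\,d\mu\right)^{1/q}\le C e^{-c\,d(B_1,B_2)^2/t}\left(\frac1{|B_1|}\int_{B_1}|f|^2\,d\mu\right)^{1/2}.$$ \textbf{Proposition ($L^p$ Caccioppoli inequality).} Let $p_0\in(2,p^L)$ and assume $(G_{p_0})$: there is a constant $C$ with $\|\sqrt t\,\Gamma e^{-tL}f\|_{p_0}\le C\|f\|_{p_0}$ for all $t>0$ and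 $f\in L^2\cap L^{p_0}$. Let $p\in(2,p_0)$, let $M\ge1$ be an integer and let $N>0$ be real. (i) There is a constant $C$ such that for every $f\in\mathcal D(L^M)$ and every ball $B$ of radius $r>0$, $$\left(\frac1{|B|}\int_B|r\Gamma f|^p\,d\mu\right)^{1/p}\le C\sum_{\ell\ge0}2^{-\ell N}\left[\left(\frac1{|2^\ell B|}\int_{2^\ell B}|f|^p\,d\mu\right)^{1/p}+\left(\frac1{|2^\ell B|}\int_{2^\ell B}|(r^2L)^Mf|^p\,d\mu\right)^{1/p}\right],$$ where both sides are elements of $[0,\infty]$. (ii) Let $\nu>0$ be such that $\mu(B(x,r))\lesssim(r/s)^\nu\mu(B(x,s))$ for all $x\in X$ and $r\ge s>0$, and suppose that $M>\frac\nu2\left(\frac12-\frac1p\right)+\frac12$. Then there is a constant $C$ such that for every $f\in\mathcal D(L^M)$ and every ball $B$ of radius $r>0$, $$\left(\frac1{|B|}\int_B|r\Gamma f|^p\,d\mu\right)^{1/p}\le C\sum_{\ell\ge0}2^{-\ell N}\left[\left(\frac1{|2^\ell B|}\int_{2^\ell B}|f|^2\,d\mu\right)^{1/2}+\left(\frac1{|2^\ell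 B|}\int_{2^\ell B}|(r^2L)^Mf|^2\,d\mu\right)^{1/2}\right].$$ -/

import Mathlib

open MeasureTheory Set Filter Topology
open scoped ENNReal NNReal

noncomputable section

namespace Caccioppoli

/-! ### Balls, averages, supports, doubling -/

section Metric

variable {X : Type*} [MetricSpace X] [MeasurableSpace X]

/-- The distance `d(A, B)`, the infimum of `d(a, b)` over `a ∈ A` and `b ∈ B`. -/
def setDist (A B : Set X) : ℝ := ⨅ z : A × B, dist (z.1 : X) (z.2 : X)

/-- The `L^p` average of `|f|` over `s`: the number `((1/μ(s)) ∫_s |f|^p dμ)^(1/p)` in `[0, ∞]`. -/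
def avg (μ : Measure X) (p : ℝ) (f : X → ℂ) (s : Set X) : ℝ≥0∞ :=
  (⨍⁻ y in s, ‖f y‖ₑ ^ p ∂μ) ^ (1 / p)

/-- The support of an a.e.-class: the complement of the largest open set on which `f = 0` a.e. -/
def essSupport (μ : Measure X) (f : X → ℂ) : Set X :=
  {x | ∀ U ∈ 𝓝 x, ¬ ∀ᵐ y ∂μ, y ∈ U → f y = 0}

/-- The function `f` vanishes a.e. outside `s` (so that `f ∈ L^2(X)` belongs to `L^2(s)`). -/
def VanishesOutside (μ : Measure X) (f : X → ℂ) (s : Set X) : Prop :=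
  ∀ᵐ y ∂μ, y ∉ s → f y = 0

/-- The doubling property `V(x, 2r) ≲ V(x, r)`. -/
def Doubling (μ : Measure X) : Prop :=
  ∃ C : ℝ≥0, ∀ (x : X) (r : ℝ), 0 < r →
    μ (Metric.ball x (2 * r)) ≤ C * μ (Metric.ball x r)

/-- The growth condition `V(x, r) ≲ (r/s)^ν V(x, s)` for `r ≥ s > 0`. -/
def VolumeGrowth (μ : Measure X) (ν : ℝ) : Prop :=
  ∃ C : ℝ≥0, ∀ (x : X) (r s : ℝ), 0 < s → s ≤ r →
    μ (Metric.ball x r) ≤ C * ENNReal.ofReal ((r / s) ^ ν) * μ (Metric.ball x s)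

end Metric

/-! ### Unbounded operators on a complex Hilbert space -/

section Operators

variable {H : Type*} [NormedAddCommGroup H] [InnerProductSpace ℂ H]

/-- The composition `A ∘ B` of unbounded operators with its natural domain
`{x ∈ D(B) : B x ∈ D(A)}`. -/
def natComp (A B : H →ₗ.[ℂ] H) : H →ₗ.[ℂ] H where
  domain :=
    { carrier := {x | ∃ hx : x ∈ B.domain, B ⟨x, hx⟩ ∈ A.domain}
      zero_mem' := by
        refine ⟨B.domain.zero_mem, ?_⟩
        have h : B ⟨0, B.domain.zero_mem⟩ = 0 := B.map_zero
        rw [h]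
        exact A.domain.zero_mem
      add_mem' := by
        rintro x y ⟨hx, hx'⟩ ⟨hy, hy'⟩
        refine ⟨B.domain.add_mem hx hy, ?_⟩
        have h : B ⟨x + y, B.domain.add_mem hx hy⟩ = B ⟨x, hx⟩ + B ⟨y, hy⟩ :=
          B.map_add ⟨x, hx⟩ ⟨y, hy⟩
        rw [h]
        exact A.domain.add_mem hx' hy'
      smul_mem' := by
        rintro c x ⟨hx, hx'⟩
        refine ⟨B.domain.smul_mem c hx, ?_⟩
        have h : B ⟨c • x, B.domain.smul_mem c hx⟩ = c • B ⟨x, hx⟩ :=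
          B.map_smul c ⟨x, hx⟩
        rw [h]
        exact A.domain.smul_mem c hx' }
  toFun :=
    { toFun := fun x => A ⟨B ⟨x.1, x.2.1⟩, x.2.2⟩
      map_add' := by
        rintro ⟨x, hx, hx'⟩ ⟨y, hy, hy'⟩
        rw [← A.map_add]
        congr 1
        exact Subtype.ext (B.map_add ⟨x, hx⟩ ⟨y, hy⟩)
      map_smul' := by
        rintro c ⟨x, hx, hx'⟩
        rw [RingHom.id_apply, ← A.map_smul]
        congr 1
        exact Subtype.ext (B.map_smul c ⟨x, hx⟩) }

/-- The power `L^M`, with `L^0 = I` on all of `H` and `L^(M+1) = L ∘ L^M` on its natural domain. -/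
def opPow (L : H →ₗ.[ℂ] H) : ℕ → (H →ₗ.[ℂ] H)
  | 0 => (LinearMap.id : H →ₗ[ℂ] H).toPMap ⊤
  | M + 1 => natComp L (opPow L M)

/-- Maximal `ω`-accretivity: `L` is closed and densely defined, its numerical range lies in the
closed sector `{z : |arg z| ≤ ω}`, and `I + L` is onto. -/
structure IsOmegaAccretive (L : H →ₗ.[ℂ] H) (ω : ℝ) : Prop where
  closed : L.IsClosed
  dense : Dense (L.domain : Set H)
  sector : ∀ f : L.domain, |Complex.arg (inner ℂ (f : H) (L f))| ≤ ω
  maximal : ∀ g : H, ∃ f : L.domain, (f : H) + L f = g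

/-- `T` restricted to `[0, ∞)` is a strongly continuous semigroup whose generator is `-L`. -/
structure IsSemigroupOf (T : ℝ → H →L[ℂ] H) (L : H →ₗ.[ℂ] H) : Prop where
  zero : T 0 = ContinuousLinearMap.id ℂ H
  add : ∀ s t : ℝ, 0 ≤ s → 0 ≤ t → T (s + t) = (T s).comp (T t)
  cont : ∀ f : H, Tendsto (fun t => T t f) (𝓝[>] 0) (𝓝 f)
  generator : ∀ f g : H, (f, g) ∈ L.graph ↔
    Tendsto (fun t : ℝ => t⁻¹ • (f - T t f)) (𝓝[>] 0) (𝓝 g)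

open Classical in
/-- The semigroup `e^{-tL}`, `t ≥ 0`: the strongly continuous semigroup generated by `-L`. It is
unique, and it exists for every maximal accretive `L`. -/
def semigroup (L : H →ₗ.[ℂ] H) : ℝ → H →L[ℂ] H :=
  if h : ∃ T : ℝ → H →L[ℂ] H, IsSemigroupOf T L then h.choose else 0

open Classical in
/-- The resolvent `(lam + L)⁻¹ g`; for a maximal accretive `L` and `lam > 0` the solution `f` of
`lam f + L f = g` exists and is unique. -/
def negResolvent (L : H →ₗ.[ℂ] H) (lam : ℝ) (g : H) : H :=
  if h : ∃ f : L.domain, lam • (f : H) + L f = g then (h.choose : H) else 0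

/-- The square root `L^{1/2} f = (1/π) ∫_0^∞ lam^{-1/2} (lam + L)⁻¹ L f dlam` of a maximal
accretive operator on `D(L)`. -/
def sqrtOp (L : H →ₗ.[ℂ] H) (f : L.domain) : H :=
  (1 / Real.pi) • ∫ lam in Ioi (0 : ℝ), (lam ^ (-(1 / 2) : ℝ)) • negResolvent L lam (L f)

end Operators

/-! ### The setting -/

section Setting

variable {X : Type*} [MetricSpace X] [MeasurableSpace X]

/-- The space `L^2(X, μ)` of complex functions. -/
abbrev L2 (μ : Measure X) : Type _ := Lp ℂ 2 μ

/-- A sublinear operator with dense domain in `L^2(X, μ)`. The values of `toFun` outside `domain`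
play no role. -/
structure SublinearOperator (μ : Measure X) where
  domain : Submodule ℂ (L2 μ)
  toFun : L2 μ → L2 μ
  dense : Dense (domain : Set (L2 μ))
  subadd : ∀ f ∈ domain, ∀ g ∈ domain,
    ∀ᵐ y ∂μ, ‖toFun (f + g) y‖ ≤ ‖toFun f y‖ + ‖toFun g y‖
  homog : ∀ (c : ℂ), ∀ f ∈ domain, ∀ᵐ y ∂μ, ‖toFun (c • f) y‖ = ‖c‖ * ‖toFun f y‖

/-- Locality: `supp Γf ⊆ supp f`. -/
def IsLocal {μ : Measure X} (Γ : SublinearOperator μ) : Prop :=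
  ∀ f ∈ Γ.domain, essSupport μ (Γ.toFun f) ⊆ essSupport μ f

/-- The relative Faber-Krahn inequality. -/
def RelativeFaberKrahn {μ : Measure X} (Γ : SublinearOperator μ) : Prop :=
  ∃ δ C : ℝ, 0 < δ ∧ δ < 1 ∧ ∀ (x : X) (r : ℝ), 0 < r →
    ENNReal.ofReal r ≤ ENNReal.ofReal δ * Metric.ediam (univ : Set X) →
    ∀ f ∈ Γ.domain, essSupport μ f ⊆ Metric.ball x r →
      eLpNorm f 2 (μ.restrict (Metric.ball x r)) ≤
        ENNReal.ofReal (C * r) * eLpNorm (Γ.toFun f) 2 (μ.restrict (Metric.ball x r))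

/-- `‖Γf‖_2 ≲ ‖L^{1/2} f‖_2` for `f ∈ D(L)`. -/
def RieszTwo {μ : Measure X} (Γ : SublinearOperator μ) (L : L2 μ →ₗ.[ℂ] L2 μ) : Prop :=
  ∃ C : ℝ, ∀ f : L.domain, ‖Γ.toFun f‖ ≤ C * ‖sqrtOp L f‖

/-- The `L^2` Davies-Gaffney estimates for `e^{-r²L}` and `rΓe^{-r²L}` between balls of
radius `r`. -/
def DaviesGaffney {μ : Measure X} (Γ : SublinearOperator μ) (L : L2 μ →ₗ.[ℂ] L2 μ) : Prop :=
  ∃ C c : ℝ, 0 < c ∧ ∀ (x y : X) (r : ℝ), 0 < r →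
    ∀ f : L2 μ, VanishesOutside μ f (Metric.ball x r) →
      eLpNorm (semigroup L (r ^ 2) f) 2 (μ.restrict (Metric.ball y r)) ≤
        ENNReal.ofReal
          (C * Real.exp (-c * setDist (Metric.ball x r) (Metric.ball y r) ^ 2 / r ^ 2)) *
          eLpNorm f 2 μ ∧
      ENNReal.ofReal r *
          eLpNorm (Γ.toFun (semigroup L (r ^ 2) f)) 2 (μ.restrict (Metric.ball y r)) ≤
        ENNReal.ofReal
          (C * Real.exp (-c * setDist (Metric.ball x r) (Metric.ball y r) ^ 2 / r ^ 2)) *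
          eLpNorm f 2 μ

/-- The standing assumptions on `(X, μ, Γ, L)`. -/
structure IsSetting (μ : Measure X) (Γ : SublinearOperator μ) (L : L2 μ →ₗ.[ℂ] L2 μ)
    (ω : ℝ) : Prop where
  doubling : Doubling μ
  isLocal : IsLocal Γ
  faberKrahn : RelativeFaberKrahn Γ
  omega_nonneg : 0 ≤ ω
  omega_lt : ω < Real.pi / 2
  injective : ∀ f : L.domain, L f = 0 → (f : L2 μ) = 0
  accretive : IsOmegaAccretive L ω
  domain_le : L.domain ≤ Γ.domain
  rieszTwo : RieszTwo Γ L
  daviesGaffney : DaviesGaffney Γ L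

/-- `L^2`-`L^q` off-diagonal estimates for `e^{-tL}` at scale `√t`, with constants that do not
depend on `t > 0`. -/
def SemigroupOffDiagonal {μ : Measure X} (L : L2 μ →ₗ.[ℂ] L2 μ) (q : ℝ) : Prop :=
  ∃ C c : ℝ, 0 < c ∧ ∀ t : ℝ, 0 < t → ∀ (x y : X),
    ∀ f : L2 μ, VanishesOutside μ f (Metric.ball x (√t)) →
      avg μ q (semigroup L t f) (Metric.ball y (√t)) ≤
        ENNReal.ofReal
          (C * Real.exp (-c * setDist (Metric.ball x (√t)) (Metric.ball y (√t)) ^ 2 / t)) *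
          avg μ 2 f (Metric.ball x (√t))

/-- The exponent `p^L ∈ [0, ∞]`: the supremum of all `q ∈ [2, ∞)` such that `e^{-tL}` satisfies
`L^2`-`L^q` off-diagonal estimates. -/
def upperExponent {μ : Measure X} (L : L2 μ →ₗ.[ℂ] L2 μ) : ℝ≥0∞ :=
  sSup {s | ∃ q : ℝ, 2 ≤ q ∧ SemigroupOffDiagonal L q ∧ s = ENNReal.ofReal q}

/-- The property `(G_q)`: the operators `√t Γe^{-tL}`, `t > 0`, are bounded on `L^q`, uniformly
in `t`. -/
def GradientBound {μ : Measure X} (Γ : SublinearOperator μ) (L : L2 μ →ₗ.[ℂ] L2 μ)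
    (q : ℝ) : Prop :=
  ∃ C : ℝ, ∀ t : ℝ, 0 < t → ∀ f : L2 μ, MemLp f (ENNReal.ofReal q) μ →
    ENNReal.ofReal (√t) * eLpNorm (Γ.toFun (semigroup L t f)) (ENNReal.ofReal q) μ ≤
      ENNReal.ofReal C * eLpNorm f (ENNReal.ofReal q) μ

/-- The weighted sum over the dilated balls `B(x, 2^ℓ r)` of the `L^q` averages of `f` and of
`r^{2M} g`, with weights `2^{-ℓN}`, `ℓ ≥ 0`. -/
def dilatedSum (μ : Measure X) (q N r : ℝ) (M : ℕ) (x : X) (f g : X → ℂ) : ℝ≥0∞ :=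
  ∑' l : ℕ, ENNReal.ofReal ((2 : ℝ) ^ (-(l * N))) *
    (avg μ q f (Metric.ball x (2 ^ l * r)) +
      avg μ q (fun y => ((r : ℂ) ^ 2) ^ M * g y) (Metric.ball x (2 ^ l * r)))

end Setting

end Caccioppoli

end

/-! Write `T t` for e^{-tL}. Since `(1 - T a)^M f → 0` as `a → 0`, the vector `f` is recovered from
`f - (1 - T τ)^M f`, with `τ` of order `r²`, by adding the differences `(1 - T (2a))^M f - (1 - T
a)^M f` over the dyadic scales `a = τ/2, τ/4, ...`. The first vector is a finite combination of `T
(mτ) f`, `m ≥ 1`. Each difference is a combination of `T (ma) (1 - T a)^M f`, `m ≥ 1`, and `(1 - T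
a)^M f` is an average of `a^M T σ L^M f` over `0 ≤ σ ≤ Ma`. Hence Γf on a ball is controlled by `ΓT
σ f` at times of order `r²` and by `a^M ΓT σ L^M f` at times of order `a`
(`IsGraphSeminorm.le_tsum`).

Γ is only sublinear, so this is carried out for extended seminorms that are lower semicontinuous in
the graph norm of L. Integrals are handled through closed convex sublevel sets. These are closed
because the semigroup is analytic: `L T t` is bounded for `t > 0`.

The second ingredient (`exists_gradient_local`) bounds `√σ ΓT σ` from L^q averages on dilated balls
to L^p on `B(x, r)`, for `σ ≤ 2r²`, with loss `(r/√σ)^(ν(1/q - 1/p))`. The off-diagonal bounds for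
the semigroup, summed over a net and combined with `(G_{p₀})`, give an L² to L^{p₀} gradient bound
for data in one ball, without decay. Interpolation with the L² Davies-Gaffney bound restores decay
for every `p < p₀`, and a Schur argument over a net turns this into the local estimate.

Put `β = (ν/2)(1/q - 1/p) + 1/2`. The k-th dyadic scale then contributes `O(2^{-k(M-β)})`, which is
summable when `M > β`. The choice `q = p` gives (i), where `β = 1/2`; the choice `q = 2` gives (ii).

The abstract operator theory serves this scheme: generation of the semigroup, contractivity,
analyticity, and a graph-norm bound for `L^{1/2}` that makes Γ continuous on D(L). -/

namespace Caccioppoli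

/-! ### Dissipative curves. -/

section Dissipative

variable {H : Type*} [NormedAddCommGroup H] [InnerProductSpace ℂ H]

/-- The norm of a curve with `u' = -v`, `Re ⟨u, v⟩ ≥ 0`, does not increase. -/
theorem norm_le_of_hasDeriv_right_dissipative {u v : ℝ → H} {a b : ℝ} (hab : a ≤ b)
    (hu : ContinuousOn u (Icc a b))
    (hd : ∀ t ∈ Ico a b, HasDerivWithinAt u (-v t) (Ici t) t)
    (hv : ∀ t ∈ Ico a b, 0 ≤ (inner ℂ (u t) (v t)).re) : ‖u b‖ ≤ ‖u a‖ := by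
  let _ : InnerProductSpace ℝ H := InnerProductSpace.rclikeToReal ℂ H
  have h2 : ‖u b‖ ^ 2 ≤ ‖u a‖ ^ 2 := by
    refine image_le_of_deriv_right_le_deriv_boundary (f := fun t => ‖u t‖ ^ 2)
      (f' := fun t => 2 * inner ℝ (u t) (-v t)) (B := fun _ => ‖u a‖ ^ 2) (B' := fun _ => 0)
      (hu.norm.pow 2) (fun t ht => (hd t ht).norm_sq) le_rfl continuousOn_const
      (fun t _ => hasDerivWithinAt_const _ _ _) (fun t ht => ?_) (right_mem_Icc.2 hab)
    have := hv t ht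
    rw [inner_neg_right]
    change 2 * -(inner ℂ (u t) (v t)).re ≤ 0
    linarith
  exact (pow_le_pow_iff_left₀ (norm_nonneg _) (norm_nonneg _) two_ne_zero).1 h2

end Dissipative

/-! ### The resolvent of a maximal accretive operator on the positive half-line. -/

section Resolvent

variable {H : Type*} [NormedAddCommGroup H] [InnerProductSpace ℂ H] {L : H →ₗ.[ℂ] H} {ω : ℝ}

theorem real_smul_mem_graph {f g : H} (h : (f, g) ∈ L.graph) (c : ℝ) :
    (c • f, c • g) ∈ L.graph := by
  have := L.graph.smul_mem (c : ℂ) h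
  simpa using this

theorem graph_add_mem {f g f' g' : H} (h : (f, g) ∈ L.graph) (h' : (f', g') ∈ L.graph) :
    (f + f', g + g') ∈ L.graph := L.graph.add_mem h h'

theorem graph_sub_mem {f g f' g' : H} (h : (f, g) ∈ L.graph) (h' : (f', g') ∈ L.graph) :
    (f - f', g - g') ∈ L.graph := L.graph.sub_mem h h'

namespace IsOmegaAccretive

theorem norm_inner_mul_cos_le (hL : IsOmegaAccretive L ω) (hω : ω < Real.pi / 2) {f g : H}
    (h : (f, g) ∈ L.graph) : ‖inner ℂ f g‖ * Real.cos ω ≤ (inner ℂ f g).re := by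
  obtain ⟨y, rfl, rfl⟩ := L.mem_graph_iff.1 h
  rw [← Complex.norm_mul_cos_arg]
  refine mul_le_mul_of_nonneg_left ?_ (norm_nonneg _)
  rw [← Real.cos_abs (Complex.arg _)]
  refine Real.cos_le_cos_of_nonneg_of_le_pi (abs_nonneg _) ?_ (hL.sector y)
  linarith [Real.pi_pos]

theorem re_inner_nonneg (hL : IsOmegaAccretive L ω) (hω : ω < Real.pi / 2) {f g : H}
    (h : (f, g) ∈ L.graph) : 0 ≤ (inner ℂ f g).re := by
  obtain ⟨y, rfl, rfl⟩ := L.mem_graph_iff.1 h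
  exact Complex.abs_arg_le_pi_div_two_iff.1 ((hL.sector y).trans hω.le)

/-- Pair `lam • f + g` with `f`: accretivity allows `Re ⟨f, g⟩` to be dropped. This one bound yields
injectivity of `lam + L` and the estimate `‖(lam + L)⁻¹‖ ≤ 1/lam`. -/
theorem mul_norm_le (hL : IsOmegaAccretive L ω) (hω : ω < Real.pi / 2) {f g : H}
    (h : (f, g) ∈ L.graph) (lam : ℝ) : lam * ‖f‖ ≤ ‖lam • f + g‖ := by
  rcases eq_or_ne f 0 with rfl | hf
  · simp
  have hf' : 0 < ‖f‖ := norm_pos_iff.2 hf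
  have h1 : (inner ℂ f (lam • f + g)).re = lam * ‖f‖ ^ 2 + (inner ℂ f g).re := by
    rw [inner_add_right, inner_smul_right_eq_smul, inner_self_eq_norm_sq_to_K]
    simp [← Complex.ofReal_pow]
  have h2 : (inner ℂ f (lam • f + g)).re ≤ ‖f‖ * ‖lam • f + g‖ :=
    (Complex.re_le_norm _).trans (norm_inner_le_norm _ _)
  have h3 := hL.re_inner_nonneg hω h
  have h4 : ‖f‖ * (lam * ‖f‖) ≤ ‖f‖ * ‖lam • f + g‖ := by nlinarith
  exact le_of_mul_le_mul_left h4 hf'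

variable [CompleteSpace H]

/-- A Neumann series in fixed-point form: solving at `mu` means `f = R (g - (mu - lam) f)` with `R =
(lam + L)⁻¹`, and this map contracts with factor `|mu - lam| / lam`. -/
theorem exists_resolvent_of_lt (hL : IsOmegaAccretive L ω) (hω : ω < Real.pi / 2) {lam mu : ℝ}
    (hl : 0 < lam) (hs : ∀ g : H, ∃ f, (f, g - lam • f) ∈ L.graph) (h : |mu - lam| < lam) (g : H) :
    ∃ f, (f, g - mu • f) ∈ L.graph := by
  choose R hR using hs
  let Φ : H → H := fun f => R (g - (mu - lam) • f)
  have hK : 0 ≤ |mu - lam| / lam := by positivity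
  have hc : ContractingWith (|mu - lam| / lam).toNNReal Φ := by
    refine ⟨?_, LipschitzWith.of_dist_le_mul fun x y => ?_⟩
    · rw [Real.toNNReal_lt_one]
      exact (div_lt_one hl).2 h
    · have h1 := graph_sub_mem (hR (g - (mu - lam) • x)) (hR (g - (mu - lam) • y))
      have h2 := hL.mul_norm_le hω h1 lam
      have h3 : lam • (R (g - (mu - lam) • x) - R (g - (mu - lam) • y)) +
          (g - (mu - lam) • x - lam • R (g - (mu - lam) • x) -
            (g - (mu - lam) • y - lam • R (g - (mu - lam) • y))) = (lam - mu) • (x - y) := by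
        module
      rw [h3, norm_smul, Real.norm_eq_abs, abs_sub_comm] at h2
      rw [dist_eq_norm, dist_eq_norm, Real.coe_toNNReal _ hK]
      change ‖R _ - R _‖ ≤ |mu - lam| / lam * ‖x - y‖
      rw [div_mul_eq_mul_div, le_div_iff₀ hl, mul_comm]
      exact h2
  have hfix : Φ (ContractingWith.fixedPoint Φ hc) = ContractingWith.fixedPoint Φ hc :=
    hc.fixedPoint_isFixedPt
  refine ⟨ContractingWith.fixedPoint Φ hc, ?_⟩
  have h5 := hR (g - (mu - lam) • ContractingWith.fixedPoint Φ hc)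
  change (Φ _, _ - lam • Φ _) ∈ L.graph at h5
  rw [hfix] at h5
  convert h5 using 2
  module

/-- Surjectivity at 1 propagates along the powers of 3/2, each step moving by half of the current
value. From a power above `lam`, a single further step reaches `lam`, however small it is. -/
theorem exists_resolvent (hL : IsOmegaAccretive L ω) (hω : ω < Real.pi / 2) {lam : ℝ}
    (hl : 0 < lam) (g : H) : ∃ f, (f, g - lam • f) ∈ L.graph := by
  have key : ∀ n : ℕ, ∀ g : H, ∃ f, (f, g - ((3 / 2 : ℝ) ^ n) • f) ∈ L.graph := by
    intro n
    induction n with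
    | zero =>
      intro g
      obtain ⟨f, hf⟩ := hL.maximal g
      refine ⟨f, L.mem_graph_iff.2 ⟨f, rfl, ?_⟩⟩
      simp [← hf]
    | succ n ih =>
      intro g
      have hp : (0 : ℝ) < (3 / 2) ^ n := by positivity
      refine hL.exists_resolvent_of_lt hω hp ih ?_ g
      rw [pow_succ, abs_of_nonneg] <;> nlinarith
  obtain ⟨n, hn⟩ := pow_unbounded_of_one_lt lam (by norm_num : (1 : ℝ) < 3 / 2)
  refine hL.exists_resolvent_of_lt hω (by positivity) (key n) ?_ g
  rw [abs_lt]
  constructor <;> linarith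

theorem exists_resolventCLM (hL : IsOmegaAccretive L ω) (hω : ω < Real.pi / 2) {lam : ℝ}
    (hl : 0 < lam) : ∃ R : H →L[ℂ] H, (∀ g, (R g, g - lam • R g) ∈ L.graph) ∧
      ∀ g, lam * ‖R g‖ ≤ ‖g‖ := by
  choose R hR using fun g => hL.exists_resolvent hω hl g
  have huniq : ∀ f g, (f, g - lam • f) ∈ L.graph → f = R g := by
    intro f g h
    have h1 := hL.mul_norm_le hω (graph_sub_mem h (hR g)) lam
    have h2 : lam • (f - R g) + (g - lam • f - (g - lam • R g)) = 0 := by module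
    rw [h2, norm_zero] at h1
    have h3 : ‖f - R g‖ ≤ 0 := by
      by_contra! h4
      nlinarith
    exact sub_eq_zero.1 (norm_le_zero_iff.1 h3)
  have hbound : ∀ g, lam * ‖R g‖ ≤ ‖g‖ := by
    intro g
    have h1 := hL.mul_norm_le hω (hR g) lam
    rwa [add_sub_cancel] at h1
  let R' : H →ₗ[ℂ] H :=
    { toFun := R
      map_add' := fun x y => by
        refine (huniq _ _ ?_).symm
        convert graph_add_mem (hR x) (hR y) using 2
        module
      map_smul' := fun c x => by
        refine (huniq _ _ ?_).symm
        convert L.graph.smul_mem c (hR x) using 1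
        rw [Prod.smul_mk, smul_sub, smul_comm c lam]
        rfl }
  refine ⟨R'.mkContinuous (lam⁻¹) fun g => ?_, hR, hbound⟩
  rw [inv_mul_eq_div, le_div_iff₀ hl, mul_comm]
  exact hbound g

/-- The resolvent `(lam + L)⁻¹`, `lam > 0`, as a bounded operator. -/
noncomputable def resolventCLM (hL : IsOmegaAccretive L ω) (hω : ω < Real.pi / 2) {lam : ℝ}
    (hl : 0 < lam) : H →L[ℂ] H := (hL.exists_resolventCLM hω hl).choose

section

variable (hL : IsOmegaAccretive L ω) (hω : ω < Real.pi / 2) {lam : ℝ} (hl : 0 < lam)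

theorem resolventCLM_mem_graph (g : H) :
    (hL.resolventCLM hω hl g, g - lam • hL.resolventCLM hω hl g) ∈ L.graph :=
  (hL.exists_resolventCLM hω hl).choose_spec.1 g

theorem mul_norm_resolventCLM_le (g : H) : lam * ‖hL.resolventCLM hω hl g‖ ≤ ‖g‖ :=
  (hL.exists_resolventCLM hω hl).choose_spec.2 g

theorem eq_resolventCLM {f g : H} (h : (f, g) ∈ L.graph) :
    f = hL.resolventCLM hω hl (lam • f + g) := by
  have h1 := hL.mul_norm_le hω
    (graph_sub_mem h (hL.resolventCLM_mem_graph hω hl (lam • f + g))) lam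
  have h2 : lam • (f - hL.resolventCLM hω hl (lam • f + g)) +
      (g - (lam • f + g - lam • hL.resolventCLM hω hl (lam • f + g))) = 0 := by module
  rw [h2, norm_zero] at h1
  have h3 : ‖f - hL.resolventCLM hω hl (lam • f + g)‖ ≤ 0 := by
    by_contra! h4
    nlinarith
  exact sub_eq_zero.1 (norm_le_zero_iff.1 h3)

theorem sub_smul_resolventCLM {f g : H} (h : (f, g) ∈ L.graph) :
    f - lam • hL.resolventCLM hω hl f = hL.resolventCLM hω hl g := by
  have h1 := hL.eq_resolventCLM hω hl h
  rw [map_add, ContinuousLinearMap.map_smul_of_tower] at h1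
  nth_rewrite 1 [h1]
  module

theorem resolventCLM_graph {f g : H} (h : (f, g) ∈ L.graph) :
    (hL.resolventCLM hω hl f, hL.resolventCLM hω hl g) ∈ L.graph := by
  rw [← hL.sub_smul_resolventCLM hω hl h]
  exact hL.resolventCLM_mem_graph hω hl f

theorem resolventCLM_commute {mu : ℝ} (hm : 0 < mu) :
    Commute (hL.resolventCLM hω hl) (hL.resolventCLM hω hm) := by
  ext g
  have h1 := hL.resolventCLM_graph hω hl (hL.resolventCLM_mem_graph hω hm g)
  have h2 := hL.eq_resolventCLM hω hm h1
  rw [map_sub, ContinuousLinearMap.map_smul_of_tower, add_sub_cancel] at h2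
  exact h2

end

/-- On D(L) the error `f - lam R f = R L f` is `O(1/lam)`; density of D(L) and `‖lam R‖ ≤ 1` extend
the convergence to all vectors. -/
theorem tendsto_smul_resolventCLM (hL : IsOmegaAccretive L ω) (hω : ω < Real.pi / 2)
    {lam : ℕ → ℝ} (hl : ∀ n, 0 < lam n) (hlim : Tendsto lam atTop atTop) (v : H) :
    Tendsto (fun n => lam n • hL.resolventCLM hω (hl n) v) atTop (𝓝 v) := by
  rw [Metric.tendsto_atTop]
  intro ε hε
  obtain ⟨w, hw, hvw⟩ := Metric.mem_closure_iff.1 (hL.dense v) (ε / 3) (by positivity)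
  obtain ⟨z, hz⟩ := LinearPMap.mem_domain_iff.1 hw
  obtain ⟨n₀, hn₀⟩ := (hlim.eventually_ge_atTop (3 * (‖z‖ + 1) / ε)).exists_forall_of_atTop
  refine ⟨n₀, fun n hn => ?_⟩
  have h1 : ‖lam n • hL.resolventCLM hω (hl n) (v - w)‖ ≤ ‖v - w‖ := by
    rw [norm_smul, Real.norm_of_nonneg (hl n).le]
    exact hL.mul_norm_resolventCLM_le hω (hl n) _
  have h2 := hL.sub_smul_resolventCLM hω (hl n) hz
  have h3 := hL.mul_norm_resolventCLM_le hω (hl n) z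
  have h4 : ‖w - lam n • hL.resolventCLM hω (hl n) w‖ < ε / 3 := by
    rw [h2]
    have h5 := (div_le_iff₀ hε).1 (hn₀ n hn)
    by_contra! h6
    have := hl n
    nlinarith [norm_nonneg z]
  rw [dist_eq_norm] at hvw ⊢
  have h5 : lam n • hL.resolventCLM hω (hl n) v - v =
      lam n • hL.resolventCLM hω (hl n) (v - w) - (w - lam n • hL.resolventCLM hω (hl n) w)
        - (v - w) := by
    rw [map_sub]; module
  rw [h5]
  have h6 := norm_sub_le (lam n • hL.resolventCLM hω (hl n) (v - w) -
    (w - lam n • hL.resolventCLM hω (hl n) w)) (v - w)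
  have h7 := norm_sub_le (lam n • hL.resolventCLM hω (hl n) (v - w))
    (w - lam n • hL.resolventCLM hω (hl n) w)
  linarith

end IsOmegaAccretive

end Resolvent

end Caccioppoli

namespace Caccioppoli

/-! ### Exponentials of bounded accretive operators. -/

section BoundedGenerator

variable {H : Type*} [NormedAddCommGroup H] [InnerProductSpace ℂ H] [CompleteSpace H]

/-- The group `e^{-tA}` of a bounded operator `A`. -/
noncomputable def expSemi (A : H →L[ℂ] H) (t : ℝ) : H →L[ℂ] H :=
  NormedSpace.exp (((-t : ℝ) : ℂ) • A)

theorem expSemi_zero (A : H →L[ℂ] H) : expSemi A 0 = 1 := by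
  simp [expSemi, NormedSpace.exp_zero]

theorem expSemi_add (A : H →L[ℂ] H) (s t : ℝ) : expSemi A (s + t) = expSemi A s * expSemi A t := by
  let _ : NormedAlgebra ℚ (H →L[ℂ] H) := NormedAlgebra.restrictScalars ℚ ℂ _
  rw [expSemi, expSemi, expSemi, ← NormedSpace.exp_add_of_commute, ← add_smul]
  · congr 2; push_cast; ring
  · exact ((Commute.refl A).smul_left _).smul_right _

theorem expSemi_commute {A B : H →L[ℂ] H} (h : Commute B A) (t : ℝ) : Commute B (expSemi A t) :=
  (h.smul_right _).exp_right

theorem hasDerivAt_expSemi (A : H →L[ℂ] H) (t : ℝ) :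
    HasDerivAt (expSemi A) (-(A * expSemi A t)) t := by
  have h1 := (hasDerivAt_exp_smul_const' (𝕂 := ℂ) A ((-t : ℝ) : ℂ)).scomp t
    (hasDerivAt_neg t).ofReal_comp
  refine h1.congr_deriv ?_
  rw [Complex.ofReal_neg, Complex.ofReal_one, neg_one_smul]
  rfl

theorem hasDerivAt_expSemi_apply (A : H →L[ℂ] H) (u : H) (t : ℝ) :
    HasDerivAt (fun t => expSemi A t u) (-(A (expSemi A t u))) t := by
  have h := ((ContinuousLinearMap.apply ℂ H u).restrictScalars ℝ).hasFDerivAt.comp_hasDerivAt t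
    (hasDerivAt_expSemi A t)
  exact h

theorem norm_expSemi_le {A : H →L[ℂ] H} (hA : ∀ u, 0 ≤ (inner ℂ u (A u)).re) {t : ℝ} (ht : 0 ≤ t)
    (u : H) : ‖expSemi A t u‖ ≤ ‖u‖ := by
  have h := norm_le_of_hasDeriv_right_dissipative (u := fun t => expSemi A t u)
    (v := fun t => A (expSemi A t u)) ht
    (fun s _ => (hasDerivAt_expSemi_apply A u s).continuousAt.continuousWithinAt)
    (fun s _ => (hasDerivAt_expSemi_apply A u s).hasDerivWithinAt) (fun s _ => hA _)
  simpa [expSemi_zero] using h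

/-- Duhamel: differentiate `s ↦ e^{-sA} e^{-(t-s)B} u`. Commutation moves `B - A` onto `u`, and both
exponentials are contractions. -/
theorem norm_expSemi_sub_le {A B : H →L[ℂ] H} (hA : ∀ u, 0 ≤ (inner ℂ u (A u)).re)
    (hB : ∀ u, 0 ≤ (inner ℂ u (B u)).re) (hAB : Commute A B) {t : ℝ} (ht : 0 ≤ t) (u : H) :
    ‖expSemi A t u - expSemi B t u‖ ≤ ‖A u - B u‖ * t := by
  have hd : ∀ s : ℝ, HasDerivAt (fun s => expSemi A s * expSemi B (t - s))
      (expSemi A s * (expSemi B (t - s) * (B - A))) s := by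
    intro s
    have h1 : HasDerivAt (fun s => expSemi B (t - s)) (B * expSemi B (t - s)) s := by
      have := (hasDerivAt_expSemi B (t - s)).scomp s ((hasDerivAt_id s).const_sub t)
      exact this.congr_deriv (by simp)
    refine ((hasDerivAt_expSemi A s).mul h1).congr_deriv ?_
    have e1 : A * expSemi A s = expSemi A s * A := expSemi_commute (Commute.refl A) s
    have e2 : A * expSemi B (t - s) = expSemi B (t - s) * A := expSemi_commute hAB _
    have e3 : B * expSemi B (t - s) = expSemi B (t - s) * B := expSemi_commute (Commute.refl B) _
    rw [e3, e1, neg_mul, mul_assoc, e2]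
    simp only [mul_sub]
    abel
  have hd' : ∀ s : ℝ, HasDerivAt (fun s => expSemi A s (expSemi B (t - s) u))
      (expSemi A s (expSemi B (t - s) (B u - A u))) s := fun s =>
    ((ContinuousLinearMap.apply ℂ H u).restrictScalars ℝ).hasFDerivAt.comp_hasDerivAt s (hd s)
  have h := norm_image_sub_le_of_norm_deriv_le_segment' (a := 0) (b := t) (C := ‖A u - B u‖)
    (fun s _ => (hd' s).hasDerivWithinAt) (fun s hs => ?_) t (right_mem_Icc.2 ht)
  · simpa [expSemi_zero] using h
  · refine (norm_expSemi_le hA hs.1 _).trans ((norm_expSemi_le hB (by linarith [hs.2]) _).trans ?_)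
    rw [norm_sub_rev]

theorem norm_expSemi_sub_self_le {A : H →L[ℂ] H} (hA : ∀ u, 0 ≤ (inner ℂ u (A u)).re) {t : ℝ}
    (ht : 0 ≤ t) (u : H) : ‖expSemi A t u - u‖ ≤ ‖A u‖ * t := by
  have h := norm_expSemi_sub_le hA (B := 0) (by simp) (Commute.zero_right A) ht u
  simpa [expSemi, NormedSpace.exp_zero] using h

/-- A first-order Taylor bound made to survive the Yosida limit. The usual remainder involves `A (A
u)`, which need not stay bounded along the approximations; replacing `A u` by a nearby `h` leaves
only `A h`, which does when `h ∈ D(L)`. -/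
theorem norm_sub_expSemi_sub_smul_le {A : H →L[ℂ] H} (hA : ∀ u, 0 ≤ (inner ℂ u (A u)).re) {t : ℝ}
    (ht : 0 ≤ t) (u h : H) :
    ‖u - expSemi A t u - t • A u‖ ≤ (2 * ‖A u - h‖ + ‖A h‖ * t) * t := by
  have hd : ∀ s : ℝ, HasDerivAt (fun s => expSemi A s u + s • A u)
      (-(expSemi A s (A u)) + A u) s := by
    intro s
    have h1 := (hasDerivAt_expSemi_apply A u s).add ((hasDerivAt_id s).smul_const (A u))
    have h2 : A (expSemi A s u) = expSemi A s (A u) :=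
      congrArg (fun F : H →L[ℂ] H => F u) (expSemi_commute (Commute.refl A) s)
    rw [h2, one_smul] at h1
    exact h1
  have h := norm_image_sub_le_of_norm_deriv_le_segment' (a := 0) (b := t)
    (C := 2 * ‖A u - h‖ + ‖A h‖ * t)
    (fun s _ => (hd s).hasDerivWithinAt) (fun s hs => ?_) t (right_mem_Icc.2 ht)
  · rw [← norm_neg]
    simp only [expSemi_zero, zero_smul, sub_zero, one_apply_eq_self, add_zero] at h
    rw [neg_sub, sub_sub_eq_add_sub, add_comm (t • A u)]
    exact h
  · have e : -(expSemi A s (A u)) + A u =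
        (A u - h) - expSemi A s (A u - h) - (expSemi A s h - h) := by
      rw [map_sub]; abel
    rw [e]
    have h1 := norm_sub_le ((A u - h) - expSemi A s (A u - h)) (expSemi A s h - h)
    have h2 := norm_sub_le (A u - h) (expSemi A s (A u - h))
    have h3 := norm_expSemi_le hA hs.1 (A u - h)
    have h4 := norm_expSemi_sub_self_le hA hs.1 h
    have h5 : ‖A h‖ * s ≤ ‖A h‖ * t := by gcongr; exact hs.2.le
    linarith

end BoundedGenerator

/-! ### Yosida approximation and generation of the semigroup. -/

section Yosida

variable {H : Type*} [NormedAddCommGroup H] [InnerProductSpace ℂ H] [CompleteSpace H]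
  {L : H →ₗ.[ℂ] H} {ω : ℝ}

namespace IsOmegaAccretive

/-- The Yosida approximation `lam - lam² (lam + L)⁻¹`, `lam > 0`. -/
noncomputable def yosida (hL : IsOmegaAccretive L ω) (hω : ω < Real.pi / 2) {lam : ℝ}
    (hl : 0 < lam) : H →L[ℂ] H := (lam : ℂ) • (1 - (lam : ℂ) • hL.resolventCLM hω hl)

variable (hL : IsOmegaAccretive L ω) (hω : ω < Real.pi / 2)

theorem yosida_apply_of_mem_graph {lam : ℝ} (hl : 0 < lam) {f g : H} (h : (f, g) ∈ L.graph) :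
    hL.yosida hω hl f = lam • hL.resolventCLM hω hl g := by
  rw [← hL.sub_smul_resolventCLM hω hl h]
  simp [yosida]

/-- The real part equals `lam (‖u‖² - lam Re ⟨u, R u⟩)`, nonnegative because `lam R` is a
contraction. -/
theorem re_inner_yosida_nonneg {lam : ℝ} (hl : 0 < lam) (u : H) :
    0 ≤ (inner ℂ u (hL.yosida hω hl u)).re := by
  have h1 : (inner ℂ u (hL.yosida hω hl u)).re =
      lam * (‖u‖ ^ 2 - lam * (inner ℂ u (hL.resolventCLM hω hl u)).re) := by
    simp only [yosida, smul_apply, sub_apply,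
      one_apply_eq_self]
    rw [inner_smul_right, inner_sub_right, inner_smul_right, inner_self_eq_norm_sq_to_K]
    simp [← Complex.ofReal_pow]
  rw [h1]
  have h2 : (inner ℂ u (hL.resolventCLM hω hl u)).re ≤ ‖u‖ * ‖hL.resolventCLM hω hl u‖ :=
    (Complex.re_le_norm _).trans (norm_inner_le_norm _ _)
  have h3 := hL.mul_norm_resolventCLM_le hω hl u
  have h4 : lam * (inner ℂ u (hL.resolventCLM hω hl u)).re ≤ ‖u‖ * ‖u‖ := by
    nlinarith [norm_nonneg u]
  exact mul_nonneg hl.le (by nlinarith)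

theorem yosida_commute {lam mu : ℝ} (hl : 0 < lam) (hm : 0 < mu) :
    Commute (hL.yosida hω hl) (hL.yosida hω hm) := by
  have h := hL.resolventCLM_commute hω hl hm
  refine Commute.smul_left (Commute.smul_right ?_ _) _
  refine Commute.sub_left (Commute.one_left _) (Commute.sub_right (Commute.one_right _) ?_)
  exact (h.smul_left _).smul_right _

/-- The Yosida approximations along the integers. -/
noncomputable def yosidaSeq (n : ℕ) : H →L[ℂ] H := hL.yosida hω (Nat.cast_add_one_pos n)

theorem tendsto_yosidaSeq {f g : H} (h : (f, g) ∈ L.graph) :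
    Tendsto (fun n => hL.yosidaSeq hω n f) atTop (𝓝 g) := by
  have h1 := hL.tendsto_smul_resolventCLM hω (lam := fun n : ℕ => (n : ℝ) + 1)
    (fun n => Nat.cast_add_one_pos n)
    (tendsto_atTop_add_const_right _ _ tendsto_natCast_atTop_atTop) g
  refine h1.congr fun n => ?_
  rw [yosidaSeq, hL.yosida_apply_of_mem_graph hω _ h]

/-- On D(L) Duhamel bounds the difference of two exponentials by `t` times the difference of the
generators, which converge there. Uniform contractivity passes from D(L) to its closure. -/
theorem exists_tendsto_expSemi_yosidaSeq {t : ℝ} (ht : 0 ≤ t) (u : H) :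
    ∃ v, Tendsto (fun n => expSemi (hL.yosidaSeq hω n) t u) atTop (𝓝 v) := by
  refine cauchySeq_tendsto_of_complete (Metric.cauchySeq_iff.2 fun ε hε => ?_)
  obtain ⟨w, hw, huw⟩ := Metric.mem_closure_iff.1 (hL.dense u) (ε / 3) (by positivity)
  obtain ⟨z, hz⟩ := LinearPMap.mem_domain_iff.1 hw
  obtain ⟨n₀, hn₀⟩ := Metric.cauchySeq_iff.1 (hL.tendsto_yosidaSeq hω hz).cauchySeq
    (ε / (3 * (t + 1))) (by positivity)
  refine ⟨n₀, fun m hm n hn => ?_⟩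
  have hd := fun k => hL.re_inner_yosida_nonneg hω (Nat.cast_add_one_pos k)
  have h1 := norm_expSemi_sub_le (hd m) (hd n) (hL.yosida_commute hω _ _) ht w
  have h2 := hn₀ m hm n hn
  rw [dist_eq_norm] at h2 huw ⊢
  have h3 := norm_expSemi_le (hd m) ht (u - w)
  have h4 := norm_expSemi_le (hd n) ht (u - w)
  have h5 : ‖hL.yosidaSeq hω m w - hL.yosidaSeq hω n w‖ * t < ε / 3 := by
    have h6 := (lt_div_iff₀ (by positivity)).1 h2
    nlinarith [norm_nonneg (hL.yosidaSeq hω m w - hL.yosidaSeq hω n w)]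
  have e : expSemi (hL.yosidaSeq hω m) t u - expSemi (hL.yosidaSeq hω n) t u =
      expSemi (hL.yosidaSeq hω m) t (u - w) - expSemi (hL.yosidaSeq hω n) t (u - w) +
      (expSemi (hL.yosidaSeq hω m) t w - expSemi (hL.yosidaSeq hω n) t w) := by
    rw [map_sub, map_sub]; abel
  rw [e]
  have h7 := norm_add_le (expSemi (hL.yosidaSeq hω m) t (u - w) -
    expSemi (hL.yosidaSeq hω n) t (u - w))
    (expSemi (hL.yosidaSeq hω m) t w - expSemi (hL.yosidaSeq hω n) t w)
  have h8 := norm_sub_le (expSemi (hL.yosidaSeq hω m) t (u - w))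
    (expSemi (hL.yosidaSeq hω n) t (u - w))
  change ‖expSemi (hL.yosidaSeq hω m) t w - expSemi (hL.yosidaSeq hω n) t w‖ ≤
    ‖hL.yosidaSeq hω m w - hL.yosidaSeq hω n w‖ * t at h1
  change ‖expSemi (hL.yosidaSeq hω m) t (u - w)‖ ≤ _ at h3
  change ‖expSemi (hL.yosidaSeq hω n) t (u - w)‖ ≤ _ at h4
  linarith

/-- The Lumer-Phillips theorem: a maximal accretive operator generates a semigroup. -/
theorem exists_isSemigroupOf (hL : IsOmegaAccretive L ω) (hω : ω < Real.pi / 2) : ∃ T : ℝ → H →L[ℂ] H, IsSemigroupOf T L := by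
  have hd := fun k => hL.re_inner_yosida_nonneg hω (Nat.cast_add_one_pos (α := ℝ) k)
  -- `max t 0` only makes the family total on ℝ; nothing is asked of negative times.
  have hex : ∀ t : ℝ, ∀ u, ∃ v,
      Tendsto (fun n => expSemi (hL.yosidaSeq hω n) (max t 0) u) atTop (𝓝 v) := fun t u =>
    hL.exists_tendsto_expSemi_yosidaSeq hω (le_max_right t 0) u
  choose F hF using hex
  let T : ℝ → H →L[ℂ] H := fun t =>
    continuousLinearMapOfTendsto (fun n => expSemi (hL.yosidaSeq hω n) (max t 0))
      (tendsto_pi_nhds.2 (hF t))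
  have hT : ∀ {t : ℝ}, 0 ≤ t → ∀ u,
      Tendsto (fun n => expSemi (hL.yosidaSeq hω n) t u) atTop (𝓝 (T t u)) := by
    intro t ht u
    have := hF t u
    rwa [max_eq_left ht] at this
  have hcontr : ∀ {t : ℝ}, 0 ≤ t → ∀ u, ‖T t u‖ ≤ ‖u‖ := fun {t} ht u =>
    le_of_tendsto (hT ht u).norm (Eventually.of_forall fun n => norm_expSemi_le (hd n) ht u)
  have hsub : ∀ {t : ℝ}, 0 ≤ t → ∀ {f g}, (f, g) ∈ L.graph → ‖T t f - f‖ ≤ ‖g‖ * t := by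
    intro t ht f g h
    exact le_of_tendsto_of_tendsto ((hT ht f).sub_const f).norm
      ((hL.tendsto_yosidaSeq hω h).norm.mul_const t)
      (Eventually.of_forall fun n => norm_expSemi_sub_self_le (hd n) ht f)
  have hgen : ∀ {f g}, (f, g) ∈ L.graph →
      Tendsto (fun t : ℝ => t⁻¹ • (f - T t f)) (𝓝[>] 0) (𝓝 g) := by
    intro f g h
    -- `g` itself need not lie in D(L). The Taylor bound is used with `w ∈ D(L)` close to `g`, and
    -- passed to the limit along the Yosida sequence.
    rw [Metric.tendsto_nhds]
    intro ε hε
    obtain ⟨w, hw, huw⟩ := Metric.mem_closure_iff.1 (hL.dense g) (ε / 4) (by positivity)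
    obtain ⟨z, hz⟩ := LinearPMap.mem_domain_iff.1 hw
    have hδ : 0 < ε / (2 * (‖z‖ + 1)) := by positivity
    filter_upwards [Ioo_mem_nhdsGT hδ] with t ht
    have ht0 : 0 < t := ht.1
    have h1 : ‖f - T t f - t • g‖ ≤ (2 * ‖g - w‖ + ‖z‖ * t) * t := by
      have a1 := hL.tendsto_yosidaSeq hω h
      have a2 := hL.tendsto_yosidaSeq hω hz
      refine le_of_tendsto_of_tendsto
        (((hT ht0.le f).const_sub f).sub (a1.const_smul t)).norm
        ((((a1.sub_const w).norm.const_mul 2).add (a2.norm.mul_const t)).mul_const t)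
        (Eventually.of_forall fun n => norm_sub_expSemi_sub_smul_le (hd n) ht0.le f w)
    rw [dist_eq_norm] at huw ⊢
    have e : t⁻¹ • (f - T t f) - g = t⁻¹ • (f - T t f - t • g) := by
      rw [smul_sub _ _ (t • g), smul_smul, inv_mul_cancel₀ ht0.ne', one_smul]
    rw [e, norm_smul, norm_inv, Real.norm_of_nonneg ht0.le, inv_mul_lt_iff₀ ht0]
    refine h1.trans_lt ?_
    rw [mul_comm]
    refine mul_lt_mul_of_pos_left ?_ ht0
    have h2 := (lt_div_iff₀ (by positivity)).1 ht.2
    nlinarith [norm_nonneg z]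
  refine ⟨T, ?_, ?_, ?_, ?_⟩
  · ext u
    refine tendsto_nhds_unique (hT le_rfl u) ?_
    simp [expSemi_zero]
  · intro s t hs ht
    ext u
    refine tendsto_nhds_unique (hT (add_nonneg hs ht) u) ?_
    have h1 : Tendsto (fun n => expSemi (hL.yosidaSeq hω n) s
        (expSemi (hL.yosidaSeq hω n) t u - T t u)) atTop (𝓝 0) := by
      refine squeeze_zero_norm (fun n => norm_expSemi_le (hd n) hs _) ?_
      have := ((hT ht u).sub_const (T t u)).norm
      simpa using this
    have h2 := h1.add (hT hs (T t u))
    rw [zero_add] at h2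
    refine h2.congr fun n => ?_
    rw [map_sub, sub_add_cancel, expSemi_add]
    rfl
  · intro f
    rw [Metric.tendsto_nhds]
    intro ε hε
    obtain ⟨w, hw, huw⟩ := Metric.mem_closure_iff.1 (hL.dense f) (ε / 4) (by positivity)
    obtain ⟨z, hz⟩ := LinearPMap.mem_domain_iff.1 hw
    have hδ : 0 < ε / (2 * (‖z‖ + 1)) := by positivity
    filter_upwards [Ioo_mem_nhdsGT hδ] with t ht
    rw [dist_eq_norm] at huw ⊢
    have h1 := hsub ht.1.le hz
    have h2 := hcontr ht.1.le (f - w)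
    have h3 := (lt_div_iff₀ (by positivity)).1 ht.2
    have e : T t f - f = T t (f - w) + (T t w - w) - (f - w) := by rw [map_sub]; abel
    rw [e]
    have h4 := norm_sub_le (T t (f - w) + (T t w - w)) (f - w)
    have h5 := norm_add_le (T t (f - w)) (T t w - w)
    nlinarith [norm_nonneg z, ht.1]
  · have hacc : ∀ {t : ℝ}, 0 < t → ∀ v, 0 ≤ (inner ℂ v (t⁻¹ • (v - T t v))).re := by
      intro t ht v
      rw [inner_smul_right_eq_smul, inner_sub_right, inner_self_eq_norm_sq_to_K]
      have h4 : (inner ℂ v (T t v)).re ≤ ‖v‖ * ‖T t v‖ :=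
        (Complex.re_le_norm _).trans (norm_inner_le_norm _ _)
      have h5 := hcontr ht.le v
      have h6 : 0 ≤ t⁻¹ * (‖v‖ ^ 2 - (inner ℂ v (T t v)).re) :=
        mul_nonneg (by positivity) (by nlinarith [norm_nonneg v])
      simpa [← Complex.ofReal_pow] using h6
    -- Maximality: the generator of `T` could a priori extend `-L`. Let `u = (1 + L)⁻¹ (f + g)`. The
    -- difference quotients send `f - u` to `-(f - u)`, and they are accretive since `T t` is a
    -- contraction, so `f = u ∈ D(L)`.
    refine fun f g => ⟨hgen, fun h => ?_⟩
    have hm := hL.resolventCLM_mem_graph hω one_pos (f + g)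
    set u := hL.resolventCLM hω one_pos (f + g)
    rw [one_smul] at hm
    have h1 := h.sub (hgen hm)
    have h2 : Tendsto (fun t : ℝ => t⁻¹ • ((f - u) - T t (f - u))) (𝓝[>] 0) (𝓝 (-(f - u))) := by
      convert h1 using 2
      · rw [map_sub]; module
      · abel
    have h3 : 0 ≤ (inner ℂ (f - u) (-(f - u))).re := by
      refine ge_of_tendsto ((Complex.continuous_re.tendsto _).comp
        (Tendsto.inner (𝕜 := ℂ) tendsto_const_nhds h2)) ?_
      filter_upwards [self_mem_nhdsWithin] with t (ht : 0 < t)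
      exact hacc ht (f - u)
    rw [inner_neg_right, inner_self_eq_norm_sq_to_K] at h3
    have h4 : ‖f - u‖ ^ 2 ≤ 0 := by simpa [← Complex.ofReal_pow] using h3
    have h5 : f - u = 0 := by
      rw [← norm_eq_zero]; nlinarith [norm_nonneg (f - u)]
    rw [sub_eq_zero] at h5
    rw [← h5] at hm
    simpa using hm

/-- Existence rules out the default value 0 in the definition of `semigroup`. -/
theorem isSemigroupOf_semigroup (hL : IsOmegaAccretive L ω) (hω : ω < Real.pi / 2) :
    IsSemigroupOf (semigroup L) L := by
  rw [semigroup, dif_pos (hL.exists_isSemigroupOf hω)]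
  exact (hL.exists_isSemigroupOf hω).choose_spec

end IsOmegaAccretive

end Yosida

end Caccioppoli

namespace Caccioppoli

/-! ### Contractivity, regularity in time and analyticity of the semigroup. -/

section Semigroup

variable {H : Type*} [NormedAddCommGroup H] [InnerProductSpace ℂ H]
  {L : H →ₗ.[ℂ] H} {ω : ℝ} {T : ℝ → H →L[ℂ] H}

namespace IsSemigroupOf

theorem apply_zero (hT : IsSemigroupOf T L) (f : H) : T 0 f = f := by
  rw [hT.zero]; rfl

theorem add_apply (hT : IsSemigroupOf T L) {s t : ℝ} (hs : 0 ≤ s) (ht : 0 ≤ t) (f : H) :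
    T (s + t) f = T s (T t f) := by
  rw [hT.add s t hs ht]; rfl

theorem comm_apply (hT : IsSemigroupOf T L) {s t : ℝ} (hs : 0 ≤ s) (ht : 0 ≤ t) (f : H) :
    T s (T t f) = T t (T s f) := by
  rw [← hT.add_apply hs ht, add_comm, hT.add_apply ht hs]

theorem map_graph (hT : IsSemigroupOf T L) {t : ℝ} (ht : 0 ≤ t) {f g : H}
    (h : (f, g) ∈ L.graph) : (T t f, T t g) ∈ L.graph := by
  refine (hT.generator _ _).2 ?_
  have h1 := ((T t).continuous.tendsto g).comp ((hT.generator f g).1 h)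
  refine h1.congr' ?_
  filter_upwards [self_mem_nhdsWithin] with s (hs : 0 < s)
  rw [Function.comp_apply, ContinuousLinearMap.map_smul_of_tower, map_sub,
    hT.comm_apply ht hs.le]

theorem tendsto_nhdsGE (hT : IsSemigroupOf T L) (f : H) :
    Tendsto (fun t => T t f) (𝓝[≥] 0) (𝓝 f) := by
  have h : ContinuousWithinAt (fun t => T t f) (Ioi 0) 0 := by
    rw [ContinuousWithinAt, hT.apply_zero]; exact hT.cont f
  have h2 := continuousWithinAt_Ioi_iff_Ici.1 h
  rw [ContinuousWithinAt, hT.apply_zero] at h2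
  exact h2

/-- If it failed, some `t n → 0` would have unbounded `‖T (t n)‖`, against Banach-Steinhaus, because
`T (t n) f → f` for every `f`. -/
theorem exists_bound [CompleteSpace H] (hT : IsSemigroupOf T L) :
    ∃ δ > 0, ∃ M : ℝ, ∀ t ∈ Icc 0 δ, ‖T t‖ ≤ M := by
  by_contra! hcon
  have h1 : ∀ n : ℕ, ∃ t ∈ Icc (0 : ℝ) (1 / (n + 1)), (n : ℝ) < ‖T t‖ := fun n =>
    hcon _ Nat.one_div_pos_of_nat n
  choose t ht htn using h1
  have hlim : Tendsto t atTop (𝓝[≥] 0) := by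
    refine tendsto_nhdsWithin_iff.2 ⟨?_, Eventually.of_forall fun n => (ht n).1⟩
    exact squeeze_zero (fun n => (ht n).1) (fun n => (ht n).2) tendsto_one_div_add_atTop_nhds_zero_nat
  obtain ⟨C, hC⟩ := banach_steinhaus (g := fun n => T (t n)) fun x => by
    obtain ⟨C, hC⟩ := (((hT.tendsto_nhdsGE x).comp hlim).norm).bddAbove_range
    exact ⟨C, fun n => hC ⟨n, rfl⟩⟩
  obtain ⟨n, hn⟩ := exists_nat_gt C
  exact absurd (hC n) (not_le.2 (hn.trans (htn n)))

theorem continuousOn_of_bound (hT : IsSemigroupOf T L) {S : Set ℝ} (hS : S ⊆ Ici 0) {M : ℝ}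
    (hM : ∀ t ∈ S, ‖T t‖ ≤ M) (f : H) : ContinuousOn (fun t => T t f) S := by
  rw [Metric.continuousOn_iff]
  intro t ht ε hε
  have hM0 : 0 ≤ M := (norm_nonneg _).trans (hM t ht)
  have h1 := Metric.tendsto_nhdsWithin_nhds.1 (hT.tendsto_nhdsGE f) (ε / (M + 1)) (by positivity)
  obtain ⟨δ, hδ, h⟩ := h1
  have key : ∀ s ∈ S, ∀ t ∈ S, s ≤ t → t - s < δ → dist (T s f) (T t f) < ε := by
    intro s hs t ht hst htd
    have h2 : dist (T (t - s) f) f < ε / (M + 1) := by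
      refine h (sub_nonneg.2 hst) ?_
      rwa [Real.dist_eq, sub_zero, abs_of_nonneg (sub_nonneg.2 hst)]
    have e : T t f = T s (T (t - s) f) := by
      rw [← hT.add_apply (hS hs) (sub_nonneg.2 hst), add_sub_cancel]
    rw [dist_comm, dist_eq_norm, e, ← map_sub]
    rw [dist_eq_norm, lt_div_iff₀ (by positivity)] at h2
    have h3 := (T s).le_of_opNorm_le (hM s hs) (T (t - s) f - f)
    nlinarith [norm_nonneg (T (t - s) f - f)]
  refine ⟨δ, hδ, fun s hs hst => ?_⟩
  rw [Real.dist_eq, abs_lt] at hst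
  rcases le_total s t with h' | h'
  · exact key s hs t ht h' (by linarith)
  · rw [dist_comm]; exact key t ht s hs h' (by linarith)

theorem hasDerivWithinAt (hT : IsSemigroupOf T L) {f g : H} (h : (f, g) ∈ L.graph) {t : ℝ}
    (ht : 0 ≤ t) : HasDerivWithinAt (fun t => T t f) (-(T t g)) (Ici t) t := by
  rw [← hasDerivWithinAt_Ioi_iff_Ici, hasDerivWithinAt_iff_tendsto_slope' self_notMem_Ioi]
  have h1 := ((hT.generator _ _).1 (hT.map_graph ht h)).neg
  have h2 : Tendsto (fun s => s - t) (𝓝[>] t) (𝓝[>] 0) := by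
    refine tendsto_nhdsWithin_iff.2 ⟨?_, ?_⟩
    · have : Tendsto (fun s => s - t) (𝓝 t) (𝓝 (t - t)) := tendsto_id.sub_const t
      rw [sub_self] at this
      exact this.mono_left nhdsWithin_le_nhds
    · filter_upwards [self_mem_nhdsWithin] with s (hs : t < s)
      exact sub_pos.2 hs
  refine (h1.comp h2).congr' ?_
  filter_upwards [self_mem_nhdsWithin] with s (hs : t < s)
  rw [Function.comp_apply, ← hT.add_apply (sub_nonneg.2 hs.le) ht, sub_add_cancel, slope_def_module,
    ← smul_neg, neg_sub]

variable [CompleteSpace H]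

/-- For `f ∈ D(L)` and short times the orbit is continuous by the uniform bound and solves a
dissipative equation. Density gives all `f`, and the semigroup law gives all times. -/
theorem norm_le (hT : IsSemigroupOf T L) (hL : IsOmegaAccretive L ω) (hω : ω < Real.pi / 2)
    {t : ℝ} (ht : 0 ≤ t) (f : H) : ‖T t f‖ ≤ ‖f‖ := by
  obtain ⟨δ, hδ, M, hM⟩ := hT.exists_bound
  have h1 : ∀ t ∈ Icc 0 δ, ∀ f g, (f, g) ∈ L.graph → ‖T t f‖ ≤ ‖f‖ := by
    intro t ht f g h
    have h2 := norm_le_of_hasDeriv_right_dissipative (u := fun t => T t f) (v := fun t => T t g)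
      ht.1 (hT.continuousOn_of_bound (S := Icc 0 t) (fun s hs => hs.1)
        (fun s hs => hM s ⟨hs.1, hs.2.trans ht.2⟩) f)
      (fun s hs => hT.hasDerivWithinAt h hs.1)
      (fun s hs => hL.re_inner_nonneg hω (hT.map_graph hs.1 h))
    simpa [hT.apply_zero] using h2
  have h2 : ∀ t ∈ Icc 0 δ, ∀ f, ‖T t f‖ ≤ ‖f‖ := by
    intro t ht f
    have hcl : IsClosed {f | ‖T t f‖ ≤ ‖f‖} :=
      isClosed_le (T t).continuous.norm continuous_norm
    have hsub : (L.domain : Set H) ⊆ {f | ‖T t f‖ ≤ ‖f‖} := fun f hf => by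
      obtain ⟨g, hg⟩ := LinearPMap.mem_domain_iff.1 hf
      exact h1 t ht f g hg
    exact hcl.closure_subset_iff.2 hsub (hL.dense f)
  have h3 : ∀ n : ℕ, ∀ t ∈ Icc 0 δ, ∀ f, ‖T (n * t) f‖ ≤ ‖f‖ := by
    intro n t ht
    induction n with
    | zero => intro f; simp [hT.apply_zero]
    | succ n ih =>
      intro f
      have e : ((n + 1 : ℕ) : ℝ) * t = n * t + t := by push_cast; ring
      rw [e, hT.add_apply (mul_nonneg n.cast_nonneg ht.1) ht.1]
      exact (ih _).trans (h2 t ht f)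
  obtain ⟨n, hn⟩ := exists_nat_gt (t / δ)
  have hn0 : (0 : ℝ) < n := (div_nonneg ht hδ.le).trans_lt hn
  have e : t = n * (t / n) := by field_simp
  rw [e]
  refine h3 n _ ⟨by positivity, ?_⟩ f
  rw [div_le_iff₀ hn0]
  have := (div_lt_iff₀ hδ).1 hn
  linarith

theorem opNorm_le (hT : IsSemigroupOf T L) (hL : IsOmegaAccretive L ω) (hω : ω < Real.pi / 2)
    {t : ℝ} (ht : 0 ≤ t) : ‖T t‖ ≤ 1 :=
  ContinuousLinearMap.opNorm_le_bound _ zero_le_one fun f => by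
    rw [one_mul]; exact hT.norm_le hL hω ht f

theorem continuousOn (hT : IsSemigroupOf T L) (hL : IsOmegaAccretive L ω) (hω : ω < Real.pi / 2)
    (f : H) : ContinuousOn (fun t => T t f) (Ici 0) :=
  hT.continuousOn_of_bound Subset.rfl (fun _ ht => hT.opNorm_le hL hω ht) f

theorem integral_eq_sub (hT : IsSemigroupOf T L) (hL : IsOmegaAccretive L ω)
    (hω : ω < Real.pi / 2) {f g : H} (h : (f, g) ∈ L.graph) {a : ℝ} (ha : 0 ≤ a) :
    ∫ s in (0 : ℝ)..a, T s g = f - T a f := by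
  have hc : ContinuousOn (fun t => T t g) (Icc 0 a) :=
    (hT.continuousOn hL hω g).mono fun s hs => hs.1
  have h1 := intervalIntegral.integral_eq_sub_of_hasDeriv_right_of_le ha
    (f := fun t => T t f) (f' := fun t => -(T t g))
    ((hT.continuousOn hL hω f).mono fun s hs => hs.1)
    (fun s hs => (hT.hasDerivWithinAt h hs.1.le).mono Ioi_subset_Ici_self)
    (hc.neg.intervalIntegrable_of_Icc ha)
  rw [intervalIntegral.integral_neg, hT.apply_zero] at h1
  rw [← neg_sub, ← h1, neg_neg]

end IsSemigroupOf

/-- Cauchy-Schwarz type inequality for a sectorial form. -/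
theorem IsOmegaAccretive.norm_inner_mul_cos_le_add (hL : IsOmegaAccretive L ω)
    (hω : ω < Real.pi / 2) {u w v z : H} (hu : (u, w) ∈ L.graph) (hv : (v, z) ∈ L.graph) :
    ‖inner ℂ v w‖ * Real.cos ω ≤ (inner ℂ u w).re + (inner ℂ v z).re := by
  have hp : ∀ c : ℂ, ‖c‖ = 1 → ‖inner ℂ (u + c • v) (w + c • z)‖ * Real.cos ω ≤
      (inner ℂ (u + c • v) (w + c • z)).re := fun c _ =>
    hL.norm_inner_mul_cos_le hω (graph_add_mem hu (L.graph.smul_mem c hv))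
  have h1 := hp 1 (by simp)
  have h2 := hp (-1) (by simp)
  have h3 := hp Complex.I (by simp)
  have h4 := hp (-Complex.I) (by simp)
  have e : (4 : ℂ) * inner ℂ v w = inner ℂ (u + (1 : ℂ) • v) (w + (1 : ℂ) • z)
      - inner ℂ (u + (-1 : ℂ) • v) (w + (-1 : ℂ) • z)
      + Complex.I * inner ℂ (u + Complex.I • v) (w + Complex.I • z)
      - Complex.I * inner ℂ (u + (-Complex.I) • v) (w + (-Complex.I) • z) := by
    simp only [inner_add_left, inner_add_right, inner_smul_left, inner_smul_right, map_neg,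
      map_one, Complex.conj_I]
    ring_nf
    simp only [Complex.I_sq]
    ring
  have e2 : (inner ℂ (u + (1 : ℂ) • v) (w + (1 : ℂ) • z)).re
      + (inner ℂ (u + (-1 : ℂ) • v) (w + (-1 : ℂ) • z)).re
      + (inner ℂ (u + Complex.I • v) (w + Complex.I • z)).re
      + (inner ℂ (u + (-Complex.I) • v) (w + (-Complex.I) • z)).re =
      4 * ((inner ℂ u w).re + (inner ℂ v z).re) := by
    have e3 : inner ℂ (u + (1 : ℂ) • v) (w + (1 : ℂ) • z)
        + inner ℂ (u + (-1 : ℂ) • v) (w + (-1 : ℂ) • z)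
        + inner ℂ (u + Complex.I • v) (w + Complex.I • z)
        + inner ℂ (u + (-Complex.I) • v) (w + (-Complex.I) • z) =
        ((4 : ℝ) : ℂ) * (inner ℂ u w + inner ℂ v z) := by
      simp only [inner_add_left, inner_add_right, inner_smul_left, inner_smul_right, map_neg,
        map_one, Complex.conj_I]
      ring_nf
      simp only [Complex.I_sq]
      push_cast
      ring
    have e4 := congrArg Complex.re e3
    rw [Complex.re_ofReal_mul] at e4
    simpa only [Complex.add_re] using e4
  have hn : 4 * ‖inner ℂ v w‖ ≤ ‖inner ℂ (u + (1 : ℂ) • v) (w + (1 : ℂ) • z)‖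
      + ‖inner ℂ (u + (-1 : ℂ) • v) (w + (-1 : ℂ) • z)‖
      + ‖inner ℂ (u + Complex.I • v) (w + Complex.I • z)‖
      + ‖inner ℂ (u + (-Complex.I) • v) (w + (-Complex.I) • z)‖ := by
    have : ‖(4 : ℂ) * inner ℂ v w‖ = 4 * ‖inner ℂ v w‖ := by simp
    rw [← this, e]
    refine (norm_sub_le _ _).trans ?_
    refine add_le_add ((norm_add_le _ _).trans (add_le_add (norm_sub_le _ _) ?_)) ?_ <;>
    simp
  have hc : 0 ≤ Real.cos ω ∨ Real.cos ω < 0 := le_or_gt _ _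
  rcases hc with hc | hc
  · nlinarith [mul_le_mul_of_nonneg_right hn hc]
  · have a1 := hL.re_inner_nonneg hω hu
    have a2 := hL.re_inner_nonneg hω hv
    nlinarith [norm_nonneg (inner ℂ v w)]

namespace IsSemigroupOf

variable [CompleteSpace H]

/-- An energy argument with `w = L u`, `z = L w`: the energy `‖T s u‖² + c² ‖T s w‖²` decreases at
rate at least `2c cos ω ‖T s w‖²`, and `‖T s w‖ ≥ ‖T t w‖` for `s ≤ t`. -/
theorem mul_norm_sq_le (hT : IsSemigroupOf T L) (hL : IsOmegaAccretive L ω)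
    (hω : ω < Real.pi / 2) {u w z : H} (hu : (u, w) ∈ L.graph) (hw : (w, z) ∈ L.graph)
    {c t : ℝ} (hc : 0 ≤ c) (hcos : 0 ≤ Real.cos ω) (ht : 0 ≤ t) :
    2 * c * Real.cos ω * t * ‖T t w‖ ^ 2 ≤ ‖u‖ ^ 2 + c ^ 2 * ‖w‖ ^ 2 := by
  let _ : InnerProductSpace ℝ H := InnerProductSpace.rclikeToReal ℂ H
  have hd : ∀ s ∈ Ico 0 t, HasDerivWithinAt (fun s => ‖T s u‖ ^ 2 + c ^ 2 * ‖T s w‖ ^ 2)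
      (2 * inner ℝ (T s u) (-(T s w)) + c ^ 2 * (2 * inner ℝ (T s w) (-(T s z)))) (Ici s) s :=
    fun s hs => (hT.hasDerivWithinAt hu hs.1).norm_sq.add
      ((hT.hasDerivWithinAt hw hs.1).norm_sq.const_mul (c ^ 2))
  have hcu := (hT.continuousOn hL hω u).mono (fun s (hs : s ∈ Icc 0 t) => hs.1)
  have hcw := (hT.continuousOn hL hω w).mono (fun s (hs : s ∈ Icc 0 t) => hs.1)
  have h2 : ‖T t u‖ ^ 2 + c ^ 2 * ‖T t w‖ ^ 2 ≤
      ‖u‖ ^ 2 + c ^ 2 * ‖w‖ ^ 2 - 2 * c * Real.cos ω * ‖T t w‖ ^ 2 * t := by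
    refine image_le_of_deriv_right_le_deriv_boundary
      (f := fun s => ‖T s u‖ ^ 2 + c ^ 2 * ‖T s w‖ ^ 2)
      (B := fun s => ‖u‖ ^ 2 + c ^ 2 * ‖w‖ ^ 2 - 2 * c * Real.cos ω * ‖T t w‖ ^ 2 * s)
      (B' := fun s => - (2 * c * Real.cos ω * ‖T t w‖ ^ 2))
      ((hcu.norm.pow 2).add (continuousOn_const.mul (hcw.norm.pow 2)))
      hd ?_ (by fun_prop) (fun s _ => ?_) (fun s hs => ?_) (right_mem_Icc.2 ht)
    · simp [hT.apply_zero]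
    · have := ((hasDerivAt_id s).const_mul (2 * c * Real.cos ω * ‖T t w‖ ^ 2)).const_sub
        (‖u‖ ^ 2 + c ^ 2 * ‖w‖ ^ 2)
      rw [mul_one] at this
      exact this.hasDerivWithinAt
    · have g1 := hT.map_graph hs.1 hu
      have g2 := hT.map_graph hs.1 hw
      -- The sectorial Cauchy-Schwarz inequality for the pair `T s u`, `c T s w`: its left side is
      -- `c ‖T s w‖² cos ω` because `L T s u = T s w`.
      have h3 := hL.norm_inner_mul_cos_le_add hω g1 (L.graph.smul_mem (c : ℂ) g2)
      simp only at h3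
      rw [inner_smul_left, inner_smul_left, inner_smul_right, inner_self_eq_norm_sq_to_K] at h3
      have h4 : ‖T t w‖ ≤ ‖T s w‖ := by
        have e : T t w = T (t - s) (T s w) := by
          rw [← hT.add_apply (sub_nonneg.2 hs.2.le) hs.1, sub_add_cancel]
        rw [e]
        exact hT.norm_le hL hω (sub_nonneg.2 hs.2.le) _
      have h5 : c * ‖T s w‖ ^ 2 * Real.cos ω ≤
          (inner ℂ (T s u) (T s w)).re + c ^ 2 * (inner ℂ (T s w) (T s z)).re := by
        have e1 : ‖(starRingEnd ℂ) (c : ℂ) * (((‖T s w‖ : ℝ) : ℂ)) ^ 2‖ = c * ‖T s w‖ ^ 2 := by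
          simp [abs_of_nonneg hc]
        have e2 : ((starRingEnd ℂ) (c : ℂ) * ((c : ℂ) * inner ℂ (T s w) (T s z))).re =
            c ^ 2 * (inner ℂ (T s w) (T s z)).re := by
          simp; ring
        rw [e2] at h3
        exact e1 ▸ h3
      rw [inner_neg_right, inner_neg_right]
      change 2 * -(inner ℂ (T s u) (T s w)).re + c ^ 2 * (2 * -(inner ℂ (T s w) (T s z)).re) ≤ _
      have h6 : c * Real.cos ω * ‖T t w‖ ^ 2 ≤ c * Real.cos ω * ‖T s w‖ ^ 2 := by gcongr
      nlinarith
  have : 0 ≤ ‖T t u‖ ^ 2 + c ^ 2 * ‖T t w‖ ^ 2 := by positivity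
  linarith

/-- The energy bound with the optimal parameter `c = ‖u‖ / ‖w‖`. -/
theorem cos_mul_norm_sq_le (hT : IsSemigroupOf T L) (hL : IsOmegaAccretive L ω)
    (hω : ω < Real.pi / 2) {u w z : H} (hu : (u, w) ∈ L.graph) (hw : (w, z) ∈ L.graph)
    {t : ℝ} (hcos : 0 ≤ Real.cos ω) (ht : 0 ≤ t) :
    Real.cos ω * t * ‖T t w‖ ^ 2 ≤ ‖u‖ * ‖w‖ := by
  rcases eq_or_ne w 0 with rfl | hw0
  · simp
  rcases eq_or_ne u 0 with rfl | hu0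
  · exact absurd (L.graph_fst_eq_zero_snd hu rfl) hw0
  have hw' : 0 < ‖w‖ := norm_pos_iff.2 hw0
  have hu' : 0 < ‖u‖ := norm_pos_iff.2 hu0
  have h := hT.mul_norm_sq_le hL hω hu hw (c := ‖u‖ / ‖w‖) (by positivity) hcos ht
  have e : ‖u‖ ^ 2 + (‖u‖ / ‖w‖) ^ 2 * ‖w‖ ^ 2 = 2 * (‖u‖ / ‖w‖) * (‖u‖ * ‖w‖) := by
    field_simp; ring
  rw [e] at h
  have h2 : 2 * (‖u‖ / ‖w‖) * (Real.cos ω * t * ‖T t w‖ ^ 2) ≤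
      2 * (‖u‖ / ‖w‖) * (‖u‖ * ‖w‖) := by linarith
  exact le_of_mul_le_mul_left h2 (by positivity)

/-- For `φ(t) = t ‖T t L f‖` the previous bound at time `t/2` gives `φ(t)² ≤ A φ(t/2)`. Iterating
yields `φ(t) ≤ max A (t ‖g‖ / 2^n)` for every `n`, and the second entry tends to 0. -/
theorem norm_generator_le_of_sq (hT : IsSemigroupOf T L) (hL : IsOmegaAccretive L ω)
    (hω : ω < Real.pi / 2) (hcos : 0 < Real.cos ω) {f g z : H} (hf : (f, g) ∈ L.graph)
    (hg : (g, z) ∈ L.graph) {t : ℝ} (ht : 0 < t) :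
    t * ‖T t g‖ ≤ 4 / Real.cos ω * ‖f‖ := by
  set A := 4 / Real.cos ω * ‖f‖
  have hA : 0 ≤ A := by positivity
  have hstep : ∀ t, 0 < t → (t * ‖T t g‖) ^ 2 ≤ A * (t / 2 * ‖T (t / 2) g‖) := by
    intro t ht
    have ht2 : 0 ≤ t / 2 := by positivity
    have h1 := hT.cos_mul_norm_sq_le hL hω (hT.map_graph ht2 hf) (hT.map_graph ht2 hg) hcos.le ht2
    rw [← hT.add_apply ht2 ht2, add_halves] at h1
    have h2 : Real.cos ω * (t / 2) * ‖T t g‖ ^ 2 ≤ ‖f‖ * ‖T (t / 2) g‖ :=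
      h1.trans (by gcongr; exact hT.norm_le hL hω ht2 f)
    have h3 : (t * ‖T t g‖) ^ 2 = 2 * t / Real.cos ω * (Real.cos ω * (t / 2) * ‖T t g‖ ^ 2) := by
      field_simp
    have h4 : A * (t / 2 * ‖T (t / 2) g‖) = 2 * t / Real.cos ω * (‖f‖ * ‖T (t / 2) g‖) := by
      simp only [A]; field_simp; ring
    rw [h3, h4]
    gcongr
  have hind : ∀ n : ℕ, ∀ t, 0 < t → t * ‖T t g‖ ≤ max A (t * ‖g‖ / 2 ^ n) := by
    intro n
    induction n with
    | zero =>
      intro t ht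
      refine le_max_of_le_right ?_
      rw [pow_zero, div_one]
      gcongr
      exact hT.norm_le hL hω ht.le g
    | succ n ih =>
      intro t ht
      have h1 := ih (t / 2) (by positivity)
      have e : t / 2 * ‖g‖ / 2 ^ n = t * ‖g‖ / 2 ^ (n + 1) := by rw [pow_succ]; field_simp
      rw [e] at h1
      set m := max A (t * ‖g‖ / 2 ^ (n + 1))
      have hm : A ≤ m := le_max_left _ _
      have h2 : (t * ‖T t g‖) ^ 2 ≤ m ^ 2 := by
        refine (hstep t ht).trans ?_
        rw [sq]
        exact mul_le_mul hm h1 (by positivity) (hA.trans hm)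
      exact le_of_sq_le_sq h2 (hA.trans hm)
  have hlim : Tendsto (fun n : ℕ => max A (t * ‖g‖ / 2 ^ n)) atTop (𝓝 (max A 0)) :=
    tendsto_const_nhds.max (tendsto_const_nhds.div_atTop
      (tendsto_pow_atTop_atTop_of_one_lt one_lt_two))
  rw [max_eq_left hA] at hlim
  exact ge_of_tendsto' hlim fun n => hind n t ht

/-- Replacing `f`, `g` by `lam R f`, `lam R g` with `lam → ∞` removes the requirement `g ∈ D(L)`. -/
theorem norm_generator_le (hT : IsSemigroupOf T L) (hL : IsOmegaAccretive L ω)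
    (hω : ω < Real.pi / 2) (hcos : 0 < Real.cos ω) {f g : H} (hf : (f, g) ∈ L.graph)
    {t : ℝ} (ht : 0 < t) : t * ‖T t g‖ ≤ 4 / Real.cos ω * ‖f‖ := by
  have hlim : Tendsto (fun n : ℕ => (n : ℝ) + 1) atTop atTop :=
    tendsto_atTop_add_const_right _ _ tendsto_natCast_atTop_atTop
  have hl : ∀ n : ℕ, (0 : ℝ) < (n : ℝ) + 1 := fun n => Nat.cast_add_one_pos n
  have h1 := hL.tendsto_smul_resolventCLM hω hl hlim f
  have h2 := hL.tendsto_smul_resolventCLM hω hl hlim g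
  refine le_of_tendsto_of_tendsto' ((((T t).continuous.tendsto _).comp h2).norm.const_mul t)
    (h1.norm.const_mul _) fun n => ?_
  refine hT.norm_generator_le_of_sq hL hω hcos
    (real_smul_mem_graph (hL.resolventCLM_graph hω (hl n) hf) _)
    (real_smul_mem_graph (hL.resolventCLM_mem_graph hω (hl n) g) _) ht

/-- Analyticity of the semigroup of a maximal sectorial operator. -/
theorem exists_generator (hT : IsSemigroupOf T L) (hL : IsOmegaAccretive L ω)
    (hω : ω < Real.pi / 2) (hcos : 0 < Real.cos ω) {t : ℝ} (ht : 0 < t) (f : H) :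
    ∃ g, (T t f, g) ∈ L.graph ∧ ‖g‖ ≤ 4 / Real.cos ω / t * ‖f‖ := by
  have hlim : Tendsto (fun n : ℕ => (n : ℝ) + 1) atTop atTop :=
    tendsto_atTop_add_const_right _ _ tendsto_natCast_atTop_atTop
  have hl : ∀ n : ℕ, (0 : ℝ) < (n : ℝ) + 1 := fun n => Nat.cast_add_one_pos n
  have h1 := hL.tendsto_smul_resolventCLM hω hl hlim f
  have hmem : ∀ n : ℕ, ∃ g, (((n : ℝ) + 1) • hL.resolventCLM hω (hl n) f, g) ∈ L.graph :=
    fun n => ⟨_, real_smul_mem_graph (hL.resolventCLM_mem_graph hω (hl n) f) _⟩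
  choose g hg using hmem
  have hb : ∀ {u v}, (u, v) ∈ L.graph → ‖T t v‖ ≤ 4 / Real.cos ω / t * ‖u‖ := by
    intro u v h
    rw [div_mul_eq_mul_div, le_div_iff₀ ht, mul_comm]
    exact hT.norm_generator_le hL hω hcos h ht
  have hK : 0 < 4 / Real.cos ω / t := by positivity
  -- The vectors `(n + 1) R f` lie in D(L) and tend to `f`. The bound on D(L) makes their images
  -- under `T t L` Cauchy, and closedness of L identifies the limit.
  have hcau : CauchySeq fun n => T t (g n) := by
    rw [Metric.cauchySeq_iff]
    intro ε hε
    obtain ⟨N, hN⟩ := Metric.cauchySeq_iff.1 h1.cauchySeq (ε / (4 / Real.cos ω / t))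
      (by positivity)
    refine ⟨N, fun m hm n hn => ?_⟩
    have h3 := hN m hm n hn
    have h4 := hb (graph_sub_mem (hg m) (hg n))
    rw [dist_eq_norm, lt_div_iff₀ hK] at h3
    rw [dist_eq_norm, ← map_sub]
    linarith
  obtain ⟨v, hv⟩ := cauchySeq_tendsto_of_complete hcau
  refine ⟨v, ?_, ?_⟩
  · refine hL.closed.mem_of_tendsto ((((T t).continuous.tendsto _).comp h1).prodMk_nhds hv)
      (Eventually.of_forall fun n => hT.map_graph ht.le (hg n))
  · exact le_of_tendsto_of_tendsto' hv.norm (h1.norm.const_mul _) fun n => hb (hg n)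

end IsSemigroupOf

end Semigroup

end Caccioppoli

namespace Caccioppoli

/-! ### The square root is bounded in the graph norm. -/

section SquareRoot

variable {H : Type*} [NormedAddCommGroup H] [InnerProductSpace ℂ H] {L : H →ₗ.[ℂ] H} {ω : ℝ}

/-- With `u = (lam + L)⁻¹ L f`, the first bound is the resolvent bound; the second comes from `u - f
= -lam (lam + L)⁻¹ f`. They serve the integral for `L^{1/2}` at infinity and at 0 respectively. -/
theorem IsOmegaAccretive.norm_negResolvent_le (hL : IsOmegaAccretive L ω)
    (hω : ω < Real.pi / 2) (f : L.domain) {lam : ℝ} (hl : 0 < lam) :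
    lam * ‖negResolvent L lam (L f)‖ ≤ ‖L f‖ ∧ ‖negResolvent L lam (L f)‖ ≤ 2 * ‖(f : H)‖ := by
  rw [negResolvent]
  split_ifs with h
  · set u := h.choose
    have hu : lam • (u : H) + L u = L f := h.choose_spec
    have h1 := hL.mul_norm_le hω (L.mem_graph u) lam
    rw [hu] at h1
    refine ⟨h1, ?_⟩
    have h2 := hL.mul_norm_le hω (graph_sub_mem (L.mem_graph u) (L.mem_graph f)) lam
    have e : lam • ((u : H) - f) + (L u - L f) = -(lam • (f : H)) := by
      rw [← hu]; module
    rw [e, norm_neg, norm_smul, Real.norm_of_nonneg hl.le] at h2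
    have h3 := le_of_mul_le_mul_left h2 hl
    have h4 := norm_sub_norm_le (u : H) f
    linarith
  · simp

theorem IsOmegaAccretive.exists_norm_sqrtOp_le (hL : IsOmegaAccretive L ω)
    (hω : ω < Real.pi / 2) :
    ∃ C : ℝ, 0 ≤ C ∧ ∀ f : L.domain, ‖sqrtOp L f‖ ≤ C * (‖(f : H)‖ + ‖L f‖) := by
  set k : ℝ → ℝ := fun lam => (Ioc (0 : ℝ) 1).indicator (fun x => x ^ (-(1 / 2) : ℝ)) lam +
    (Ioi (1 : ℝ)).indicator (fun x => x ^ (-(3 / 2) : ℝ)) lam with hk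
  have hk0 : ∀ lam, 0 ≤ k lam := by
    intro lam
    refine add_nonneg (indicator_nonneg (fun x hx => Real.rpow_nonneg hx.1.le _) _)
      (indicator_nonneg (fun x hx => Real.rpow_nonneg (zero_le_one.trans (le_of_lt hx)) _) _)
  have hki : Integrable k (volume.restrict (Ioi 0)) := by
    refine (Integrable.add ?_ ?_).restrict
    · rw [integrable_indicator_iff measurableSet_Ioc]
      exact (intervalIntegrable_iff_integrableOn_Ioc_of_le zero_le_one).1
        (intervalIntegral.intervalIntegrable_rpow' (by norm_num))
    · rw [integrable_indicator_iff measurableSet_Ioi]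
      exact integrableOn_Ioi_rpow_of_lt (by norm_num) one_pos
  refine ⟨2 * ((1 / Real.pi) * ∫ lam in Ioi (0 : ℝ), k lam), ?_, fun f => ?_⟩
  · have : 0 ≤ ∫ lam in Ioi (0 : ℝ), k lam := integral_nonneg hk0
    positivity
  rw [sqrtOp, norm_smul, Real.norm_of_nonneg (by positivity : 0 ≤ 1 / Real.pi)]
  have h1 : ‖∫ lam in Ioi (0 : ℝ), (lam ^ (-(1 / 2) : ℝ)) • negResolvent L lam (L f)‖ ≤
      ∫ lam in Ioi (0 : ℝ), k lam * (2 * (‖(f : H)‖ + ‖L f‖)) := by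
    refine norm_integral_le_of_norm_le (hki.mul_const _) ?_
    refine (ae_restrict_iff' measurableSet_Ioi).2 (Eventually.of_forall fun lam hlam => ?_)
    have hl : (0 : ℝ) < lam := hlam
    obtain ⟨h2, h3⟩ := hL.norm_negResolvent_le hω f hl
    have hp : 0 ≤ lam ^ (-(1 / 2) : ℝ) := Real.rpow_nonneg hl.le _
    rw [norm_smul, Real.norm_of_nonneg hp]
    rcases le_or_gt lam 1 with h | h
    · have e : k lam = lam ^ (-(1 / 2) : ℝ) := by
        simp only [hk]
        rw [indicator_of_mem (show lam ∈ Ioc (0 : ℝ) 1 from ⟨hl, h⟩),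
          indicator_of_notMem (by simpa using h), add_zero]
      rw [e]
      gcongr
      linarith [norm_nonneg (L f)]
    · have e : k lam = lam ^ (-(1 / 2) : ℝ) * lam⁻¹ := by
        simp only [hk]
        rw [indicator_of_notMem (by simp [h]), indicator_of_mem (by simpa using h), zero_add,
          ← Real.rpow_neg_one lam, ← Real.rpow_add hl]
        norm_num
      rw [e, mul_assoc]
      gcongr
      rw [inv_mul_eq_div, le_div_iff₀ hl, mul_comm]
      linarith [norm_nonneg (f : H), norm_nonneg (L f)]
  rw [integral_mul_const] at h1
  calc _ ≤ 1 / Real.pi * ((∫ lam in Ioi (0 : ℝ), k lam) * (2 * (‖(f : H)‖ + ‖L f‖))) := by gcongr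
    _ = _ := by ring

end SquareRoot

section Powers

variable {H : Type*} [NormedAddCommGroup H] [InnerProductSpace ℂ H] {L : H →ₗ.[ℂ] H}

theorem opPow_succ_mem_graph {M : ℕ} (f : (opPow L (M + 1)).domain) :
    ∃ hf : (f : H) ∈ (opPow L M).domain,
      (opPow L M ⟨f, hf⟩, opPow L (M + 1) f) ∈ L.graph := by
  obtain ⟨f, hf⟩ := f
  obtain ⟨h1, h2⟩ := hf
  exact ⟨h1, L.mem_graph_iff.2 ⟨⟨_, h2⟩, rfl, rfl⟩⟩

theorem opPow_domain_le {M : ℕ} (hM : 1 ≤ M) : (opPow L M).domain ≤ L.domain := by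
  induction M, hM using Nat.le_induction with
  | base =>
    rintro f ⟨h1, h2⟩
    exact h2
  | succ M hM ih =>
    rintro f ⟨h1, h2⟩
    exact ih h1

end Powers

/-! ### Graph seminorms and the reproducing estimate. -/

section GraphSeminorm

variable {H : Type*} [NormedAddCommGroup H] [InnerProductSpace ℂ H] {L : H →ₗ.[ℂ] H} {ω : ℝ}
  {T : ℝ → H →L[ℂ] H} {Ψ : H → ℝ≥0∞}

/-- An extended seminorm on `D(L)` that is lower semicontinuous for the graph norm. -/
structure IsGraphSeminorm (L : H →ₗ.[ℂ] H) (Ψ : H → ℝ≥0∞) : Prop where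
  add : ∀ u ∈ L.domain, ∀ v ∈ L.domain, Ψ (u + v) ≤ Ψ u + Ψ v
  smul : ∀ (c : ℂ), ∀ u ∈ L.domain, Ψ (c • u) ≤ ‖c‖ₑ * Ψ u
  lsc : ∀ (u w : ℕ → H) (u' w' : H), (∀ n, (u n, w n) ∈ L.graph) → (u', w') ∈ L.graph →
    Tendsto u atTop (𝓝 u') → Tendsto w atTop (𝓝 w') → ∀ c, (∀ n, Ψ (u n) ≤ c) → Ψ u' ≤ c

namespace IsGraphSeminorm

theorem map_zero (hΨ : IsGraphSeminorm L Ψ) : Ψ 0 = 0 := by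
  have := hΨ.smul 0 0 L.domain.zero_mem
  simpa using this

theorem sum_smul_le (hΨ : IsGraphSeminorm L Ψ) {ι : Type*} (s : Finset ι) (c : ι → ℂ)
    (u : ι → H) (hu : ∀ i ∈ s, u i ∈ L.domain) :
    Ψ (∑ i ∈ s, c i • u i) ≤ ∑ i ∈ s, ‖c i‖ₑ * Ψ (u i) := by
  classical
  induction s using Finset.induction_on with
  | empty => simp [hΨ.map_zero]
  | insert i s hi ih =>
    rw [Finset.sum_insert hi, Finset.sum_insert hi]
    have h1 := hu i (Finset.mem_insert_self _ _)
    have h2 : ∀ j ∈ s, u j ∈ L.domain := fun j hj => hu j (Finset.mem_insert_of_mem hj)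
    refine (hΨ.add _ (L.domain.smul_mem _ h1) _
      (L.domain.sum_mem fun j hj => L.domain.smul_mem _ (h2 j hj))).trans ?_
    exact add_le_add (hΨ.smul _ _ h1) (ih h2)

variable [CompleteSpace H]

/-- By analyticity `z ↦ T t z` is continuous from H to D(L) with the graph norm, so lower
semicontinuity of `Ψ` in that norm suffices. -/
theorem isClosed_sublevel (hΨ : IsGraphSeminorm L Ψ) (hT : IsSemigroupOf T L)
    (hL : IsOmegaAccretive L ω) (hω : ω < Real.pi / 2) (hcos : 0 < Real.cos ω) {t : ℝ}
    (ht : 0 < t) (c : ℝ≥0∞) : IsClosed {z | Ψ (T t z) ≤ c} := by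
  refine IsSeqClosed.isClosed fun z z' hz hlim => ?_
  choose G hG hGn using hT.exists_generator hL hω hcos ht
  refine hΨ.lsc (fun n => T t (z n)) (fun n => G (z n)) (T t z') (G z') (fun n => hG _) (hG _)
    (((T t).continuous.tendsto _).comp hlim) ?_ c hz
  rw [tendsto_iff_norm_sub_tendsto_zero] at hlim ⊢
  refine squeeze_zero (fun _ => norm_nonneg _) (fun n => ?_)
    (by simpa using hlim.const_mul (4 / Real.cos ω / t))
  have h1 : G (z n) - G z' = G (z n - z') := by
    refine L.mem_graph_snd_inj (graph_sub_mem (hG (z n)) (hG z')) (hG _) ?_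
    rw [map_sub]
  rw [h1]
  exact hGn _

theorem apply_mem_domain (hT : IsSemigroupOf T L)
    (hL : IsOmegaAccretive L ω) (hω : ω < Real.pi / 2) (hcos : 0 < Real.cos ω) {t : ℝ}
    (ht : 0 < t) (z : H) : T t z ∈ L.domain := by
  obtain ⟨g, hg, -⟩ := hT.exists_generator hL hω hcos ht z
  exact LinearPMap.mem_domain_iff.2 ⟨g, hg⟩

theorem convex_sublevel (hΨ : IsGraphSeminorm L Ψ) (hT : IsSemigroupOf T L)
    (hL : IsOmegaAccretive L ω) (hω : ω < Real.pi / 2) (hcos : 0 < Real.cos ω) {t : ℝ}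
    (ht : 0 < t) (c : ℝ≥0∞) : Convex ℝ {z | Ψ (T t z) ≤ c} := by
  intro x hx y hy a b ha hb hab
  have hm := apply_mem_domain hT hL hω hcos ht
  have e : T t (a • x + b • y) = (a : ℂ) • T t x + (b : ℂ) • T t y := by
    rw [map_add, ContinuousLinearMap.map_smul_of_tower, ContinuousLinearMap.map_smul_of_tower]
    rfl
  have hn : ∀ r : ℝ, 0 ≤ r → ‖(r : ℂ)‖ₑ = ENNReal.ofReal r := fun r hr => by
    rw [← ofReal_norm, Complex.norm_real, Real.norm_of_nonneg hr]
  change Ψ _ ≤ c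
  rw [e]
  calc _ ≤ Ψ ((a : ℂ) • T t x) + Ψ ((b : ℂ) • T t y) :=
        hΨ.add _ (L.domain.smul_mem _ (hm x)) _ (L.domain.smul_mem _ (hm y))
    _ ≤ ‖(a : ℂ)‖ₑ * Ψ (T t x) + ‖(b : ℂ)‖ₑ * Ψ (T t y) :=
        add_le_add (hΨ.smul _ _ (hm x)) (hΨ.smul _ _ (hm y))
    _ ≤ ENNReal.ofReal a * c + ENNReal.ofReal b * c := by
        rw [hn a ha, hn b hb]
        gcongr
        exacts [hx, hy]
    _ = c := by rw [← add_mul, ← ENNReal.ofReal_add ha hb, hab, ENNReal.ofReal_one, one_mul]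

end IsGraphSeminorm

theorem IsSemigroupOf.pow_apply (hT : IsSemigroupOf T L) {a : ℝ} (ha : 0 ≤ a) (m : ℕ) :
    T a ^ m = T (m * a) := by
  induction m with
  | zero => simp [hT.zero]; rfl
  | succ m ih =>
    rw [pow_succ, ih, Nat.cast_succ, add_mul, one_mul, hT.add _ _ (by positivity) ha]
    rfl

variable [CompleteSpace H]

/-- `(1 - T a)^M f` is an average of the vectors `a^M T σ L^M f`, `0 ≤ σ ≤ M a`. -/
theorem IsSemigroupOf.one_sub_pow_mem (hT : IsSemigroupOf T L) (hL : IsOmegaAccretive L ω)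
    (hω : ω < Real.pi / 2) {a : ℝ} (ha : 0 < a) (M : ℕ) :
    ∀ {K : Set H}, IsClosed K → Convex ℝ K → ∀ f : (opPow L M).domain,
      (∀ σ ∈ Icc 0 (M * a), a ^ M • T σ (opPow L M f) ∈ K) → ((1 - T a) ^ M) (f : H) ∈ K := by
  induction M with
  | zero =>
    intro K _ _ f h
    have := h 0 (by simp)
    rw [pow_zero, one_smul, hT.apply_zero] at this
    exact this
  | succ M ih =>
    intro K hK hKc f h
    obtain ⟨hf, hg⟩ := opPow_succ_mem_graph f
    -- The induction runs over all closed convex sets; the new factor `1 - T a` is absorbed into its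
    -- preimage of `K`.
    have key := ih (K := (fun z => (1 - T a) z) ⁻¹' K)
      (hK.preimage (1 - T a).continuous)
      (hKc.is_linear_preimage (((1 - T a : H →L[ℂ] H) : H →ₗ[ℂ] H).restrictScalars ℝ).isLinear)
      ⟨f, hf⟩ fun σ hσ => ?_
    · rw [pow_succ']
      exact key
    · set u := opPow L M ⟨f, hf⟩
      set w := opPow L (M + 1) f
      have h1 := hT.integral_eq_sub hL hω (hT.map_graph hσ.1 hg) ha.le
      -- `(1 - T a) T σ u` is the integral of `T (s + σ) L u` over `[0, a]`, that is, `a` times an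
      -- average, and `K` contains averages of its elements.
      have h2 : (1 - T a) (a ^ M • T σ u) = ⨍ s in Icc 0 a, a ^ (M + 1) • T (s + σ) w := by
        rw [setAverage_eq, Real.volume_real_Icc_of_le ha.le, sub_zero, integral_Icc_eq_integral_Ioc,
          ← intervalIntegral.integral_of_le ha.le, intervalIntegral.integral_smul, smul_smul,
          pow_succ, mul_comm _ a, ← mul_assoc, inv_mul_cancel₀ ha.ne', one_mul,
          ContinuousLinearMap.map_smul_of_tower]
        congr 1
        change T σ u - T a (T σ u) = _
        rw [← h1]
        refine intervalIntegral.integral_congr fun s hs => ?_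
        rw [uIcc_of_le ha.le] at hs
        exact (hT.add_apply hs.1 hσ.1 w).symm
      have hcont : ContinuousOn (fun s => a ^ (M + 1) • T (s + σ) w) (Icc 0 a) :=
        continuousOn_const.smul ((hT.continuousOn hL hω w).comp (by fun_prop)
          fun s hs => add_nonneg hs.1 hσ.1)
      change (1 - T a) (a ^ M • T σ u) ∈ K
      rw [h2]
      refine hKc.set_average_mem hK ?_ ?_ ?_ (hcont.integrableOn_Icc)
      · simp [ha]
      · simp
      · refine (ae_restrict_iff' measurableSet_Icc).2 (Eventually.of_forall fun s hs => ?_)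
        refine h _ ⟨add_nonneg hs.1 hσ.1, ?_⟩
        push_cast
        linarith [hs.2, hσ.2]

/-- Factor `1 - y² = (1 + y)(1 - y)` and expand `(1 + y)^M`. With `y = T a`, so that `T (2a) = y²`,
every term keeps a factor `T ((m + 1) a)`, which maps into D(L). -/
theorem one_sub_sq_pow_sub {R : Type*} [Ring R] (y : R) (M : ℕ) :
    (1 - y ^ 2) ^ M - (1 - y) ^ M =
      ∑ m ∈ Finset.range M, (M.choose (m + 1) : R) * (y ^ (m + 1) * (1 - y) ^ M) := by
  have hc : Commute (1 + y) (1 - y) := by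
    refine Commute.sub_right (Commute.one_right _) ?_
    exact (Commute.one_left y).add_left (Commute.refl y)
  have h1 : 1 - y ^ 2 = (1 + y) * (1 - y) := by noncomm_ring
  have h2 : (1 + y) ^ M = ∑ m ∈ Finset.range M, (M.choose (m + 1) : R) * y ^ (m + 1) + 1 := by
    rw [add_comm 1 y, (Commute.one_right y).add_pow, Finset.sum_range_succ']
    simp only [one_pow, mul_one, pow_zero, Nat.choose_zero_right, Nat.cast_one]
    congr 1
    exact Finset.sum_congr rfl fun m _ => (Nat.cast_commute _ _).symm
  rw [h1, hc.mul_pow, h2, add_mul, one_mul, add_sub_cancel_right, Finset.sum_mul]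
  exact Finset.sum_congr rfl fun m _ => mul_assoc _ _ _

theorem one_sub_one_sub_pow {R : Type*} [Ring R] (y : R) (M : ℕ) :
    1 - (1 - y) ^ M =
      ∑ m ∈ Finset.range M, ((-1) ^ m * M.choose (m + 1) : ℤ) • y ^ (m + 1) := by
  have h2 : (1 - y) ^ M =
      ∑ m ∈ Finset.range M, (-1) ^ (m + 1) * y ^ (m + 1) * (M.choose (m + 1) : R) + 1 := by
    rw [sub_eq_neg_add, (Commute.one_right (-y)).add_pow, Finset.sum_range_succ']
    simp only [one_pow, mul_one, pow_zero, Nat.choose_zero_right, Nat.cast_one, neg_pow y]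
  rw [h2, sub_add_cancel_right, ← Finset.sum_neg_distrib]
  refine Finset.sum_congr rfl fun m _ => ?_
  rw [zsmul_eq_mul, pow_succ (-1 : R)]
  push_cast
  rw [mul_assoc ((-1) ^ m) _ _, mul_assoc _ (M.choose (m + 1) : R), (Nat.cast_commute _ _).eq]
  noncomm_ring

theorem sum_choose_succ_le (M : ℕ) :
    ∑ m ∈ Finset.range M, ((M.choose (m + 1) : ℕ) : ℝ≥0∞) ≤ 2 ^ M := by
  have h : ∑ m ∈ Finset.range M, M.choose (m + 1) ≤ 2 ^ M := by
    rw [← Nat.sum_range_choose, Finset.sum_range_succ']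
    exact Nat.le_add_right _ _
  exact_mod_cast h

end GraphSeminorm

end Caccioppoli

namespace Caccioppoli

section

variable {H : Type*} [NormedAddCommGroup H] [InnerProductSpace ℂ H] {L : H →ₗ.[ℂ] H} {ω : ℝ}
  {T : ℝ → H →L[ℂ] H} {Ψ : H → ℝ≥0∞}

theorem IsSemigroupOf.one_sub_pow_mem_graph (hT : IsSemigroupOf T L) {a : ℝ} (ha : 0 ≤ a) (m : ℕ)
    {f g : H} (h : (f, g) ∈ L.graph) :
    (((1 - T a) ^ m) f, ((1 - T a) ^ m) g) ∈ L.graph := by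
  induction m with
  | zero => simpa using h
  | succ m ih =>
    rw [pow_succ']
    exact graph_sub_mem ih (hT.map_graph ha ih)

variable [CompleteSpace H]

theorem IsSemigroupOf.norm_one_sub_pow_le (hT : IsSemigroupOf T L) (hL : IsOmegaAccretive L ω)
    (hω : ω < Real.pi / 2) {a : ℝ} (ha : 0 ≤ a) (m : ℕ) (v : H) :
    ‖((1 - T a) ^ m) v‖ ≤ 2 ^ m * ‖v‖ := by
  induction m generalizing v with
  | zero => simp
  | succ m ih =>
    rw [pow_succ (1 - T a)]
    refine (ih ((1 - T a) v)).trans ?_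
    have h1 : ‖(1 - T a) v‖ ≤ 2 * ‖v‖ :=
      (norm_sub_le v (T a v)).trans (by linarith [hT.norm_le hL hω ha v])
    rw [pow_succ (2 : ℝ), mul_assoc]
    gcongr

theorem IsSemigroupOf.tendsto_one_sub_pow (hT : IsSemigroupOf T L) (hL : IsOmegaAccretive L ω)
    (hω : ω < Real.pi / 2) {M : ℕ} (hM : 1 ≤ M) {a : ℕ → ℝ} (ha : ∀ n, 0 < a n)
    (hlim : Tendsto a atTop (𝓝 0)) (v : H) :
    Tendsto (fun n => ((1 - T (a n)) ^ M) v) atTop (𝓝 0) := by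
  obtain ⟨m, rfl⟩ : ∃ m, M = m + 1 := ⟨M - 1, by omega⟩
  have h1 : Tendsto (fun n => T (a n) v) atTop (𝓝 v) :=
    (hT.cont v).comp (tendsto_nhdsWithin_iff.2 ⟨hlim, Eventually.of_forall ha⟩)
  have h2 := ((h1.const_sub v).norm).const_mul (2 ^ m)
  rw [sub_self, norm_zero, mul_zero] at h2
  refine squeeze_zero_norm (fun n => ?_) h2
  rw [pow_succ (1 - T (a n))]
  exact hT.norm_one_sub_pow_le hL hω (ha n).le m _

/-- The difference is a binomial combination of `T ((m + 1) a) (1 - T a)^M f`, and `(1 - T a)^M f`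
is an average of `a^M T σ L^M f` with `σ ≤ Ma`. The total time stays in `[a, 2Ma]`. -/
theorem IsGraphSeminorm.one_sub_pow_sub_le (hΨ : IsGraphSeminorm L Ψ) (hT : IsSemigroupOf T L)
    (hL : IsOmegaAccretive L ω) (hω : ω < Real.pi / 2) (hcos : 0 < Real.cos ω) {M : ℕ}
    (f : (opPow L M).domain) {a : ℝ} (ha : 0 < a) {b : ℝ≥0∞}
    (hb : ∀ σ ∈ Icc a (2 * M * a), Ψ (T σ (opPow L M f)) ≤ b) :
    Ψ (((1 - T (2 * a)) ^ M) (f : H) - ((1 - T a) ^ M) (f : H)) ≤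
      2 ^ M * (ENNReal.ofReal (a ^ M) * b) := by
  have h2 : T (2 * a) = T a ^ 2 := by rw [hT.pow_apply ha.le]; norm_num
  have h3 : ((1 - T (2 * a)) ^ M) (f : H) - ((1 - T a) ^ M) (f : H) =
      ∑ m ∈ Finset.range M, (M.choose (m + 1) : ℂ) •
        T ((m + 1 : ℕ) * a) (((1 - T a) ^ M) (f : H)) := by
    have := congrArg (fun F : H →L[ℂ] H => F f) (one_sub_sq_pow_sub (T a) M)
    rw [← h2] at this
    simp only [sum_apply, sub_apply] at this
    rw [this]
    refine Finset.sum_congr rfl fun m _ => ?_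
    rw [← hT.pow_apply ha.le, Nat.cast_smul_eq_nsmul ℂ, ← nsmul_eq_mul]
    rfl
  have hpos : ∀ m : ℕ, 0 < ((m + 1 : ℕ) : ℝ) * a := fun m => by positivity
  have hmem := fun m : ℕ =>
    apply_mem_domain hT hL hω hcos (hpos m) (((1 - T a) ^ M) (f : H))
  rw [h3]
  refine (hΨ.sum_smul_le _ _ _ fun m _ => hmem m).trans ?_
  calc _ ≤ ∑ m ∈ Finset.range M, ((M.choose (m + 1) : ℕ) : ℝ≥0∞) *
        (ENNReal.ofReal (a ^ M) * b) := by
        refine Finset.sum_le_sum fun m hm => ?_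
        have hmM : m + 1 ≤ M := Finset.mem_range.1 hm
        have e : ‖(M.choose (m + 1) : ℂ)‖ₑ = (M.choose (m + 1) : ℕ) := by
          rw [← ofReal_norm, Complex.norm_natCast, ENNReal.ofReal_natCast]
        rw [e]
        gcongr
        refine hT.one_sub_pow_mem hL hω ha M
          (hΨ.isClosed_sublevel hT hL hω hcos (hpos m) _)
          (hΨ.convex_sublevel hT hL hω hcos (hpos m) _) f fun σ hσ => ?_
        have e2 : T ((m + 1 : ℕ) * a) (a ^ M • T σ (opPow L M f)) =
            ((a ^ M : ℝ) : ℂ) • T ((m + 1 : ℕ) * a + σ) (opPow L M f) := by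
          rw [ContinuousLinearMap.map_smul_of_tower, hT.add_apply (hpos m).le hσ.1]
          rfl
        change Ψ _ ≤ _
        rw [e2]
        refine (hΨ.smul _ _ (apply_mem_domain hT hL hω hcos
          (add_pos_of_pos_of_nonneg (hpos m) hσ.1) _)).trans ?_
        rw [← ofReal_norm, Complex.norm_real, Real.norm_of_nonneg (by positivity)]
        gcongr
        refine hb _ ⟨?_, ?_⟩
        · push_cast
          nlinarith [hσ.1, (Nat.cast_nonneg m : (0 : ℝ) ≤ m)]
        · have : ((m + 1 : ℕ) : ℝ) ≤ M := by exact_mod_cast hmM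
          nlinarith [hσ.2]
    _ ≤ _ := by
        rw [← Finset.sum_mul]
        gcongr
        exact sum_choose_succ_le M

theorem IsGraphSeminorm.sub_one_sub_pow_le (hΨ : IsGraphSeminorm L Ψ) (hT : IsSemigroupOf T L)
    (hL : IsOmegaAccretive L ω) (hω : ω < Real.pi / 2) (hcos : 0 < Real.cos ω) (M : ℕ)
    (f : H) {a : ℝ} (ha : 0 < a) {A : ℝ≥0∞}
    (hA : ∀ σ ∈ Icc a (M * a), Ψ (T σ f) ≤ A) :
    Ψ (f - ((1 - T a) ^ M) f) ≤ 2 ^ M * A := by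
  have h3 : f - ((1 - T a) ^ M) f = ∑ m ∈ Finset.range M,
      (((-1) ^ m * M.choose (m + 1) : ℤ) : ℂ) • T ((m + 1 : ℕ) * a) f := by
    have := congrArg (fun F : H →L[ℂ] H => F f) (one_sub_one_sub_pow (T a) M)
    simp only [sum_apply, sub_apply, one_apply_eq_self] at this
    rw [this]
    refine Finset.sum_congr rfl fun m _ => ?_
    rw [← hT.pow_apply ha.le, Int.cast_smul_eq_zsmul ℂ]
    rfl
  have hpos : ∀ m : ℕ, 0 < ((m + 1 : ℕ) : ℝ) * a := fun m => by positivity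
  rw [h3]
  refine (hΨ.sum_smul_le _ _ _ fun m _ => apply_mem_domain hT hL hω hcos (hpos m) f).trans ?_
  calc _ ≤ ∑ m ∈ Finset.range M, ((M.choose (m + 1) : ℕ) : ℝ≥0∞) * A := by
        refine Finset.sum_le_sum fun m hm => ?_
        have hmM : m + 1 ≤ M := Finset.mem_range.1 hm
        have e : ‖(((-1) ^ m * M.choose (m + 1) : ℤ) : ℂ)‖ₑ = (M.choose (m + 1) : ℕ) := by
          rw [← ofReal_norm]
          push_cast
          rw [norm_mul, norm_pow, norm_neg, norm_one, one_pow, one_mul, Complex.norm_natCast,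
            ENNReal.ofReal_natCast]
        rw [e]
        gcongr
        refine hA _ ⟨?_, ?_⟩
        · push_cast
          nlinarith [(Nat.cast_nonneg m : (0 : ℝ) ≤ m)]
        · have : ((m + 1 : ℕ) : ℝ) ≤ M := by exact_mod_cast hmM
          gcongr
    _ ≤ _ := by
        rw [← Finset.sum_mul]
        gcongr
        exact sum_choose_succ_le M

/-- Calderón type reproducing estimate: a graph seminorm of `f` is controlled by its values on the
semigroup acting on `f` at scale `τ` and on `L^M f` at the scales `τ 2^{-k}`. -/
theorem IsGraphSeminorm.le_tsum (hΨ : IsGraphSeminorm L Ψ) (hT : IsSemigroupOf T L)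
    (hL : IsOmegaAccretive L ω) (hω : ω < Real.pi / 2) (hcos : 0 < Real.cos ω) {M : ℕ}
    (hM : 1 ≤ M) (f : (opPow L M).domain) {τ : ℝ} (hτ : 0 < τ) {A : ℝ≥0∞} {b : ℝ → ℝ≥0∞}
    (hA : ∀ σ ∈ Icc τ (M * τ), Ψ (T σ f) ≤ A)
    (hb : ∀ a, 0 < a → a ≤ τ / 2 → ∀ σ ∈ Icc a (2 * M * a), Ψ (T σ (opPow L M f)) ≤ b a) :
    Ψ f ≤ 2 ^ M * A + ∑' k : ℕ, 2 ^ M *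
      (ENNReal.ofReal ((τ / 2 ^ (k + 1)) ^ M) * b (τ / 2 ^ (k + 1))) := by
  obtain ⟨g, hg⟩ := LinearPMap.mem_domain_iff.1 (opPow_domain_le hM f.2)
  set a : ℕ → ℝ := fun k => τ / 2 ^ k with ha_def
  have ha : ∀ k, 0 < a k := fun k => by positivity
  have halim : Tendsto a atTop (𝓝 0) :=
    tendsto_const_nhds.div_atTop (tendsto_pow_atTop_atTop_of_one_lt one_lt_two)
  set d : ℕ → ℝ≥0∞ := fun k => 2 ^ M * (ENNReal.ofReal (a (k + 1) ^ M) * b (a (k + 1))) with hd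
  have hgr : ∀ k, ((f : H) - ((1 - T (a k)) ^ M) (f : H), g - ((1 - T (a k)) ^ M) g) ∈ L.graph :=
    fun k => graph_sub_mem hg (hT.one_sub_pow_mem_graph (ha k).le M hg)
  -- Telescoping: passing from `a k = 2 a (k + 1)` to `a (k + 1)` costs one difference at scale `a
  -- (k + 1)`, so the scales entering the sum start at `τ / 2`.
  have hbound : ∀ k, Ψ ((f : H) - ((1 - T (a k)) ^ M) (f : H)) ≤
      2 ^ M * A + ∑ j ∈ Finset.range k, d j := by
    intro k
    induction k with
    | zero =>
      rw [Finset.sum_range_zero, add_zero]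
      have : a 0 = τ := by simp [ha_def]
      rw [this]
      exact hΨ.sub_one_sub_pow_le hT hL hω hcos M f hτ hA
    | succ k ih =>
      have e : a k = 2 * a (k + 1) := by simp only [ha_def, pow_succ]; field_simp
      have hle : a (k + 1) ≤ τ / 2 := by
        simp only [ha_def, pow_succ]
        refine div_le_div_of_nonneg_left hτ.le two_pos ?_
        have : (1 : ℝ) ≤ 2 ^ k := one_le_pow₀ one_le_two
        linarith
      have h1 := hΨ.one_sub_pow_sub_le hT hL hω hcos f (ha (k + 1)) (hb _ (ha (k + 1)) hle)
      rw [← e] at h1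
      have e2 : (f : H) - ((1 - T (a (k + 1))) ^ M) (f : H) =
          ((f : H) - ((1 - T (a k)) ^ M) (f : H)) +
          (((1 - T (a k)) ^ M) (f : H) - ((1 - T (a (k + 1))) ^ M) (f : H)) := by abel
      have m1 : ∀ k, ((1 - T (a k)) ^ M) (f : H) ∈ L.domain := fun k =>
        LinearPMap.mem_domain_iff.2 ⟨_, hT.one_sub_pow_mem_graph (ha k).le M hg⟩
      rw [e2, Finset.sum_range_succ, ← add_assoc]
      exact (hΨ.add _ (LinearPMap.mem_domain_iff.2 ⟨_, hgr k⟩) _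
        (L.domain.sub_mem (m1 k) (m1 (k + 1)))).trans (add_le_add ih h1)
  -- The remainder `(1 - T (a k))^M` tends to 0 strongly on `f` and on `L f`, so the convergence
  -- holds in the graph norm.
  refine hΨ.lsc _ _ f g hgr hg ?_ ?_ _ fun k =>
    (hbound k).trans (add_le_add_right (ENNReal.sum_le_tsum _) _)
  · simpa using (hT.tendsto_one_sub_pow hL hω hM ha halim (f : H)).const_sub (f : H)
  · simpa using (hT.tendsto_one_sub_pow hL hω hM ha halim g).const_sub g

end

end Caccioppoli

namespace Caccioppoli

/-! ### Local norms of Γ as graph seminorms. -/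

section SublinearOperator

variable {X : Type*} [MetricSpace X] [MeasurableSpace X] {μ : Measure X}
  {Γ : SublinearOperator μ} {L : L2 μ →ₗ.[ℂ] L2 μ} {ω : ℝ}

theorem SublinearOperator.abs_norm_sub_norm_le (Γ : SublinearOperator μ) {u v : L2 μ}
    (hu : u ∈ Γ.domain) (hv : v ∈ Γ.domain) :
    ∀ᵐ y ∂μ, |‖Γ.toFun u y‖ - ‖Γ.toFun v y‖| ≤ ‖Γ.toFun (u - v) y‖ := by
  have h := Γ.domain.sub_mem hu hv
  have h' : v - u ∈ Γ.domain := Γ.domain.sub_mem hv hu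
  filter_upwards [Γ.subadd _ h v hv, Γ.subadd _ h' u hu, Γ.homog (-1) _ h] with y h1 h2 h3
  rw [sub_add_cancel] at h1 h2
  rw [neg_one_smul, neg_sub, norm_neg, norm_one, one_mul] at h3
  rw [h3] at h2
  rw [abs_le]
  constructor <;> linarith

theorem IsSetting.exists_norm_le (hS : IsSetting μ Γ L ω) :
    ∃ C : ℝ, 0 ≤ C ∧ ∀ {u w : L2 μ}, (u, w) ∈ L.graph → ‖Γ.toFun u‖ ≤ C * (‖u‖ + ‖w‖) := by
  obtain ⟨C₁, h1⟩ := hS.rieszTwo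
  obtain ⟨C₂, hC₂, h2⟩ := hS.accretive.exists_norm_sqrtOp_le hS.omega_lt
  refine ⟨|C₁| * C₂, by positivity, fun {u w} h => ?_⟩
  obtain ⟨f, rfl, rfl⟩ := L.mem_graph_iff.1 h
  calc ‖Γ.toFun f‖ ≤ C₁ * ‖sqrtOp L f‖ := h1 f
    _ ≤ |C₁| * ‖sqrtOp L f‖ := by gcongr; exact le_abs_self _
    _ ≤ |C₁| * (C₂ * (‖(f : L2 μ)‖ + ‖L f‖)) := by gcongr; exact h2 f
    _ = _ := by ring

/-- For lower semicontinuity: the Riesz bound and the bound on `L^{1/2}` give `Γ(u_n - u') → 0` in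
L², hence a.e. along a subsequence. The reverse triangle inequality for Γ gives `|Γu_n| → |Γu'|`
a.e., and Fatou concludes. -/
theorem IsSetting.isGraphSeminorm (hS : IsSetting μ Γ L ω) {p : ℝ≥0∞} (hp : 1 ≤ p) (S : Set X) :
    IsGraphSeminorm L fun u => eLpNorm (Γ.toFun u) p (μ.restrict S) where
  add u hu v hv := by
    have h := ae_restrict_of_ae (s := S) (Γ.subadd u (hS.domain_le hu) v (hS.domain_le hv))
    have hm : ∀ w : L2 μ, AEStronglyMeasurable (fun y => ‖w y‖) (μ.restrict S) := fun w =>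
      (Lp.aestronglyMeasurable w).norm.restrict
    calc eLpNorm (Γ.toFun (u + v)) p (μ.restrict S)
        ≤ eLpNorm ((fun y => ‖Γ.toFun u y‖) + fun y => ‖Γ.toFun v y‖) p (μ.restrict S) := by
          refine eLpNorm_mono_ae ?_
          filter_upwards [h] with y hy
          exact hy.trans (le_abs_self _)
      _ ≤ _ := by
          refine (eLpNorm_add_le (hm _) (hm _) hp).trans ?_
          rw [eLpNorm_norm, eLpNorm_norm]
  smul c u hu := by
    have h := ae_restrict_of_ae (s := S) (Γ.homog c u (hS.domain_le hu))
    rw [← eLpNorm_const_smul]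
    refine eLpNorm_mono_ae ?_
    filter_upwards [h] with y hy
    rw [hy, Pi.smul_apply, norm_smul]
  lsc u w u' w' hu hu' hlu hlw c hc := by
    obtain ⟨C, hC, hb⟩ := hS.exists_norm_le
    have hdom : ∀ {u w : L2 μ}, (u, w) ∈ L.graph → u ∈ Γ.domain := fun h =>
      hS.domain_le (LinearPMap.mem_domain_iff.2 ⟨_, h⟩)
    have hlim : Tendsto (fun n => Γ.toFun (u n - u')) atTop (𝓝 0) := by
      refine squeeze_zero_norm (fun n => hb (graph_sub_mem (hu n) hu')) ?_
      rw [tendsto_iff_norm_sub_tendsto_zero] at hlu hlw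
      simpa using (hlu.add hlw).const_mul C
    obtain ⟨ns, -, hns⟩ := (tendstoInMeasure_of_tendsto_Lp hlim).exists_seq_tendsto_ae
    have hae : ∀ᵐ y ∂μ, Tendsto (fun i => ‖Γ.toFun (u (ns i)) y‖) atTop
        (𝓝 ‖Γ.toFun u' y‖) := by
      filter_upwards [hns, Lp.coeFn_zero ℂ 2 μ, ae_all_iff.2 fun n =>
        Γ.abs_norm_sub_norm_le (hdom (hu n)) (hdom hu')] with y h1 h2 h3
      rw [h2] at h1
      rw [tendsto_iff_norm_sub_tendsto_zero]
      refine squeeze_zero (fun _ => norm_nonneg _) (fun i => ?_) (by simpa using h1.norm)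
      exact h3 (ns i)
    have h4 := Lp.eLpNorm_lim_le_liminf_eLpNorm (p := p) (μ := μ.restrict S)
      (f := fun i y => ‖Γ.toFun (u (ns i)) y‖)
      (fun i => (Lp.aestronglyMeasurable _).norm.restrict) (fun y => ‖Γ.toFun u' y‖)
      (ae_restrict_of_ae hae)
    rw [eLpNorm_norm] at h4
    refine h4.trans (Filter.liminf_le_of_le (by isBoundedDefault) fun b hb' => ?_)
    obtain ⟨n, hn⟩ := hb'.exists
    rw [eLpNorm_norm] at hn
    exact hn.trans (hc _)

end SublinearOperator

end Caccioppoli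

namespace Caccioppoli

/-! ### Polynomial weights. -/

section Weight

variable {X : Type*} [MetricSpace X]

/-- The polynomial weight `1 + d(a, b)/s`. -/
noncomputable def wt (s : ℝ) (a b : X) : ℝ≥0∞ := ENNReal.ofReal (1 + dist a b / s)

theorem wt_comm (s : ℝ) (a b : X) : wt s a b = wt s b a := by rw [wt, wt, dist_comm]

theorem wt_ne_top {s : ℝ} {a b : X} : wt s a b ≠ ⊤ := ENNReal.ofReal_ne_top

theorem one_le_wt {s : ℝ} (hs : 0 < s) (a b : X) : 1 ≤ wt s a b := by
  rw [wt, ← ENNReal.ofReal_one]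
  exact ENNReal.ofReal_le_ofReal (le_add_of_nonneg_right (by positivity))

theorem wt_ne_zero {s : ℝ} (hs : 0 < s) {a b : X} : wt s a b ≠ 0 :=
  (zero_lt_one.trans_le (one_le_wt hs a b)).ne'

theorem wt_triangle {s : ℝ} (hs : 0 < s) (a b c : X) : wt s a c ≤ wt s a b * wt s b c := by
  rw [wt, wt, wt, ← ENNReal.ofReal_mul (by positivity)]
  refine ENNReal.ofReal_le_ofReal ?_
  have h : dist a c / s ≤ dist a b / s + dist b c / s := by
    rw [← add_div]; gcongr; exact dist_triangle a b c
  have : 0 ≤ dist a b / s * (dist b c / s) := by positivity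
  nlinarith

theorem wt_anti {s r : ℝ} (hs : 0 < s) (hsr : s ≤ r) (a b : X) : wt r a b ≤ wt s a b := by
  rw [wt, wt]; gcongr

theorem wt_le_ofReal {s R : ℝ} {a b : X} (h : 1 + dist a b / s ≤ R) : wt s a b ≤ ENNReal.ofReal R :=
  ENNReal.ofReal_le_ofReal h

/-- Peetre's inequality: moving the second point of a decaying weight costs a growing weight in the
displacement. -/
theorem wt_rpow_neg_le {s : ℝ} (hs : 0 < s) {K : ℝ} (hK : 0 ≤ K) (a b c : X) :
    wt s a b ^ (-K) ≤ wt s a c ^ (-K) * wt s b c ^ K := by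
  have h1 : wt s a c ^ K ≤ wt s a b ^ K * wt s b c ^ K := by
    rw [← ENNReal.mul_rpow_of_nonneg _ _ hK]
    exact ENNReal.rpow_le_rpow (wt_triangle hs a b c) hK
  rw [ENNReal.rpow_neg, ENNReal.rpow_neg, ← ENNReal.div_eq_inv_mul]
  rw [ENNReal.le_div_iff_mul_le (Or.inl ?_) (Or.inl ?_), mul_comm]
  · rw [← div_eq_mul_inv]
    refine ENNReal.div_le_of_le_mul ?_
    rwa [mul_comm]
  · exact (ENNReal.rpow_pos (pos_iff_ne_zero.2 (wt_ne_zero hs)) wt_ne_top).ne'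
  · exact ENNReal.rpow_ne_top_of_nonneg hK wt_ne_top

theorem wt_rpow_le_of_le {s : ℝ} (hs : 0 < s) {K K' : ℝ} (hK : K ≤ K') (a b : X) :
    wt s a b ^ K ≤ wt s a b ^ K' :=
  ENNReal.rpow_le_rpow_of_exponent_le (one_le_wt hs a b) hK

theorem wt_rpow_add {s : ℝ} (hs : 0 < s) (K K' : ℝ) (a b : X) :
    wt s a b ^ (K + K') = wt s a b ^ K * wt s a b ^ K' :=
  ENNReal.rpow_add _ _ (wt_ne_zero hs) wt_ne_top

theorem measurable_wt [MeasurableSpace X] [OpensMeasurableSpace X] (s : ℝ) (a : X) :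
    Measurable (wt s a) := by
  unfold wt
  exact ((continuous_const.add ((continuous_const.dist continuous_id).div_const s)).measurable).ennreal_ofReal

theorem ofReal_two_rpow (x : ℝ) : ENNReal.ofReal ((2 : ℝ) ^ x) = 2 ^ x := by
  rw [← ENNReal.ofReal_rpow_of_pos two_pos, ENNReal.ofReal_ofNat]

/-- If `2^n ≤ 1 + d(x, y)/r < 2^(n+1)`, the single term `l = n + 1` suffices; the factor `2^K` pays
for the index shift. -/
theorem wt_rpow_neg_le_tsum {r : ℝ} (hr : 0 < r) {K : ℝ} (hK : 0 ≤ K) (x y : X) :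
    wt r x y ^ (-K) ≤ ∑' l : ℕ, 2 ^ K * ((2 : ℝ≥0∞) ^ (-(l * K)) *
      (Metric.ball x (2 ^ l * r)).indicator 1 y) := by
  obtain ⟨n, hn1, hn2⟩ := exists_nat_pow_near (x := 1 + dist x y / r) (y := (2 : ℝ))
    (le_add_of_nonneg_right (by positivity)) one_lt_two
  refine le_trans ?_ (ENNReal.le_tsum (n + 1))
  have hy : y ∈ Metric.ball x (2 ^ (n + 1) * r) := by
    rw [Metric.mem_ball, dist_comm, ← div_lt_iff₀ hr]
    linarith
  rw [indicator_of_mem hy, Pi.one_apply, mul_one,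
    ← ENNReal.rpow_add _ _ two_ne_zero ENNReal.ofNat_ne_top]
  have e : K + -(((n + 1 : ℕ) : ℝ) * K) = (n : ℝ) * (-K) := by push_cast; ring
  rw [e, ENNReal.rpow_mul, ENNReal.rpow_natCast, ENNReal.rpow_neg, ENNReal.rpow_neg]
  refine ENNReal.inv_le_inv.2 (ENNReal.rpow_le_rpow ?_ hK)
  rw [wt, ← ENNReal.ofReal_ofNat 2, ← ENNReal.ofReal_pow zero_le_two]
  exact ENNReal.ofReal_le_ofReal hn1

theorem lintegral_wt_mul_le [MeasurableSpace X] [OpensMeasurableSpace X] {μ : Measure X} {r : ℝ}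
    (hr : 0 < r) {K : ℝ} (hK : 0 ≤ K) (x : X) {h : X → ℝ≥0∞} (hh : AEMeasurable h μ) :
    ∫⁻ y, wt r x y ^ (-K) * h y ∂μ ≤ ∑' l : ℕ, 2 ^ K * ((2 : ℝ≥0∞) ^ (-(l * K)) *
      ∫⁻ y in Metric.ball x (2 ^ l * r), h y ∂μ) := by
  have hm : ∀ l : ℕ, AEMeasurable
      (fun y => (Metric.ball x (2 ^ l * r)).indicator h y) μ := fun l =>
    hh.indicator Metric.isOpen_ball.measurableSet
  calc _ ≤ ∫⁻ y, ∑' l : ℕ, 2 ^ K * ((2 : ℝ≥0∞) ^ (-(l * K)) *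
        (Metric.ball x (2 ^ l * r)).indicator h y) ∂μ := by
        refine lintegral_mono fun y => ?_
        refine (mul_le_mul_left (wt_rpow_neg_le_tsum hr hK x y) _).trans_eq ?_
        rw [← ENNReal.tsum_mul_right]
        refine tsum_congr fun l => ?_
        by_cases hy : y ∈ Metric.ball x (2 ^ l * r)
        · rw [indicator_of_mem hy, indicator_of_mem hy, Pi.one_apply, mul_one, mul_assoc]
        · rw [indicator_of_notMem hy, indicator_of_notMem hy]; simp
    _ = _ := by
        rw [lintegral_tsum fun l => ((hm l).const_mul _).const_mul _]
        refine tsum_congr fun l => ?_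
        rw [lintegral_const_mul'' _ ((hm l).const_mul _), lintegral_const_mul'' _ (hm l),
          lintegral_indicator Metric.isOpen_ball.measurableSet]

end Weight

/-! ### Separated nets. -/

section Net

variable {X : Type*} [MetricSpace X]

/-- A maximal `s`-separated set. -/
structure IsNet (s : ℝ) (N : Set X) : Prop where
  sep : ∀ a ∈ N, ∀ b ∈ N, a ≠ b → s ≤ dist a b
  cover : ∀ x, ∃ a ∈ N, dist x a < s

theorem exists_isNet {s : ℝ} (hs : 0 < s) : ∃ N : Set X, IsNet s N := by
  obtain ⟨N, hN⟩ := zorn_subset {N : Set X | ∀ a ∈ N, ∀ b ∈ N, a ≠ b → s ≤ dist a b} fun c hc hch => by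
    refine ⟨⋃₀ c, ?_, fun t ht => subset_sUnion_of_mem ht⟩
    rintro a ⟨t, ht, hat⟩ b ⟨t', ht', hbt⟩ hab
    rcases hch.total ht ht' with h | h
    · exact hc ht' a (h hat) b hbt hab
    · exact hc ht a hat b (h hbt) hab
  refine ⟨N, hN.prop, fun x => ?_⟩
  by_contra! hx
  have h1 : insert x N ∈ {N : Set X | ∀ a ∈ N, ∀ b ∈ N, a ≠ b → s ≤ dist a b} := by
    rintro a (rfl | ha) b (rfl | hb) hab
    · exact absurd rfl hab
    · exact hx b hb
    · rw [dist_comm]; exact hx a ha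
    · exact hN.prop a ha b hb hab
  have h2 : x ∈ N := hN.le_of_ge h1 (subset_insert x N) (mem_insert x N)
  have := hx x h2
  rw [dist_self] at this
  linarith

namespace IsNet

variable {s : ℝ} {N : Set X}

theorem disjoint_balls (hN : IsNet s N) {a b : X} (ha : a ∈ N) (hb : b ∈ N) (hab : a ≠ b) :
    Disjoint (Metric.ball a (s / 2)) (Metric.ball b (s / 2)) :=
  Metric.ball_disjoint_ball (by linarith [hN.sep a ha b hb hab])

theorem countable [TopologicalSpace.SeparableSpace X] (hN : IsNet s N) (hs : 0 < s) :
    N.Countable := by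
  refine Set.PairwiseDisjoint.countable_of_isOpen (s := fun a : X => Metric.ball a (s / 2))
    (fun a ha b hb hab => hN.disjoint_balls ha hb hab) (fun a _ => Metric.isOpen_ball)
    (fun a _ => ⟨a, Metric.mem_ball_self (half_pos hs)⟩)

end IsNet

end Net

/-! ### Volume growth and sums over nets. -/

section Growth

variable {X : Type*} [MetricSpace X] [MeasurableSpace X] {μ : Measure X}

/-- The growth condition with a given constant. -/
def GrowthBound (μ : Measure X) (ν : ℝ) (C : ℝ≥0) : Prop :=
  ∀ (x : X) (r s : ℝ), 0 < s → s ≤ r →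
    μ (Metric.ball x r) ≤ C * ENNReal.ofReal ((r / s) ^ ν) * μ (Metric.ball x s)

theorem Doubling.exists_growthBound (h : Doubling μ) :
    ∃ ν : ℝ, 0 < ν ∧ VolumeGrowth μ ν := by
  obtain ⟨C, hC⟩ := h
  obtain ⟨k, hk⟩ := pow_unbounded_of_one_lt C (one_lt_two : (1 : ℝ≥0) < 2)
  have hiter : ∀ (x : X) (s : ℝ), 0 < s → ∀ n : ℕ,
      μ (Metric.ball x (2 ^ n * s)) ≤ ((2 : ℝ≥0∞) ^ (k + 1)) ^ n * μ (Metric.ball x s) := by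
    intro x s hs n
    induction n with
    | zero => simp
    | succ n ih =>
      have e : (2 : ℝ) ^ (n + 1) * s = 2 * (2 ^ n * s) := by ring
      rw [e]
      refine (hC x _ (by positivity)).trans ?_
      have hC2 : (C : ℝ≥0∞) ≤ 2 ^ (k + 1) := by
        have : C ≤ 2 ^ (k + 1) := hk.le.trans (pow_le_pow_right₀ one_le_two (Nat.le_succ k))
        exact_mod_cast this
      rw [pow_succ' ((2 : ℝ≥0∞) ^ (k + 1)), mul_assoc]
      gcongr
  -- The exponent is `k + 1` rather than `k` so that it is positive even when `k = 0`.
  refine ⟨(k + 1 : ℕ), by positivity, 2 ^ (k + 1), fun x r s hs hsr => ?_⟩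
  obtain ⟨n, hn1, hn2⟩ := exists_nat_pow_near (x := r / s) (y := (2 : ℝ))
    ((one_le_div hs).2 hsr) one_lt_two
  have h1 : μ (Metric.ball x r) ≤ μ (Metric.ball x (2 ^ (n + 1) * s)) :=
    measure_mono (Metric.ball_subset_ball ((div_le_iff₀ hs).1 hn2.le))
  refine (h1.trans (hiter x s hs (n + 1))).trans ?_
  gcongr
  rw [Real.rpow_natCast, ENNReal.ofReal_pow (div_nonneg (hs.le.trans hsr) hs.le), pow_succ ((2 : ℝ≥0∞) ^ (k + 1)),
    mul_comm, ← pow_mul, mul_comm (k + 1) n, pow_mul]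
  push_cast
  gcongr
  rw [← ENNReal.ofReal_ofNat 2, ← ENNReal.ofReal_pow zero_le_two]
  exact ENNReal.ofReal_le_ofReal hn1

theorem Doubling.measure_ball_ne_top [LocallyCompactSpace X] [IsFiniteMeasureOnCompacts μ]
    (h : Doubling μ) (x : X) (r : ℝ) : μ (Metric.ball x r) ≠ ⊤ := by
  obtain ⟨ν, hν, C, hC⟩ := h.exists_growthBound
  obtain ⟨S, hS, hxS⟩ := exists_compact_mem_nhds x
  obtain ⟨ε, hε, hball⟩ := Metric.mem_nhds_iff.1 hxS
  have h1 : μ (Metric.ball x ε) ≠ ⊤ :=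
    ((measure_mono hball).trans_lt hS.measure_lt_top).ne
  have h2 : μ (Metric.ball x r) ≤ μ (Metric.ball x (max r ε)) :=
    measure_mono (Metric.ball_subset_ball (le_max_left _ _))
  refine ((h2.trans (hC x _ ε hε (le_max_right _ _))).trans_lt ?_).ne
  exact ENNReal.mul_lt_top (ENNReal.mul_lt_top ENNReal.coe_lt_top ENNReal.ofReal_lt_top)
    h1.lt_top

variable {ν : ℝ} {C : ℝ≥0}

theorem GrowthBound.ball_le (h : GrowthBound μ ν C) {s : ℝ} (hs : 0 < s) (a b : X) :
    μ (Metric.ball b s) ≤ C * wt s a b ^ ν * μ (Metric.ball a s) := by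
  have hpos : 0 < 1 + dist a b / s := by positivity
  have h1 : Metric.ball b s ⊆ Metric.ball a (s * (1 + dist a b / s)) := by
    refine Metric.ball_subset_ball' ?_
    rw [mul_add, mul_one, mul_div_cancel₀ _ hs.ne', dist_comm]
  refine (measure_mono h1).trans ((h a _ s hs ?_).trans ?_)
  · have : 0 ≤ s * (dist a b / s) := by positivity
    linarith
  · rw [mul_div_cancel_left₀ _ hs.ne', wt, ENNReal.ofReal_rpow_of_pos hpos]

theorem GrowthBound.dyadic_ball_le (h : GrowthBound μ ν C) {r : ℝ} (hr : 0 < r) (x : X) (l : ℕ) :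
    μ (Metric.ball x (2 ^ l * r)) ≤ C * 2 ^ (l * ν) * μ (Metric.ball x r) := by
  refine (h x _ r hr ?_).trans_eq ?_
  · exact le_mul_of_one_le_left hr.le (one_le_pow₀ one_le_two)
  · rw [mul_div_cancel_right₀ _ hr.ne', ← Real.rpow_natCast_mul zero_le_two, ofReal_two_rpow]

namespace IsNet

variable {s : ℝ} {N : Set X}

/-- Each ball loses the balls that precede it in an enumeration of the net. -/
theorem exists_partition [OpensMeasurableSpace X] (hN : IsNet s N) [Countable N] :
    ∃ Q : N → Set X, (∀ j, MeasurableSet (Q j)) ∧ Pairwise (Function.onFun Disjoint Q) ∧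
      (∀ j, Q j ⊆ Metric.ball (j : X) s) ∧ ⋃ j, Q j = univ := by
  have := Encodable.ofCountable N
  refine ⟨fun j => Metric.ball (j : X) s \
    ⋃ i : N, ⋃ _ : Encodable.encode i < Encodable.encode j, Metric.ball (i : X) s, ?_, ?_, ?_, ?_⟩
  · exact fun j => Metric.isOpen_ball.measurableSet.diff
      (MeasurableSet.iUnion fun i => MeasurableSet.iUnion fun _ => Metric.isOpen_ball.measurableSet)
  · intro i j hij
    have key : ∀ i j : N, Encodable.encode i < Encodable.encode j → Disjoint
        (Metric.ball (i : X) s \ ⋃ k : N, ⋃ _ : Encodable.encode k < Encodable.encode i,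
          Metric.ball (k : X) s)
        (Metric.ball (j : X) s \ ⋃ k : N, ⋃ _ : Encodable.encode k < Encodable.encode j,
          Metric.ball (k : X) s) := fun i j h =>
      disjoint_left.2 fun y hy hy' => hy'.2 (mem_iUnion₂.2 ⟨i, h, hy.1⟩)
    rcases lt_or_gt_of_ne (fun h => hij (Encodable.encode_injective h)) with h | h
    · exact key i j h
    · exact (key j i h).symm
  · exact fun j => sdiff_subset
  · refine eq_univ_of_forall fun y => ?_
    have hex : ∃ n, ∃ j : N, Encodable.encode j = n ∧ y ∈ Metric.ball (j : X) s := by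
      obtain ⟨a, ha, hya⟩ := hN.cover y
      exact ⟨_, ⟨a, ha⟩, rfl, hya⟩
    classical
    obtain ⟨j, hj, hy⟩ := Nat.find_spec hex
    refine mem_iUnion.2 ⟨j, hy, fun h => ?_⟩
    obtain ⟨i, hi, hyi⟩ := mem_iUnion₂.1 h
    exact Nat.find_min hex (hj ▸ hi) ⟨i, rfl, hyi⟩

end IsNet

theorem tsum_two_rpow_neg_ne_top {K : ℝ} (hK : 0 < K) :
    ∑' l : ℕ, (2 : ℝ≥0∞) ^ (-(l * K)) ≠ ⊤ := by
  have e : ∀ l : ℕ, (2 : ℝ≥0∞) ^ (-(l * K)) = ((2 : ℝ≥0∞) ^ (-K)) ^ l := fun l => by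
    rw [← ENNReal.rpow_natCast, ← ENNReal.rpow_mul]; congr 1; ring
  simp_rw [e]
  rw [ENNReal.tsum_geometric]
  refine ENNReal.inv_ne_top.2 (tsub_pos_of_lt ?_).ne'
  exact ENNReal.rpow_lt_one_of_one_lt_of_neg (by norm_num) (neg_lt_zero.2 hK)

/-- Sums of the weights over a net are bounded, uniformly in the scale and in the center. -/
theorem GrowthBound.exists_tsum_net_le [TopologicalSpace.SeparableSpace X] [OpensMeasurableSpace X]
    [μ.IsOpenPosMeasure]
    (h : GrowthBound μ ν C) (hν : 0 ≤ ν) (hfin : ∀ (x : X) (r : ℝ), μ (Metric.ball x r) ≠ ⊤) :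
    ∃ C' : ℝ≥0∞, C' ≠ ⊤ ∧ ∀ (s : ℝ), 0 < s → ∀ (N : Set X), IsNet s N → ∀ (z : X) (K : ℝ),
      2 * ν + 1 ≤ K → ∑' j : N, wt s z j ^ (-K) ≤ C' := by
  set S : ℝ≥0∞ := ∑' l : ℕ, (2 : ℝ≥0∞) ^ (-(l * (1 : ℝ))) with hS
  refine ⟨C * C * 2 ^ ν * 2 ^ (ν + 1) * (2 ^ (ν + 1) * (C * S)), ?_, ?_⟩
  · have h2 : ∀ x : ℝ, 0 ≤ x → (2 : ℝ≥0∞) ^ x ≠ ⊤ := fun x hx =>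
      ENNReal.rpow_ne_top_of_nonneg hx ENNReal.ofNat_ne_top
    have h3 := tsum_two_rpow_neg_ne_top one_pos
    refine ENNReal.mul_ne_top (ENNReal.mul_ne_top (ENNReal.mul_ne_top
      (ENNReal.mul_ne_top ?_ ?_) (h2 _ hν)) (h2 _ (by linarith)))
      (ENNReal.mul_ne_top (h2 _ (by linarith)) (ENNReal.mul_ne_top ?_ h3)) <;>
    exact ENNReal.coe_ne_top
  intro s hs N hN z K hK
  have hcount := hN.countable hs
  have : Countable N := hcount.to_subtype
  have hzpos : μ (Metric.ball z s) ≠ 0 := (Metric.measure_ball_pos μ z hs).ne'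
  -- After multiplication by `μ (B(z, s))` the sum is compared with an integral over the disjoint
  -- half-balls. Of the exponent `2ν + 1`, a part `ν` moves the ball from `z` to `j`, and `ν + 1`
  -- makes the weight integrable.
  rw [← ENNReal.mul_le_mul_iff_left hzpos (hfin z s)]
  rw [← ENNReal.tsum_mul_right]
  have hterm : ∀ j : N, wt s z j ^ (-K) * μ (Metric.ball z s) ≤
      C * C * 2 ^ ν * 2 ^ (ν + 1) *
        ∫⁻ y in Metric.ball (j : X) (s / 2), wt s z y ^ (-(ν + 1)) ∂μ := by
    intro j
    have h1 := h.ball_le hs (j : X) z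
    have h2 := h (j : X) s (s / 2) (by positivity) (by linarith)
    have e2 : s / (s / 2) = 2 := by field_simp
    rw [e2, ofReal_two_rpow] at h2
    have h3 : wt s z j ^ (-(ν + 1)) * μ (Metric.ball (j : X) (s / 2)) ≤
        2 ^ (ν + 1) * ∫⁻ y in Metric.ball (j : X) (s / 2), wt s z y ^ (-(ν + 1)) ∂μ := by
      rw [← setLIntegral_const, ← lintegral_const_mul _ ((measurable_wt s z).pow_const _)]
      refine setLIntegral_mono (((measurable_wt s z).pow_const _).const_mul _) fun y hy => ?_
      refine (wt_rpow_neg_le hs (by linarith) z j y).trans ?_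
      rw [mul_comm]
      gcongr
      rw [← ENNReal.ofReal_ofNat 2]
      refine wt_le_ofReal ?_
      have : dist (j : X) y / s ≤ 1 := by
        rw [div_le_one hs, dist_comm]; linarith [Metric.mem_ball.1 hy]
      linarith
    calc wt s z j ^ (-K) * μ (Metric.ball z s)
        ≤ wt s z j ^ (-(ν + (ν + 1))) *
          (C * wt s z j ^ ν * (C * 2 ^ ν * μ (Metric.ball (j : X) (s / 2)))) := by
          refine mul_le_mul' (wt_rpow_le_of_le hs (by linarith) z j) (h1.trans ?_)
          rw [wt_comm]
          gcongr
      _ = C * C * 2 ^ ν * (wt s z j ^ (-(ν + 1)) * μ (Metric.ball (j : X) (s / 2))) := by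
          have e : wt s z j ^ (-(ν + 1)) = wt s z j ^ (-(ν + (ν + 1))) * wt s z j ^ ν := by
            rw [← wt_rpow_add hs]; congr 1; ring
          rw [e]; ring
      _ ≤ C * C * 2 ^ ν * (2 ^ (ν + 1) *
          ∫⁻ y in Metric.ball (j : X) (s / 2), wt s z y ^ (-(ν + 1)) ∂μ) := by gcongr
      _ = _ := by ring
  refine (ENNReal.tsum_le_tsum hterm).trans ?_
  rw [ENNReal.tsum_mul_left]
  refine (mul_le_mul_right ?_ _).trans_eq (mul_assoc _ _ _).symm
  rw [← lintegral_iUnion (fun j : N => Metric.isOpen_ball.measurableSet)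
    (fun i j hij => hN.disjoint_balls i.2 j.2 fun h => hij (Subtype.ext h))]
  refine (setLIntegral_le_lintegral _ _).trans ?_
  have h5 := lintegral_wt_mul_le (μ := μ) hs (K := ν + 1) (by linarith) z
    (h := fun _ => 1) aemeasurable_const
  simp only [mul_one, lintegral_const, Measure.restrict_apply_univ, one_mul] at h5
  refine h5.trans ?_
  rw [ENNReal.tsum_mul_left, mul_assoc, mul_assoc (C : ℝ≥0∞)]
  gcongr
  rw [hS, ← ENNReal.tsum_mul_right, ← ENNReal.tsum_mul_left]
  refine ENNReal.tsum_le_tsum fun l => ?_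
  calc _ ≤ (2 : ℝ≥0∞) ^ (-(l * (ν + 1))) * (C * 2 ^ (l * ν) * μ (Metric.ball z s)) := by
        gcongr
        exact h.dyadic_ball_le hs z l
    _ = C * (((2 : ℝ≥0∞) ^ (-(l * (ν + 1))) * 2 ^ (l * ν)) * μ (Metric.ball z s)) := by ring
    _ = _ := by
        rw [← ENNReal.rpow_add _ _ two_ne_zero ENNReal.ofNat_ne_top]
        congr 3
        ring_nf

end Growth

end Caccioppoli

namespace Caccioppoli

/-! ### Averages and local norms. -/

section Averages

variable {X : Type*} [MeasurableSpace X] {μ : Measure X}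

theorem eLpNorm_ofReal_rpow {p : ℝ} (hp : 0 < p) (f : X → ℂ) (m : Measure X) :
    eLpNorm f (ENNReal.ofReal p) m ^ p = ∫⁻ y, ‖f y‖ₑ ^ p ∂m := by
  rw [eLpNorm_eq_lintegral_rpow_enorm_toReal (by simpa using hp) ENNReal.ofReal_ne_top,
    ENNReal.toReal_ofReal hp.le, ← ENNReal.rpow_mul, one_div_mul_cancel hp.ne', ENNReal.rpow_one]

theorem eLpNorm_ofReal_eq {p : ℝ} (hp : 0 < p) (f : X → ℂ) (m : Measure X) :
    eLpNorm f (ENNReal.ofReal p) m = (∫⁻ y, ‖f y‖ₑ ^ p ∂m) ^ (1 / p) := by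
  rw [← eLpNorm_ofReal_rpow hp, ← ENNReal.rpow_mul, mul_one_div_cancel hp.ne', ENNReal.rpow_one]

theorem eLpNorm_restrict_le_mul_rpow {p q : ℝ} (hp : 0 < p) (hpq : p ≤ q) {f : X → ℂ}
    (hf : AEStronglyMeasurable f μ) (s : Set X) :
    eLpNorm f (ENNReal.ofReal p) (μ.restrict s) ≤
      eLpNorm f (ENNReal.ofReal q) (μ.restrict s) * μ s ^ (1 / p - 1 / q) := by
  have h := eLpNorm_le_eLpNorm_mul_rpow_measure_univ (μ := μ.restrict s)
    (ENNReal.ofReal_le_ofReal hpq) hf.restrict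
  rwa [ENNReal.toReal_ofReal hp.le, ENNReal.toReal_ofReal (hp.le.trans hpq),
    Measure.restrict_apply_univ] at h

/-- Log-convexity of the `L^p` norms. -/
theorem eLpNorm_le_rpow_mul_rpow {p₁ p p₂ : ℝ} (h0 : 0 < p₁) (h1 : p₁ < p) (h2 : p < p₂)
    {f : X → ℂ} (hf : AEStronglyMeasurable f μ) :
    eLpNorm f (ENNReal.ofReal p) μ ≤
      eLpNorm f (ENNReal.ofReal p₁) μ ^ (p₁ * (p₂ - p) / (p * (p₂ - p₁))) *
      eLpNorm f (ENNReal.ofReal p₂) μ ^ (p₂ * (p - p₁) / (p * (p₂ - p₁))) := by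
  have hp : 0 < p := h0.trans h1
  have hp2 : 0 < p₂ := hp.trans h2
  have hd : 0 < p₂ - p₁ := by linarith
  have hα : 0 ≤ (p₂ - p) / (p₂ - p₁) := div_nonneg (by linarith) hd.le
  have hβ : 0 ≤ (p - p₁) / (p₂ - p₁) := div_nonneg (by linarith) hd.le
  have h := ENNReal.lintegral_mul_norm_pow_le (μ := μ) (f := fun y => ‖f y‖ₑ ^ p₁)
    (g := fun y => ‖f y‖ₑ ^ p₂) (hf.enorm.pow_const _) (hf.enorm.pow_const _) hα hβ
    (by field_simp; ring)
  have e : ∀ y, (‖f y‖ₑ ^ p₁) ^ ((p₂ - p) / (p₂ - p₁)) * (‖f y‖ₑ ^ p₂) ^ ((p - p₁) / (p₂ - p₁)) =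
      ‖f y‖ₑ ^ p := fun y => by
    rw [← ENNReal.rpow_mul, ← ENNReal.rpow_mul, ← ENNReal.rpow_add_of_nonneg _ _ (by positivity)
      (by positivity)]
    congr 1
    field_simp
    ring
  simp only [e] at h
  rw [eLpNorm_ofReal_eq hp]
  refine (ENNReal.rpow_le_rpow h (by positivity)).trans_eq ?_
  rw [← eLpNorm_ofReal_rpow h0, ← eLpNorm_ofReal_rpow hp2, ENNReal.mul_rpow_of_nonneg _ _
    (by positivity), ← ENNReal.rpow_mul, ← ENNReal.rpow_mul, ← ENNReal.rpow_mul, ← ENNReal.rpow_mul]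
  congr 2 <;> field_simp

theorem lintegral_le_tsum_of_cover {ι : Type*} [Countable ι] {B : ι → Set X}
    (hB : ⋃ j, B j = univ) (m : Measure X) (h : X → ℝ≥0∞) :
    ∫⁻ y, h y ∂m ≤ ∑' j, ∫⁻ y in B j, h y ∂m := by
  rw [← setLIntegral_univ, ← hB]
  exact lintegral_iUnion_le _ _

variable [MetricSpace X]

theorem avg_eq {p : ℝ} (hp : 0 < p) (f : X → ℂ) (s : Set X) :
    avg μ p f s = μ s ^ (-(1 / p)) * eLpNorm f (ENNReal.ofReal p) (μ.restrict s) := by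
  rw [avg, setLAverage_eq, eLpNorm_ofReal_eq hp, div_eq_mul_inv, mul_comm,
    ENNReal.mul_rpow_of_nonneg _ _ (by positivity), ENNReal.inv_rpow, ENNReal.rpow_neg]

theorem eLpNorm_restrict_eq_mul_avg {p : ℝ} (hp : 0 < p) (f : X → ℂ) {s : Set X} (h0 : μ s ≠ 0)
    (ht : μ s ≠ ⊤) :
    eLpNorm f (ENNReal.ofReal p) (μ.restrict s) = μ s ^ (1 / p) * avg μ p f s := by
  rw [avg_eq hp, ← mul_assoc, ← ENNReal.rpow_add _ _ h0 ht, add_neg_cancel, ENNReal.rpow_zero,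
    one_mul]

theorem avg_mono_exponent {p q : ℝ} (hp : 0 < p) (hpq : p ≤ q) {f : X → ℂ}
    (hf : AEStronglyMeasurable f μ) {s : Set X} (h0 : μ s ≠ 0) (ht : μ s ≠ ⊤) :
    avg μ p f s ≤ avg μ q f s := by
  rw [avg_eq hp, avg_eq (hp.trans_le hpq)]
  calc _ ≤ μ s ^ (-(1 / p)) * (eLpNorm f (ENNReal.ofReal q) (μ.restrict s) *
        μ s ^ (1 / p - 1 / q)) := by
        gcongr; exact eLpNorm_restrict_le_mul_rpow hp hpq hf s
    _ = (μ s ^ (-(1 / p)) * μ s ^ (1 / p - 1 / q)) *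
        eLpNorm f (ENNReal.ofReal q) (μ.restrict s) := by ring
    _ = _ := by
        rw [← ENNReal.rpow_add _ _ h0 ht]
        congr 2
        ring

end Averages

/-! ### Gaussian decay dominates polynomial decay. -/

section Gaussian

theorem exists_rpow_le_mul_exp {c : ℝ} (hc : 0 < c) (K : ℝ) :
    ∃ D : ℝ, 0 ≤ D ∧ ∀ x : ℝ, 0 ≤ x → (3 + x) ^ K ≤ D * Real.exp (c * x ^ 2) := by
  obtain ⟨n, hn⟩ := exists_nat_ge K
  refine ⟨(18 + 2 / c) ^ n * (n.factorial * Real.exp 1), by positivity, fun x hx => ?_⟩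
  have h1 : (3 + x) ^ K ≤ ((3 + x) ^ 2) ^ n := by
    rw [← pow_mul, ← Real.rpow_natCast]
    refine Real.rpow_le_rpow_of_exponent_le (by linarith) (hn.trans ?_)
    push_cast
    linarith [(Nat.cast_nonneg n : (0 : ℝ) ≤ n)]
  have h2 : (3 + x) ^ 2 ≤ (18 + 2 / c) * (1 + c * x ^ 2) := by
    have e : (18 + 2 / c) * (1 + c * x ^ 2) = 18 + 2 / c + 18 * (c * x ^ 2) + 2 * x ^ 2 := by
      field_simp; ring
    have : 0 ≤ 2 / c := by positivity
    have : 0 ≤ c * x ^ 2 := by positivity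
    nlinarith [sq_nonneg (3 - x)]
  have h3 : (1 + c * x ^ 2) ^ n ≤ n.factorial * Real.exp (1 + c * x ^ 2) := by
    have := Real.pow_div_factorial_le_exp (1 + c * x ^ 2) (by positivity) n
    rw [div_le_iff₀ (by positivity)] at this
    exact this.trans_eq (mul_comm _ _)
  calc (3 + x) ^ K ≤ ((3 + x) ^ 2) ^ n := h1
    _ ≤ ((18 + 2 / c) * (1 + c * x ^ 2)) ^ n := by gcongr
    _ = (18 + 2 / c) ^ n * (1 + c * x ^ 2) ^ n := mul_pow _ _ _
    _ ≤ (18 + 2 / c) ^ n * (n.factorial * Real.exp (1 + c * x ^ 2)) := by gcongr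
    _ = _ := by rw [Real.exp_add]; ring

variable {X : Type*} [MetricSpace X]

theorem dist_sub_le_setDist {R : ℝ} (hR : 0 < R) (a b : X) :
    dist a b - 2 * R ≤ setDist (Metric.ball a R) (Metric.ball b R) := by
  have : Nonempty (Metric.ball a R × Metric.ball b R) :=
    ⟨⟨⟨a, Metric.mem_ball_self hR⟩, ⟨b, Metric.mem_ball_self hR⟩⟩⟩
  refine le_ciInf fun z => ?_
  have h1 := Metric.mem_ball.1 z.1.2
  have h2 := Metric.mem_ball.1 z.2.2
  have h3 := dist_triangle4 a z.1 z.2 b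
  rw [dist_comm a (z.1 : X)] at h3
  linarith

theorem setDist_nonneg (A B : Set X) : 0 ≤ setDist A B := Real.iInf_nonneg fun _ => dist_nonneg

/-- Gaussian off-diagonal decay dominates any polynomial decay. -/
theorem exists_gaussian_le_wt {c : ℝ} (hc : 0 < c) (C : ℝ) {K : ℝ} (hK : 0 ≤ K) :
    ∃ C' : ℝ≥0∞, C' ≠ ⊤ ∧ ∀ (R : ℝ), 0 < R → ∀ a b : X,
      ENNReal.ofReal (C * Real.exp (-c * setDist (Metric.ball a R) (Metric.ball b R) ^ 2 / R ^ 2)) ≤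
        C' * wt R a b ^ (-K) := by
  obtain ⟨D, hD, h⟩ := exists_rpow_le_mul_exp hc K
  refine ⟨ENNReal.ofReal (|C| * D), ENNReal.ofReal_ne_top, fun R hR a b => ?_⟩
  have hw : 0 < 1 + dist a b / R := by positivity
  rw [wt, ENNReal.ofReal_rpow_of_pos hw, ← ENNReal.ofReal_mul (by positivity)]
  refine ENNReal.ofReal_le_ofReal ?_
  set S := setDist (Metric.ball a R) (Metric.ball b R) with hS
  have hS0 : 0 ≤ S / R := div_nonneg (setDist_nonneg _ _) hR.le
  have h1 : 1 + dist a b / R ≤ 3 + S / R := by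
    have := dist_sub_le_setDist hR a b
    have h2 : dist a b / R ≤ (S + 2 * R) / R := by gcongr; linarith
    rw [add_div, mul_div_cancel_right₀ _ hR.ne'] at h2
    linarith
  have h2 : (1 + dist a b / R) ^ K ≤ D * Real.exp (c * (S / R) ^ 2) :=
    (Real.rpow_le_rpow hw.le h1 hK).trans (h _ hS0)
  have e : Real.exp (-c * S ^ 2 / R ^ 2) = (Real.exp (c * (S / R) ^ 2))⁻¹ := by
    rw [← Real.exp_neg]; congr 1; rw [div_pow]; ring
  rw [e, Real.rpow_neg hw.le, mul_assoc]
  refine mul_le_mul (le_abs_self C) ?_ (by positivity) (abs_nonneg _)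
  rw [← div_eq_mul_inv, le_div_iff₀ (by positivity), inv_mul_le_iff₀ (by positivity), mul_comm]
  exact h2

end Gaussian

/-! ### Off-diagonal estimates. -/

section OffDiagonal

variable {X : Type*} [MetricSpace X] [LocallyCompactSpace X] [TopologicalSpace.SeparableSpace X]
  [MeasurableSpace X] [BorelSpace X] {μ : Measure X} [IsFiniteMeasureOnCompacts μ]
  [μ.IsOpenPosMeasure] {Γ : SublinearOperator μ} {L : L2 μ →ₗ.[ℂ] L2 μ} {ω : ℝ}

/-- Some admissible `q` exceeds `p₀` by definition of the supremum, and Hölder on averages passes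
down from `q` to `p₀`. -/
theorem exists_semigroup_offDiagonal (hD : Doubling μ) {p₀ : ℝ} (hp₀ : 0 < p₀)
    (hp₀L : ENNReal.ofReal p₀ < upperExponent L) {K : ℝ} (hK : 0 ≤ K) :
    ∃ C : ℝ≥0∞, C ≠ ⊤ ∧ ∀ (s : ℝ), 0 < s → ∀ (a b : X) (g : L2 μ),
      VanishesOutside μ g (Metric.ball a s) →
      eLpNorm (semigroup L (s ^ 2) g) (ENNReal.ofReal p₀) (μ.restrict (Metric.ball b s)) ≤
        C * wt s a b ^ (-K) * μ (Metric.ball b s) ^ (1 / p₀) *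
          (μ (Metric.ball a s) ^ (-(1 / 2) : ℝ) * eLpNorm g 2 μ) := by
  obtain ⟨_, ⟨q, hq2, ⟨C, c, hc, hq⟩, rfl⟩, hlt⟩ := lt_sSup_iff.1 hp₀L
  have hpq : p₀ ≤ q := by
    by_contra! h
    exact absurd (ENNReal.ofReal_le_ofReal h.le) (not_le.2 hlt)
  obtain ⟨C', hC', hG⟩ := exists_gaussian_le_wt (X := X) hc C hK
  refine ⟨C', hC', fun s hs a b g hg => ?_⟩
  have hb0 : μ (Metric.ball b s) ≠ 0 := (Metric.measure_ball_pos μ b hs).ne'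
  have hbt := hD.measure_ball_ne_top b s
  have h1 := hq (s ^ 2) (by positivity) a b g
  rw [Real.sqrt_sq hs.le] at h1
  have h2 := h1 hg
  rw [eLpNorm_restrict_eq_mul_avg hp₀ _ hb0 hbt]
  have h3 : avg μ 2 g (Metric.ball a s) ≤
      μ (Metric.ball a s) ^ (-(1 / 2) : ℝ) * eLpNorm g 2 μ := by
    rw [avg_eq two_pos, ENNReal.ofReal_ofNat]
    gcongr
    exact Measure.restrict_le_self
  calc _ ≤ μ (Metric.ball b s) ^ (1 / p₀) * (C' * wt s a b ^ (-K) *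
        (μ (Metric.ball a s) ^ (-(1 / 2) : ℝ) * eLpNorm g 2 μ)) := by
        gcongr
        refine (avg_mono_exponent hp₀ hpq (Lp.aestronglyMeasurable _) hb0 hbt).trans
          (h2.trans (mul_le_mul' (hG s hs a b) h3))
    _ = _ := by ring

theorem exists_semigroup_global (hD : Doubling μ) {p₀ : ℝ} (hp₀ : 0 < p₀)
    (hp₀L : ENNReal.ofReal p₀ < upperExponent L) :
    ∃ C : ℝ≥0∞, C ≠ ⊤ ∧ ∀ (s : ℝ), 0 < s → ∀ (a : X) (g : L2 μ),
      VanishesOutside μ g (Metric.ball a s) →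
      eLpNorm (semigroup L (s ^ 2) g) (ENNReal.ofReal p₀) μ ≤
        C * (μ (Metric.ball a s) ^ (1 / p₀ - 1 / 2) * eLpNorm g 2 μ) := by
  obtain ⟨ν, hν, C₁, hgr⟩ := hD.exists_growthBound
  change GrowthBound μ ν C₁ at hgr
  obtain ⟨C₂, hC₂, hsum⟩ := hgr.exists_tsum_net_le hν.le hD.measure_ball_ne_top
  -- After the `p₀`-th power the decay exponent is `3ν + 1`: `ν` compares the volume at `j` with
  -- that at `a`, and `2ν + 1` sums over the net.
  obtain ⟨C₃, hC₃, hoff⟩ := exists_semigroup_offDiagonal (L := L) hD hp₀ hp₀L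
    (K := (3 * ν + 1) / p₀) (by positivity)
  have hip : 0 ≤ 1 / p₀ := by positivity
  refine ⟨C₃ * C₁ ^ (1 / p₀) * C₂ ^ (1 / p₀), ?_, fun s hs a g hg => ?_⟩
  · exact ENNReal.mul_ne_top (ENNReal.mul_ne_top hC₃
      (ENNReal.rpow_ne_top_of_nonneg hip ENNReal.coe_ne_top))
      (ENNReal.rpow_ne_top_of_nonneg hip hC₂)
  obtain ⟨N, hN⟩ := exists_isNet (X := X) hs
  have : Countable N := (hN.countable hs).to_subtype
  have ha0 : μ (Metric.ball a s) ≠ 0 := (Metric.measure_ball_pos μ a hs).ne'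
  have hat := hD.measure_ball_ne_top a s
  set V := μ (Metric.ball a s)
  set G := eLpNorm g 2 μ
  have hcov : ⋃ j : N, Metric.ball (j : X) s = univ := by
    refine eq_univ_of_forall fun y => ?_
    obtain ⟨j, hj, hy⟩ := hN.cover y
    exact mem_iUnion.2 ⟨⟨j, hj⟩, hy⟩
  have hterm : ∀ j : N, ∫⁻ y in Metric.ball (j : X) s, ‖semigroup L (s ^ 2) g y‖ₑ ^ p₀ ∂μ ≤
      (C₃ * C₁ ^ (1 / p₀) * (V ^ (1 / p₀ - 1 / 2) * G)) ^ p₀ * wt s a j ^ (-(2 * ν + 1)) := by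
    intro j
    rw [← eLpNorm_ofReal_rpow hp₀]
    have e1 : wt s a j ^ (-(2 * ν + 1)) = (wt s a j ^ (-((2 * ν + 1) / p₀))) ^ p₀ := by
      rw [← ENNReal.rpow_mul]; congr 1; field_simp
    rw [e1, ← ENNReal.mul_rpow_of_nonneg _ _ hp₀.le]
    refine ENNReal.rpow_le_rpow ?_ hp₀.le
    calc _ ≤ C₃ * wt s a j ^ (-((3 * ν + 1) / p₀)) * μ (Metric.ball (j : X) s) ^ (1 / p₀) *
          (V ^ (-(1 / 2) : ℝ) * G) := hoff s hs a j g hg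
      _ ≤ C₃ * wt s a j ^ (-((3 * ν + 1) / p₀)) * (C₁ * wt s a j ^ ν * V) ^ (1 / p₀) *
          (V ^ (-(1 / 2) : ℝ) * G) := by
          gcongr
          exact hgr.ball_le hs a j
      _ = C₃ * C₁ ^ (1 / p₀) * ((V ^ (1 / p₀) * V ^ (-(1 / 2) : ℝ)) * G) *
          (wt s a j ^ (-((3 * ν + 1) / p₀)) * wt s a j ^ (ν * (1 / p₀))) := by
          rw [ENNReal.mul_rpow_of_nonneg _ _ hip, ENNReal.mul_rpow_of_nonneg _ _ hip,
            ← ENNReal.rpow_mul]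
          ring
      _ = _ := by
          rw [← ENNReal.rpow_add _ _ ha0 hat, ← wt_rpow_add hs, ← sub_eq_add_neg]
          congr 2
          field_simp
          ring
  rw [eLpNorm_ofReal_eq hp₀]
  have h1 : ∫⁻ y, ‖semigroup L (s ^ 2) g y‖ₑ ^ p₀ ∂μ ≤
      (C₃ * C₁ ^ (1 / p₀) * (V ^ (1 / p₀ - 1 / 2) * G)) ^ p₀ * C₂ := by
    refine (lintegral_le_tsum_of_cover hcov μ _).trans ((ENNReal.tsum_le_tsum hterm).trans ?_)
    rw [ENNReal.tsum_mul_left]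
    gcongr
    exact hsum s hs N hN a _ le_rfl
  refine (ENNReal.rpow_le_rpow h1 hip).trans_eq ?_
  rw [ENNReal.mul_rpow_of_nonneg _ _ hip, ← ENNReal.rpow_mul, mul_one_div_cancel hp₀.ne',
    ENNReal.rpow_one]
  ring

/-- Split e^{-2s²L} into two factors e^{-s²L}: the inner one maps L² of the ball into L^{p₀}, and
`(G_{p₀})` applies to the outer one. This is where the time `2s²` comes from. -/
theorem exists_gradient_global (hS : IsSetting μ Γ L ω) {p₀ : ℝ} (hp₀ : 0 < p₀)
    (hp₀L : ENNReal.ofReal p₀ < upperExponent L) (hG : GradientBound Γ L p₀) :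
    ∃ C : ℝ≥0∞, C ≠ ⊤ ∧ ∀ (s : ℝ), 0 < s → ∀ (a : X) (g : L2 μ),
      VanishesOutside μ g (Metric.ball a s) →
      ENNReal.ofReal s * eLpNorm (Γ.toFun (semigroup L (2 * s ^ 2) g)) (ENNReal.ofReal p₀) μ ≤
        C * (μ (Metric.ball a s) ^ (1 / p₀ - 1 / 2) * eLpNorm g 2 μ) := by
  obtain ⟨C₁, hC₁, h1⟩ := exists_semigroup_global (L := L) hS.doubling hp₀ hp₀L
  obtain ⟨C₂, h2⟩ := hG
  refine ⟨ENNReal.ofReal C₂ * C₁, ENNReal.mul_ne_top ENNReal.ofReal_ne_top hC₁,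
    fun s hs a g hg => ?_⟩
  have h3 := h1 s hs a g hg
  have ha0 : μ (Metric.ball a s) ≠ 0 := (Metric.measure_ball_pos μ a hs).ne'
  have hat := hS.doubling.measure_ball_ne_top a s
  have hmem : MemLp (semigroup L (s ^ 2) g) (ENNReal.ofReal p₀) μ := by
    refine ⟨Lp.aestronglyMeasurable _, h3.trans_lt ?_⟩
    refine ENNReal.mul_lt_top hC₁.lt_top (ENNReal.mul_lt_top ?_ (Lp.eLpNorm_lt_top g))
    exact (ENNReal.rpow_ne_top_of_ne_zero ha0 hat).lt_top
  have h4 := h2 (s ^ 2) (by positivity) _ hmem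
  have hsg := hS.accretive.isSemigroupOf_semigroup hS.omega_lt
  rw [Real.sqrt_sq hs.le, ← hsg.add_apply (sq_nonneg s) (sq_nonneg s), ← two_mul] at h4
  calc _ ≤ _ := h4
    _ ≤ ENNReal.ofReal C₂ * (C₁ * (μ (Metric.ball a s) ^ (1 / p₀ - 1 / 2) * eLpNorm g 2 μ)) := by
        gcongr
    _ = _ := by ring

/-- Davies-Gaffney at radius `√2 s`, to match the time `2s²` of the global bound; weights at the
scales `s` and `√2 s` are comparable. -/
theorem exists_gradient_offDiagonal_two (hS : IsSetting μ Γ L ω) {K : ℝ} (hK : 0 ≤ K) :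
    ∃ C : ℝ≥0∞, C ≠ ⊤ ∧ ∀ (s : ℝ), 0 < s → ∀ (a b : X) (g : L2 μ),
      VanishesOutside μ g (Metric.ball a s) →
      ENNReal.ofReal s * eLpNorm (Γ.toFun (semigroup L (2 * s ^ 2) g)) 2
        (μ.restrict (Metric.ball b s)) ≤ C * wt s a b ^ (-K) * eLpNorm g 2 μ := by
  obtain ⟨C, c, hc, h⟩ := hS.daviesGaffney
  obtain ⟨C', hC', hG⟩ := exists_gaussian_le_wt (X := X) hc C hK
  refine ⟨C' * 2 ^ K, ENNReal.mul_ne_top hC'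
    (ENNReal.rpow_ne_top_of_nonneg hK ENNReal.ofNat_ne_top), fun s hs a b g hg => ?_⟩
  have hr : 0 < √2 * s := by positivity
  have hsr : s ≤ √2 * s := le_mul_of_one_le_left hs.le (Real.one_le_sqrt.2 one_le_two)
  have hv : VanishesOutside μ g (Metric.ball a (√2 * s)) := by
    filter_upwards [hg] with y hy hya
    exact hy fun hya' => hya (Metric.ball_subset_ball hsr hya')
  have h1 := (h a b (√2 * s) hr g hv).2
  rw [mul_pow, Real.sq_sqrt zero_le_two] at h1
  have h2 := hG (√2 * s) hr a b
  rw [mul_pow, Real.sq_sqrt zero_le_two] at h2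
  have h3 : wt (√2 * s) a b ^ (-K) ≤ 2 ^ K * wt s a b ^ (-K) := by
    have h4 : wt s a b ≤ 2 * wt (√2 * s) a b := by
      rw [wt, wt, ← ENNReal.ofReal_ofNat 2, ← ENNReal.ofReal_mul zero_le_two]
      refine ENNReal.ofReal_le_ofReal ?_
      have h5 : √2 ≤ 2 := Real.sqrt_le_iff.2 ⟨zero_le_two, by norm_num⟩
      have h6 : dist a b / (2 * s) ≤ dist a b / (√2 * s) := by gcongr
      have h7 : dist a b / s = 2 * (dist a b / (2 * s)) := by field_simp
      linarith
    rw [ENNReal.rpow_neg, ENNReal.rpow_neg, ← div_eq_mul_inv,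
      ENNReal.le_div_iff_mul_le (Or.inl (ENNReal.rpow_pos (pos_iff_ne_zero.2 (wt_ne_zero hs))
        wt_ne_top).ne') (Or.inl (ENNReal.rpow_ne_top_of_nonneg hK wt_ne_top)), mul_comm,
      ← div_eq_mul_inv]
    refine ENNReal.div_le_of_le_mul ?_
    rw [← ENNReal.mul_rpow_of_nonneg _ _ hK]
    exact ENNReal.rpow_le_rpow h4 hK
  calc _ ≤ ENNReal.ofReal (√2 * s) * eLpNorm (Γ.toFun (semigroup L (2 * s ^ 2) g)) 2
        (μ.restrict (Metric.ball b (√2 * s))) :=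
        mul_le_mul' (ENNReal.ofReal_le_ofReal hsr) (eLpNorm_mono_measure _
          (Measure.restrict_mono (Metric.ball_subset_ball hsr) le_rfl))
    _ ≤ _ := h1
    _ ≤ C' * (2 ^ K * wt s a b ^ (-K)) * eLpNorm g 2 μ := by
        gcongr
        exact h2.trans (by gcongr)
    _ = _ := by ring

/-- `L^2`-`L^p` off-diagonal estimates for the gradient of the semigroup. -/
theorem exists_gradient_offDiagonal (hS : IsSetting μ Γ L ω) {p p₀ : ℝ} (hp : 2 < p)
    (hpp₀ : p < p₀) (hp₀L : ENNReal.ofReal p₀ < upperExponent L) (hG : GradientBound Γ L p₀)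
    {K : ℝ} (hK : 0 ≤ K) :
    ∃ C : ℝ≥0∞, C ≠ ⊤ ∧ ∀ (s : ℝ), 0 < s → ∀ (a b : X) (g : L2 μ),
      VanishesOutside μ g (Metric.ball a s) →
      ENNReal.ofReal s * eLpNorm (Γ.toFun (semigroup L (2 * s ^ 2) g)) (ENNReal.ofReal p)
        (μ.restrict (Metric.ball b s)) ≤
        C * wt s a b ^ (-K) * (μ (Metric.ball a s) ^ (1 / p - 1 / 2) * eLpNorm g 2 μ) := by
  have hp0 : 0 < p := by linarith
  have hp₀0 : 0 < p₀ := by linarith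
  have hd : 0 < p₀ - 2 := by linarith
  -- Interpolation exponents: `1/p = θ/2 + η/p₀`.
  set θ := 2 * (p₀ - p) / (p * (p₀ - 2)) with hθ
  set η := p₀ * (p - 2) / (p * (p₀ - 2)) with hη
  have hθ0 : 0 < θ := div_pos (by linarith) (by positivity)
  have hη0 : 0 < η := div_pos (mul_pos hp₀0 (by linarith)) (by positivity)
  have hsum : θ + η = 1 := by rw [hθ, hη]; field_simp; ring
  have hexp : (1 / p₀ - 1 / 2) * η = 1 / p - 1 / 2 := by rw [hη]; field_simp; ring
  -- Only the L² factor decays and it enters with power `θ`, hence the exponent `K / θ`.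
  obtain ⟨C₁, hC₁, h1⟩ := exists_gradient_offDiagonal_two hS (K := K / θ) (by positivity)
  obtain ⟨C₂, hC₂, h2⟩ := exists_gradient_global hS hp₀0 hp₀L hG
  refine ⟨C₁ ^ θ * C₂ ^ η, ENNReal.mul_ne_top (ENNReal.rpow_ne_top_of_nonneg hθ0.le hC₁)
    (ENNReal.rpow_ne_top_of_nonneg hη0.le hC₂), fun s hs a b g hg => ?_⟩
  have h3 := h1 s hs a b g hg
  have h4 := h2 s hs a g hg
  set u := Γ.toFun (semigroup L (2 * s ^ 2) g)
  have h5 := eLpNorm_le_rpow_mul_rpow (μ := μ.restrict (Metric.ball b s)) two_pos hp hpp₀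
    (Lp.aestronglyMeasurable u).restrict
  rw [ENNReal.ofReal_ofNat, ← hθ, ← hη] at h5
  have h6 : eLpNorm u (ENNReal.ofReal p₀) (μ.restrict (Metric.ball b s)) ≤
      eLpNorm u (ENNReal.ofReal p₀) μ := eLpNorm_mono_measure _ Measure.restrict_le_self
  have hsplit : ∀ x : ℝ≥0∞, x = x ^ θ * x ^ η := fun x => by
    rw [← ENNReal.rpow_add_of_nonneg _ _ hθ0.le hη0.le, hsum, ENNReal.rpow_one]
  set A := eLpNorm u 2 (μ.restrict (Metric.ball b s))
  set B := eLpNorm u (ENNReal.ofReal p₀) μ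
  set V := μ (Metric.ball a s)
  set G := eLpNorm g 2 μ
  calc _ ≤ (ENNReal.ofReal s ^ θ * ENNReal.ofReal s ^ η) * (A ^ θ * B ^ η) := by
        rw [← hsplit]
        gcongr
        exact h5.trans (by gcongr)
    _ = (ENNReal.ofReal s * A) ^ θ * (ENNReal.ofReal s * B) ^ η := by
        rw [ENNReal.mul_rpow_of_nonneg _ _ hθ0.le, ENNReal.mul_rpow_of_nonneg _ _ hη0.le]
        ring
    _ ≤ (C₁ * wt s a b ^ (-(K / θ)) * G) ^ θ * (C₂ * (V ^ (1 / p₀ - 1 / 2) * G)) ^ η := by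
        gcongr
    _ = C₁ ^ θ * C₂ ^ η * (wt s a b ^ (-(K / θ) * θ)) *
        (V ^ ((1 / p₀ - 1 / 2) * η) * (G ^ θ * G ^ η)) := by
        rw [ENNReal.mul_rpow_of_nonneg _ _ hθ0.le, ENNReal.mul_rpow_of_nonneg _ _ hθ0.le,
          ENNReal.mul_rpow_of_nonneg _ _ hη0.le, ENNReal.mul_rpow_of_nonneg _ _ hη0.le,
          ← ENNReal.rpow_mul, ← ENNReal.rpow_mul]
        ring
    _ = _ := by
        rw [hexp, ← hsplit, neg_mul, div_mul_cancel₀ _ hθ0.ne']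

end OffDiagonal

end Caccioppoli

namespace Caccioppoli

/-! ### Decomposition of L² functions over a partition. -/

section Partition

variable {X : Type*} [MeasurableSpace X] {μ : Measure X} {ι : Type*} {Q : ι → Set X}

/-- The restriction of an `L^2` function to a measurable set. -/
noncomputable def cutoff (g : Lp ℂ 2 μ) {S : Set X} (hS : MeasurableSet S) : Lp ℂ 2 μ :=
  ((Lp.memLp g).indicator hS).toLp

theorem coeFn_cutoff (g : Lp ℂ 2 μ) {S : Set X} (hS : MeasurableSet S) :
    cutoff g hS =ᵐ[μ] S.indicator g := MemLp.coeFn_toLp _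

theorem eLpNorm_cutoff (g : Lp ℂ 2 μ) {S : Set X} (hS : MeasurableSet S) (p : ℝ≥0∞) :
    eLpNorm (cutoff g hS) p μ = eLpNorm g p (μ.restrict S) := by
  rw [eLpNorm_congr_ae (coeFn_cutoff g hS), eLpNorm_indicator_eq_eLpNorm_restrict hS]

theorem coeFn_sum_cutoff (hQ : ∀ j, MeasurableSet (Q j)) (hd : Pairwise (Function.onFun Disjoint Q))
    (g : Lp ℂ 2 μ) (F : Finset ι) :
    (∑ j ∈ F, cutoff g (hQ j) : Lp ℂ 2 μ) =ᵐ[μ] (⋃ j ∈ F, Q j).indicator g := by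
  classical
  induction F using Finset.induction_on with
  | empty =>
    rw [Finset.sum_empty]
    filter_upwards [Lp.coeFn_zero ℂ 2 μ] with y hy
    rw [hy, Pi.zero_apply]
    simp
  | insert i F hi ih =>
    rw [Finset.sum_insert hi]
    filter_upwards [ih, coeFn_cutoff g (hQ i), Lp.coeFn_add (cutoff g (hQ i))
      (∑ j ∈ F, cutoff g (hQ j))] with y h1 h2 h3
    rw [h3, Pi.add_apply, h1, h2, Finset.set_biUnion_insert, indicator_union_of_disjoint]
    exact disjoint_iUnion₂_right.2 fun j hj => hd fun h => hi (h ▸ hj)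

theorem hasSum_cutoff [Countable ι] (hQ : ∀ j, MeasurableSet (Q j))
    (hd : Pairwise (Function.onFun Disjoint Q)) (hU : ⋃ j, Q j = univ) (g : Lp ℂ 2 μ) :
    HasSum (fun j => cutoff g (hQ j)) g := by
  rw [HasSum, SummationFilter.unconditional_filter, Lp.tendsto_Lp_iff_tendsto_eLpNorm']
  have hmeas : ∀ F : Finset ι, MeasurableSet (⋃ j ∈ F, Q j) := fun F =>
    Finset.measurableSet_biUnion F fun j _ => hQ j
  have h1 : ∀ F : Finset ι, eLpNorm (⇑(∑ j ∈ F, cutoff g (hQ j)) - ⇑g) 2 μ =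
      (∫⁻ y, (⋃ j ∈ F, Q j)ᶜ.indicator (fun y => ‖g y‖ₑ ^ (2 : ℝ)) y ∂μ) ^ (1 / 2 : ℝ) := by
    intro F
    rw [lintegral_indicator (hmeas F).compl, ← eLpNorm_ofReal_eq two_pos, ENNReal.ofReal_ofNat,
      ← eLpNorm_indicator_eq_eLpNorm_restrict (hmeas F).compl]
    refine eLpNorm_congr_norm_ae ?_
    filter_upwards [coeFn_sum_cutoff hQ hd g F] with y hy
    rw [Pi.sub_apply, hy]
    by_cases hyF : y ∈ ⋃ j ∈ F, Q j
    · rw [indicator_of_mem hyF, indicator_of_notMem (by simpa using hyF), sub_self]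
    · rw [indicator_of_notMem hyF, indicator_of_mem (by simpa using hyF), zero_sub, norm_neg]
  simp only [h1]
  have hfin : ∫⁻ y, ‖g y‖ₑ ^ (2 : ℝ) ∂μ ≠ ⊤ := by
    rw [← eLpNorm_ofReal_rpow two_pos, ENNReal.ofReal_ofNat]
    exact ENNReal.rpow_ne_top_of_nonneg zero_le_two (Lp.eLpNorm_ne_top g)
  have hgm : Measurable fun y => ‖g y‖ₑ ^ (2 : ℝ) :=
    (Lp.stronglyMeasurable g).measurable.enorm.pow_const _
  have h2 : Tendsto (fun F : Finset ι =>
      ∫⁻ y, (⋃ j ∈ F, Q j)ᶜ.indicator (fun y => ‖g y‖ₑ ^ (2 : ℝ)) y ∂μ) atTop (𝓝 0) := by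
    rw [← lintegral_zero (μ := μ)]
    refine tendsto_lintegral_filter_of_dominated_convergence (fun y => ‖g y‖ₑ ^ (2 : ℝ))
      (Eventually.of_forall fun F => hgm.indicator (hmeas F).compl)
      (Eventually.of_forall fun F => Eventually.of_forall fun y => indicator_le_self _ _ y)
      hfin (Eventually.of_forall fun y => ?_)
    obtain ⟨j, hj⟩ := mem_iUnion.1 (hU ▸ mem_univ y)
    refine tendsto_const_nhds.congr' ?_
    filter_upwards [eventually_ge_atTop ({j} : Finset ι)] with F hF
    rw [indicator_of_notMem]
    rw [mem_compl_iff, not_not]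
    exact mem_biUnion (Finset.singleton_subset_iff.1 hF) hj
  have h3 := h2.ennrpow_const (1 / 2 : ℝ)
  rwa [ENNReal.zero_rpow_of_pos (by norm_num)] at h3

theorem vanishesOutside_cutoff {X : Type*} [MetricSpace X] [MeasurableSpace X] {μ : Measure X}
    (g : L2 μ) {S B : Set X} (hS : MeasurableSet S) (h : S ⊆ B) :
    VanishesOutside μ (cutoff g hS) B := by
  filter_upwards [coeFn_cutoff g hS] with y hy hyB
  rw [hy, indicator_of_notMem fun h' => hyB (h h')]

end Partition

/-- Countable subadditivity: partial sums obey the finite bound, and the sublevel set is closed in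
H. -/
theorem IsGraphSeminorm.le_tsum_of_hasSum {H : Type*} [NormedAddCommGroup H]
    [InnerProductSpace ℂ H] [CompleteSpace H] {L : H →ₗ.[ℂ] H} {ω : ℝ} {T : ℝ → H →L[ℂ] H}
    {Ψ : H → ℝ≥0∞} (hΨ : IsGraphSeminorm L Ψ) (hT : IsSemigroupOf T L)
    (hL : IsOmegaAccretive L ω) (hω : ω < Real.pi / 2) (hcos : 0 < Real.cos ω) {t : ℝ}
    (ht : 0 < t) {ι : Type*} {z : ι → H} {g : H} (hz : HasSum z g) :
    Ψ (T t g) ≤ ∑' j, Ψ (T t (z j)) := by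
  refine (hΨ.isClosed_sublevel hT hL hω hcos ht _).mem_of_tendsto hz
    (Eventually.of_forall fun F => ?_)
  change Ψ (T t (∑ j ∈ F, z j)) ≤ _
  have h := hΨ.sum_smul_le F (fun _ => 1) (fun j => T t (z j))
    fun j _ => apply_mem_domain hT hL hω hcos ht _
  simp only [one_smul, enorm_one, one_mul] at h
  rw [map_sum]
  exact h.trans (ENNReal.sum_le_tsum F)

/-! ### Elementary inequalities for series. -/

section Sums

theorem tsum_rpow_le {ι : Type*} {t : ℝ} (ht : 1 ≤ t) (y : ι → ℝ≥0∞) :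
    ∑' i, y i ^ t ≤ (∑' i, y i) ^ t := by
  have hs : ∀ x : ℝ≥0∞, x ^ t = x * x ^ (t - 1) := fun x => by
    nth_rewrite 2 [← ENNReal.rpow_one x]
    rw [← ENNReal.rpow_add_of_nonneg _ _ zero_le_one (by linarith), add_sub_cancel]
  rw [hs (∑' i, y i), ← ENNReal.tsum_mul_right]
  refine ENNReal.tsum_le_tsum fun i => ?_
  rw [hs]
  gcongr
  exact ENNReal.le_tsum i

/-- Each `v j` is at most the whole `ℓ^q` norm. This replaces Hölder's inequality and suffices
because the weights are summable. -/
theorem tsum_mul_le_mul_rpow {ι : Type*} {q : ℝ} (hq : 0 < q) (u v : ι → ℝ≥0∞) :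
    ∑' j, u j * v j ≤ (∑' j, u j) * (∑' j, v j ^ q) ^ (1 / q) := by
  rw [← ENNReal.tsum_mul_right]
  refine ENNReal.tsum_le_tsum fun j => ?_
  gcongr
  calc v j = (v j ^ q) ^ (1 / q) := by
        rw [← ENNReal.rpow_mul, mul_one_div_cancel hq.ne', ENNReal.rpow_one]
    _ ≤ _ := by
        gcongr
        exact ENNReal.le_tsum (f := fun j => v j ^ q) j

end Sums

/-! ### Weighted sums over nets. -/

section NetSums

variable {X : Type*} [MetricSpace X] [MeasurableSpace X] {μ : Measure X} {s r : ℝ} {N : Set X}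

theorem IsNet.iUnion_ball (hN : IsNet s N) : ⋃ j : N, Metric.ball (j : X) s = univ := by
  refine eq_univ_of_forall fun y => ?_
  obtain ⟨j, hj, hy⟩ := hN.cover y
  exact mem_iUnion.2 ⟨⟨j, hj⟩, hy⟩

/-- The `L^p` norm on a ball is controlled by a weighted `ℓ^q` norm of local `L^p` norms. -/
theorem IsNet.eLpNorm_ball_le [OpensMeasurableSpace X] [Countable N] (hN : IsNet s N) (hs : 0 < s)
    (hsr : s ≤ r) (x : X) {p q : ℝ} (hq : 0 < q) (hqp : q ≤ p) {K : ℝ} (hK : 0 ≤ K) (h : X → ℂ) :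
    eLpNorm h (ENNReal.ofReal p) (μ.restrict (Metric.ball x r)) ≤
      (∑' i : N, 3 ^ K * wt r x i ^ (-K) *
        eLpNorm h (ENNReal.ofReal p) (μ.restrict (Metric.ball (i : X) s)) ^ q) ^ (1 / q) := by
  have hr : 0 < r := hs.trans_le hsr
  have hp : 0 < p := hq.trans_le hqp
  set a : N → ℝ≥0∞ := fun i =>
    eLpNorm h (ENNReal.ofReal p) (μ.restrict (Metric.ball (i : X) s)) with ha
  have hterm : ∀ i : N, ∫⁻ y in Metric.ball (i : X) s, ‖h y‖ₑ ^ p ∂μ.restrict (Metric.ball x r) ≤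
      (3 ^ K * wt r x i ^ (-K) * a i ^ q) ^ (p / q) := by
    intro i
    rw [Measure.restrict_restrict Metric.isOpen_ball.measurableSet]
    rcases (Metric.ball (i : X) s ∩ Metric.ball x r).eq_empty_or_nonempty with he | ⟨y, hy1, hy2⟩
    · rw [he]; simp
    have hw : wt r x i ≤ 3 := by
      rw [← ENNReal.ofReal_ofNat 3]
      refine wt_le_ofReal ?_
      have h1 := dist_triangle_left x (i : X) y
      have h2 := Metric.mem_ball.1 hy1
      have h3 := Metric.mem_ball.1 hy2
      have h4 : dist x i / r ≤ 2 := by rw [div_le_iff₀ hr]; linarith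
      linarith
    -- Only balls meeting `B(x, r)` matter, and for these the inserted weight factor is at least 1.
    have hone : 1 ≤ 3 ^ K * wt r x i ^ (-K) := by
      rw [ENNReal.rpow_neg, ← div_eq_mul_inv, ENNReal.le_div_iff_mul_le
        (Or.inl (ENNReal.rpow_pos (pos_iff_ne_zero.2 (wt_ne_zero hr)) wt_ne_top).ne')
        (Or.inl (ENNReal.rpow_ne_top_of_nonneg hK wt_ne_top)), one_mul]
      exact ENNReal.rpow_le_rpow hw hK
    calc _ ≤ ∫⁻ y in Metric.ball (i : X) s, ‖h y‖ₑ ^ p ∂μ :=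
          lintegral_mono_set inter_subset_left
      _ = (a i ^ q) ^ (p / q) := by
          rw [← eLpNorm_ofReal_rpow hp, ← ENNReal.rpow_mul, mul_div_cancel₀ _ hq.ne']
      _ ≤ _ := by
          gcongr
          exact le_mul_of_one_le_left' hone
  rw [eLpNorm_ofReal_eq hp]
  calc _ ≤ ((∑' i : N, 3 ^ K * wt r x i ^ (-K) * a i ^ q) ^ (p / q)) ^ (1 / p) := by
        refine ENNReal.rpow_le_rpow ?_ (by positivity)
        exact (lintegral_le_tsum_of_cover hN.iUnion_ball _ _).trans
          ((ENNReal.tsum_le_tsum hterm).trans (tsum_rpow_le ((one_le_div hq).2 hqp) _))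
    _ = _ := by
        rw [← ENNReal.rpow_mul]
        congr 1
        field_simp

/-- Schur type estimate for the weights over a net. -/
theorem IsNet.tsum_wt_mul_tsum_le (hs : 0 < s) (hsr : s ≤ r) (x : X) {K E : ℝ} (hK : 0 ≤ K)
    {C : ℝ≥0∞} (hC : ∀ z : X, ∑' i : N, wt s z i ^ (-E) ≤ C) (β : N → ℝ≥0∞) :
    ∑' i : N, wt r x i ^ (-K) * ∑' j : N, wt s (j : X) i ^ (-(K + E)) * β j ≤
      C * ∑' j : N, wt r x j ^ (-K) * β j := by
  have hr : 0 < r := hs.trans_le hsr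
  calc _ ≤ ∑' i : N, ∑' j : N, wt r x j ^ (-K) * β j * wt s (j : X) i ^ (-E) := by
        refine ENNReal.tsum_le_tsum fun i => ?_
        rw [← ENNReal.tsum_mul_left]
        refine ENNReal.tsum_le_tsum fun j => ?_
        -- Peetre at scale `r`; the growing weight is then enlarged by passing to the smaller scale
        -- `s`, where `wt s j i ^ (-(K + E))` absorbs it.
        have h1 : wt r x i ^ (-K) ≤ wt r x j ^ (-K) * wt s (j : X) i ^ K := by
          refine (wt_rpow_neg_le hr hK x i j).trans ?_
          rw [wt_comm r (i : X)]
          gcongr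
          exact wt_anti hs hsr _ _
        calc _ ≤ wt r x j ^ (-K) * wt s (j : X) i ^ K * (wt s (j : X) i ^ (-(K + E)) * β j) := by
              gcongr
          _ = wt r x j ^ (-K) * β j * (wt s (j : X) i ^ K * wt s (j : X) i ^ (-(K + E))) := by ring
          _ = _ := by
              rw [← wt_rpow_add hs]
              congr 2
              ring
    _ = ∑' j : N, wt r x j ^ (-K) * β j * ∑' i : N, wt s (j : X) i ^ (-E) := by
        rw [ENNReal.tsum_comm]
        simp only [ENNReal.tsum_mul_left]
    _ ≤ ∑' j : N, wt r x j ^ (-K) * β j * C := ENNReal.tsum_le_tsum fun j => by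
        gcongr
        exact hC _
    _ = _ := by rw [ENNReal.tsum_mul_right, mul_comm]

theorem rpow_neg_le_of_le_mul {a b c : ℝ≥0∞} (ha : a ≠ 0)
    (hat : a ≠ ⊤) (h : a ≤ c * b) {ε : ℝ} (hε : 0 ≤ ε) : b ^ (-ε) ≤ c ^ ε * a ^ (-ε) := by
  rw [ENNReal.rpow_neg a, ← div_eq_mul_inv, ENNReal.le_div_iff_mul_le
    (Or.inl (ENNReal.rpow_pos (pos_iff_ne_zero.2 ha) hat).ne')
    (Or.inl (ENNReal.rpow_ne_top_of_nonneg hε hat)), ENNReal.rpow_neg, mul_comm, ← div_eq_mul_inv]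
  refine ENNReal.div_le_of_le_mul ?_
  rw [← ENNReal.mul_rpow_of_nonneg _ _ hε]
  exact ENNReal.rpow_le_rpow h hε

/-- The weighted sum of local `L^q` masses over a partition subordinate to a net. -/
theorem GrowthBound.tsum_local_le [OpensMeasurableSpace X] [μ.IsOpenPosMeasure] {ν : ℝ} {C : ℝ≥0}
    (hgr : GrowthBound μ ν C) (hν : 0 ≤ ν) (hfin : ∀ (x : X) (r : ℝ), μ (Metric.ball x r) ≠ ⊤)
    [Countable N] (hs : 0 < s) (hsr : s ≤ r) {Q : N → Set X} (hQ : ∀ j, MeasurableSet (Q j))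
    (hd : Pairwise (Function.onFun Disjoint Q)) (hQB : ∀ j, Q j ⊆ Metric.ball (j : X) s)
    (hU : ⋃ j, Q j = univ) {p q : ℝ} (hq : 2 ≤ q) (hqp : q ≤ p) {A : ℝ} (hA : 0 ≤ A) (x : X)
    {g : X → ℂ} (hg : AEStronglyMeasurable g μ) :
    ∑' j : N, wt r x j ^ (-(ν + A * q + ν * (1 - q / p))) *
      (μ (Metric.ball (j : X) s) ^ (1 / p - 1 / 2) * eLpNorm g 2 (μ.restrict (Q j))) ^ q ≤
    (C * C) ^ (1 - q / p) * 2 ^ (ν + A * q) * (2 ^ (ν + A * q) * C) *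
      (ENNReal.ofReal ((r / s) ^ (ν * (1 - q / p))) * μ (Metric.ball x r) ^ (q / p) *
        (∑' l : ℕ, (2 : ℝ≥0∞) ^ (-(l * A)) * avg μ q g (Metric.ball x (2 ^ l * r))) ^ q) := by
  have hr : 0 < r := hs.trans_le hsr
  have hq0 : 0 < q := by linarith
  have hp0 : 0 < p := by linarith
  have hε : 0 ≤ 1 - q / p := sub_nonneg.2 ((div_le_one hp0).2 hqp)
  have hrs : 0 < r / s := by positivity
  set ε := 1 - q / p
  set K := ν + A * q
  have hK : 0 ≤ K := by positivity
  have hpos : ∀ (y : X) {t : ℝ}, 0 < t → μ (Metric.ball y t) ≠ 0 := fun y t ht =>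
    (Metric.measure_ball_pos μ y ht).ne'
  set V := μ (Metric.ball x r)
  have hV0 : V ≠ 0 := hpos x hr
  have hVt : V ≠ ⊤ := hfin x r
  have hg2 : AEMeasurable (fun y => ‖g y‖ₑ ^ q) μ := hg.enorm.pow_const _
  have hterm : ∀ j : N, wt r x j ^ (-(K + ν * ε)) *
      (μ (Metric.ball (j : X) s) ^ (1 / p - 1 / 2) * eLpNorm g 2 (μ.restrict (Q j))) ^ q ≤
      (C * C) ^ ε * 2 ^ K * (ENNReal.ofReal ((r / s) ^ (ν * ε)) * V ^ (-ε)) *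
        ∫⁻ y in Q j, wt r x y ^ (-K) * ‖g y‖ₑ ^ q ∂μ := by
    intro j
    set B := μ (Metric.ball (j : X) s)
    have hB0 : B ≠ 0 := hpos j hs
    have hBt : B ≠ ⊤ := hfin j s
    have h1 : eLpNorm g 2 (μ.restrict (Q j)) ≤
        eLpNorm g (ENNReal.ofReal q) (μ.restrict (Q j)) * B ^ (1 / 2 - 1 / q) := by
      have := eLpNorm_restrict_le_mul_rpow two_pos hq hg (Q j)
      rw [ENNReal.ofReal_ofNat] at this
      refine this.trans ?_
      gcongr
      · exact sub_nonneg.2 (one_div_le_one_div_of_le two_pos hq)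
      · exact measure_mono (hQB j)
    -- After Hölder from L² to L^q the volume exponents add up to `(1/p - 1/q) q = -ε`.
    have h2 : (B ^ (1 / p - 1 / 2) * eLpNorm g 2 (μ.restrict (Q j))) ^ q ≤
        B ^ (-ε) * ∫⁻ y in Q j, ‖g y‖ₑ ^ q ∂μ := by
      calc _ ≤ (B ^ (1 / p - 1 / 2) *
            (eLpNorm g (ENNReal.ofReal q) (μ.restrict (Q j)) * B ^ (1 / 2 - 1 / q))) ^ q := by
            gcongr
        _ = (B ^ (1 / p - 1 / 2) * B ^ (1 / 2 - 1 / q)) ^ q *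
            eLpNorm g (ENNReal.ofReal q) (μ.restrict (Q j)) ^ q := by
            rw [← ENNReal.mul_rpow_of_nonneg _ _ hq0.le]
            congr 1
            ring
        _ = _ := by
            rw [← ENNReal.rpow_add _ _ hB0 hBt, ← ENNReal.rpow_mul, eLpNorm_ofReal_rpow hq0]
            congr 2
            simp only [ε]
            field_simp
            ring
    -- A small ball may have small volume: comparison with `V` produces the loss `(r/s)^(νε)` and
    -- uses up the part `νε` of the weight.
    have h3 : B ^ (-ε) ≤
        (C * C) ^ ε * wt r x j ^ (ν * ε) * ENNReal.ofReal ((r / s) ^ (ν * ε)) * V ^ (-ε) := by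
      have hVB : V ≤ C * C * wt r x j ^ ν * ENNReal.ofReal ((r / s) ^ ν) * B := by
        calc V ≤ C * wt r (j : X) x ^ ν * μ (Metric.ball (j : X) r) := hgr.ball_le hr j x
          _ ≤ C * wt r x j ^ ν * (C * ENNReal.ofReal ((r / s) ^ ν) * B) := by
              rw [wt_comm]
              gcongr
              exact hgr _ _ _ hs hsr
          _ = _ := by ring
      refine (rpow_neg_le_of_le_mul hV0 hVt hVB hε).trans_eq ?_
      rw [ENNReal.mul_rpow_of_nonneg _ _ hε, ENNReal.mul_rpow_of_nonneg _ _ hε,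
        ← ENNReal.rpow_mul, ENNReal.ofReal_rpow_of_pos (by positivity), ← Real.rpow_mul hrs.le]
    have h4 : wt r x j ^ (-K) * ∫⁻ y in Q j, ‖g y‖ₑ ^ q ∂μ ≤
        2 ^ K * ∫⁻ y in Q j, wt r x y ^ (-K) * ‖g y‖ₑ ^ q ∂μ := by
      have hwg : AEMeasurable (fun y => wt r x y ^ (-K) * ‖g y‖ₑ ^ q) (μ.restrict (Q j)) :=
        ((((measurable_wt r x).pow_const _).aemeasurable).mul hg2).restrict
      rw [← lintegral_const_mul'' _ hg2.restrict, ← lintegral_const_mul'' _ hwg]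
      refine setLIntegral_mono' (hQ j) fun y hy => ?_
      rw [← mul_assoc]
      gcongr
      refine (wt_rpow_neg_le hr hK x j y).trans ?_
      rw [mul_comm]
      gcongr
      rw [← ENNReal.ofReal_ofNat 2]
      refine wt_le_ofReal ?_
      have : dist (j : X) y / r ≤ 1 := by
        rw [div_le_one hr, dist_comm]
        exact ((Metric.mem_ball.1 (hQB j hy)).le).trans hsr
      linarith
    calc _ ≤ wt r x j ^ (-(K + ν * ε)) * (((C * C) ^ ε * wt r x j ^ (ν * ε) *
          ENNReal.ofReal ((r / s) ^ (ν * ε)) * V ^ (-ε)) * ∫⁻ y in Q j, ‖g y‖ₑ ^ q ∂μ) := by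
          gcongr
          exact h2.trans (by gcongr)
      _ = (C * C) ^ ε * (ENNReal.ofReal ((r / s) ^ (ν * ε)) * V ^ (-ε)) *
          ((wt r x j ^ (-(K + ν * ε)) * wt r x j ^ (ν * ε)) * ∫⁻ y in Q j, ‖g y‖ₑ ^ q ∂μ) := by
          ring
      _ = (C * C) ^ ε * (ENNReal.ofReal ((r / s) ^ (ν * ε)) * V ^ (-ε)) *
          (wt r x j ^ (-K) * ∫⁻ y in Q j, ‖g y‖ₑ ^ q ∂μ) := by
          rw [← wt_rpow_add hr]
          congr 3
          ring
      _ ≤ (C * C) ^ ε * (ENNReal.ofReal ((r / s) ^ (ν * ε)) * V ^ (-ε)) *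
          (2 ^ K * ∫⁻ y in Q j, wt r x y ^ (-K) * ‖g y‖ₑ ^ q ∂μ) := by gcongr
      _ = _ := by ring
  -- In `K = ν + A q`, `ν` absorbs the volume of the dilated balls, and the rest is the q-th power
  -- of `2^{-lA}`.
  have htail : ∫⁻ y, wt r x y ^ (-K) * ‖g y‖ₑ ^ q ∂μ ≤ 2 ^ K * C * V *
      (∑' l : ℕ, (2 : ℝ≥0∞) ^ (-(l * A)) * avg μ q g (Metric.ball x (2 ^ l * r))) ^ q := by
    refine (lintegral_wt_mul_le hr hK x hg2).trans ?_
    refine le_trans ?_ (mul_le_mul_right (tsum_rpow_le (by linarith) _) _)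
    rw [← ENNReal.tsum_mul_left]
    refine ENNReal.tsum_le_tsum fun l => ?_
    have hl : 0 < 2 ^ l * r := by positivity
    rw [← eLpNorm_ofReal_rpow hq0, eLpNorm_restrict_eq_mul_avg hq0 g (hpos x hl) (hfin x _),
      ENNReal.mul_rpow_of_nonneg _ _ hq0.le, ENNReal.mul_rpow_of_nonneg _ _ hq0.le,
      ← ENNReal.rpow_mul, ← ENNReal.rpow_mul, one_div_mul_cancel hq0.ne', ENNReal.rpow_one]
    calc _ ≤ (2 : ℝ≥0∞) ^ K * (2 ^ (-(l * K)) * ((C * 2 ^ (l * ν) * V) *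
          avg μ q g (Metric.ball x (2 ^ l * r)) ^ q)) := by
          gcongr
          exact hgr.dyadic_ball_le hr x l
      _ = (2 : ℝ≥0∞) ^ K * C * V * ((2 ^ (-(l * K)) * 2 ^ (l * ν)) *
          avg μ q g (Metric.ball x (2 ^ l * r)) ^ q) := by ring
      _ = _ := by
          rw [← ENNReal.rpow_add _ _ two_ne_zero ENNReal.ofNat_ne_top]
          congr 3
          simp only [K]
          ring
  refine (ENNReal.tsum_le_tsum hterm).trans ?_
  rw [ENNReal.tsum_mul_left, ← lintegral_iUnion hQ hd, hU, setLIntegral_univ]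
  refine (mul_le_mul_right htail _).trans_eq ?_
  have e : V ^ (q / p) = V ^ (-ε) * V := by
    nth_rewrite 3 [← ENNReal.rpow_one V]
    rw [← ENNReal.rpow_add _ _ hV0 hVt]
    congr 1
    simp only [ε]
    ring
  rw [e]
  ring

end NetSums

/-! ### The local gradient estimate. -/

section Local

variable {X : Type*} [MetricSpace X] [LocallyCompactSpace X] [TopologicalSpace.SeparableSpace X]
  [MeasurableSpace X] [BorelSpace X] {μ : Measure X} [IsFiniteMeasureOnCompacts μ]
  [μ.IsOpenPosMeasure] {Γ : SublinearOperator μ} {L : L2 μ →ₗ.[ℂ] L2 μ} {ω : ℝ}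

theorem IsSetting.cos_pos (hS : IsSetting μ Γ L ω) : 0 < Real.cos ω :=
  Real.cos_pos_of_mem_Ioo ⟨by linarith [hS.omega_nonneg, Real.pi_pos], hS.omega_lt⟩

/-- Local `L^q`-`L^p` estimate for the gradient of the semigroup at scales below the radius. -/
theorem exists_gradient_local (hS : IsSetting μ Γ L ω) {p p₀ : ℝ} (hp : 2 < p)
    (hpp₀ : p < p₀) (hp₀L : ENNReal.ofReal p₀ < upperExponent L) (hG : GradientBound Γ L p₀)
    {ν : ℝ} (hν : 0 < ν) (hgrow : VolumeGrowth μ ν) {q : ℝ} (hq : 2 ≤ q) (hqp : q ≤ p)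
    {A : ℝ} (hA : 0 ≤ A) :
    ∃ C : ℝ≥0∞, C ≠ ⊤ ∧ ∀ (s r : ℝ), 0 < s → s ≤ r → ∀ (x : X) (g : L2 μ),
      ENNReal.ofReal s * eLpNorm (Γ.toFun (semigroup L (2 * s ^ 2) g)) (ENNReal.ofReal p)
        (μ.restrict (Metric.ball x r)) ≤
      C * (ENNReal.ofReal ((r / s) ^ (ν * (1 / q - 1 / p))) * μ (Metric.ball x r) ^ (1 / p) *
        ∑' l : ℕ, (2 : ℝ≥0∞) ^ (-(l * A)) * avg μ q g (Metric.ball x (2 ^ l * r))) := by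
  obtain ⟨C₁, hgr⟩ := hgrow
  change GrowthBound μ ν C₁ at hgr
  have hfin := hS.doubling.measure_ball_ne_top
  have hq0 : 0 < q := by linarith
  have hp0 : 0 < p := by linarith
  have hε : 0 ≤ 1 - q / p := sub_nonneg.2 ((div_le_one hp0).2 hqp)
  have hiq : 0 ≤ 1 / q := by positivity
  set E := 2 * ν + 1 with hE
  set K := ν + A * q + ν * (1 - q / p) with hK
  have hK0 : 0 ≤ K := by positivity
  obtain ⟨C₂, hC₂, hnet⟩ := hgr.exists_tsum_net_le hν.le hfin
  -- The part `E` of the decay sums over the sources `j`; the part `(K + E) / q` becomes `K + E`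
  -- after the q-th power, as the Schur estimate requires.
  obtain ⟨C₃, hC₃, hoff⟩ := exists_gradient_offDiagonal hS hp hpp₀ hp₀L hG
    (K := E + (K + E) / q) (by positivity)
  set D : ℝ≥0∞ := (C₁ * C₁) ^ (1 - q / p) * 2 ^ (ν + A * q) * (2 ^ (ν + A * q) * C₁)
  have h2t : ∀ {x : ℝ}, 0 ≤ x → (2 : ℝ≥0∞) ^ x ≠ ⊤ := fun hx =>
    ENNReal.rpow_ne_top_of_nonneg hx ENNReal.ofNat_ne_top
  have hDt : D ≠ ⊤ := by
    refine ENNReal.mul_ne_top (ENNReal.mul_ne_top (ENNReal.rpow_ne_top_of_nonneg hε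
      (ENNReal.mul_ne_top ?_ ?_)) (h2t (by positivity)))
      (ENNReal.mul_ne_top (h2t (by positivity)) ?_) <;> exact ENNReal.coe_ne_top
  refine ⟨(3 ^ K * (C₃ * C₂) ^ q * C₂ * D) ^ (1 / q), ?_, fun s r hs hsr x g => ?_⟩
  · refine ENNReal.rpow_ne_top_of_nonneg hiq (ENNReal.mul_ne_top (ENNReal.mul_ne_top
      (ENNReal.mul_ne_top (ENNReal.rpow_ne_top_of_nonneg hK0 ENNReal.ofNat_ne_top)
        (ENNReal.rpow_ne_top_of_nonneg hq0.le (ENNReal.mul_ne_top hC₃ hC₂))) hC₂) hDt)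
  obtain ⟨N, hN⟩ := exists_isNet (X := X) hs
  have : Countable N := (hN.countable hs).to_subtype
  obtain ⟨Q, hQ, hd, hQB, hU⟩ := hN.exists_partition
  have hT := hS.accretive.isSemigroupOf_semigroup hS.omega_lt
  have ht : 0 < 2 * s ^ 2 := by positivity
  set u := Γ.toFun (semigroup L (2 * s ^ 2) g)
  set b : N → ℝ≥0∞ := fun j =>
    μ (Metric.ball (j : X) s) ^ (1 / p - 1 / 2) * eLpNorm g 2 (μ.restrict (Q j)) with hb
  -- Split `g` over the partition, apply the off-diagonal bound to each piece, and spend part of the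
  -- decay to move the q-th power inside the sum.
  have hlocal : ∀ i : N, (ENNReal.ofReal s *
      eLpNorm u (ENNReal.ofReal p) (μ.restrict (Metric.ball (i : X) s))) ^ q ≤
      (C₃ * C₂) ^ q * ∑' j : N, wt s (j : X) i ^ (-(K + E)) * b j ^ q := by
    intro i
    have h1 := (hS.isGraphSeminorm (p := ENNReal.ofReal p)
      (by rw [← ENNReal.ofReal_one]; exact ENNReal.ofReal_le_ofReal (by linarith))
      (Metric.ball (i : X) s)).le_tsum_of_hasSum hT hS.accretive hS.omega_lt hS.cos_pos ht
      (hasSum_cutoff hQ hd hU g)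
    have h2 : ENNReal.ofReal s *
        eLpNorm u (ENNReal.ofReal p) (μ.restrict (Metric.ball (i : X) s)) ≤
        C₃ * ∑' j : N, wt s (j : X) i ^ (-E) * (wt s (j : X) i ^ (-((K + E) / q)) * b j) := by
      refine (mul_le_mul_right h1 _).trans ?_
      rw [← ENNReal.tsum_mul_left, ← ENNReal.tsum_mul_left]
      refine ENNReal.tsum_le_tsum fun j => ?_
      refine (hoff s hs j i _ (vanishesOutside_cutoff g (hQ j) (hQB j))).trans_eq ?_
      rw [eLpNorm_cutoff, neg_add, wt_rpow_add hs]
      ring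
    have h3 : ∑' j : N, wt s (j : X) i ^ (-E) ≤ C₂ := by
      simp only [wt_comm s _ (i : X)]
      exact hnet s hs N hN i E le_rfl
    calc _ ≤ (C₃ * (C₂ * (∑' j : N, (wt s (j : X) i ^ (-((K + E) / q)) * b j) ^ q) ^
          (1 / q))) ^ q := by
          refine ENNReal.rpow_le_rpow (h2.trans ?_) hq0.le
          gcongr
          exact (tsum_mul_le_mul_rpow hq0 _ _).trans (mul_le_mul_left h3 _)
      _ = (C₃ * C₂) ^ q * ∑' j : N, (wt s (j : X) i ^ (-((K + E) / q)) * b j) ^ q := by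
          rw [← mul_assoc, ENNReal.mul_rpow_of_nonneg _ _ hq0.le, ← ENNReal.rpow_mul,
            one_div_mul_cancel hq0.ne', ENNReal.rpow_one]
      _ = _ := by
          congr 1
          refine tsum_congr fun j => ?_
          rw [ENNReal.mul_rpow_of_nonneg _ _ hq0.le, ← ENNReal.rpow_mul, neg_mul,
            div_mul_cancel₀ _ hq0.ne']
  have hmain : ∑' i : N, 3 ^ K * wt r x i ^ (-K) * (ENNReal.ofReal s *
      eLpNorm u (ENNReal.ofReal p) (μ.restrict (Metric.ball (i : X) s))) ^ q ≤
      3 ^ K * (C₃ * C₂) ^ q * C₂ * D * (ENNReal.ofReal ((r / s) ^ (ν * (1 - q / p))) *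
        μ (Metric.ball x r) ^ (q / p) *
        (∑' l : ℕ, (2 : ℝ≥0∞) ^ (-(l * A)) * avg μ q g (Metric.ball x (2 ^ l * r))) ^ q) := by
    calc _ ≤ ∑' i : N, 3 ^ K * (C₃ * C₂) ^ q * (wt r x i ^ (-K) *
          ∑' j : N, wt s (j : X) i ^ (-(K + E)) * b j ^ q) := by
          refine ENNReal.tsum_le_tsum fun i => ?_
          calc _ ≤ 3 ^ K * wt r x i ^ (-K) *
                ((C₃ * C₂) ^ q * ∑' j : N, wt s (j : X) i ^ (-(K + E)) * b j ^ q) := by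
                gcongr
                exact hlocal i
            _ = _ := by ring
      _ ≤ 3 ^ K * (C₃ * C₂) ^ q * (C₂ * ∑' j : N, wt r x j ^ (-K) * b j ^ q) := by
          rw [ENNReal.tsum_mul_left]
          gcongr
          exact IsNet.tsum_wt_mul_tsum_le hs hsr x hK0
            (fun z => hnet s hs N hN z E le_rfl) _
      _ ≤ 3 ^ K * (C₃ * C₂) ^ q * (C₂ * (D * (ENNReal.ofReal ((r / s) ^ (ν * (1 - q / p))) *
          μ (Metric.ball x r) ^ (q / p) *
          (∑' l : ℕ, (2 : ℝ≥0∞) ^ (-(l * A)) *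
            avg μ q g (Metric.ball x (2 ^ l * r))) ^ q))) := by
          gcongr
          exact hgr.tsum_local_le hν.le hfin hs hsr hQ hd hQB hU hq hqp hA x
            (Lp.aestronglyMeasurable g)
      _ = _ := by ring
  have hrs : 0 < r / s := div_pos (hs.trans_le hsr) hs
  calc _ ≤ ENNReal.ofReal s * (∑' i : N, 3 ^ K * wt r x i ^ (-K) *
        eLpNorm u (ENNReal.ofReal p) (μ.restrict (Metric.ball (i : X) s)) ^ q) ^ (1 / q) := by
        gcongr
        exact hN.eLpNorm_ball_le hs hsr x hq0 hqp hK0 u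
    _ = (∑' i : N, 3 ^ K * wt r x i ^ (-K) * (ENNReal.ofReal s *
        eLpNorm u (ENNReal.ofReal p) (μ.restrict (Metric.ball (i : X) s))) ^ q) ^ (1 / q) := by
        have e : ENNReal.ofReal s = (ENNReal.ofReal s ^ q) ^ (1 / q) := by
          rw [← ENNReal.rpow_mul, mul_one_div_cancel hq0.ne', ENNReal.rpow_one]
        nth_rewrite 1 [e]
        rw [← ENNReal.mul_rpow_of_nonneg _ _ hiq, ← ENNReal.tsum_mul_left]
        congr 1
        refine tsum_congr fun i => ?_
        rw [ENNReal.mul_rpow_of_nonneg _ _ hq0.le]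
        ring
    _ ≤ _ := ENNReal.rpow_le_rpow hmain hiq
    _ = _ := by
        have e1 : ν * (1 - q / p) * (1 / q) = ν * (1 / q - 1 / p) := by field_simp
        have e2 : q / p * (1 / q) = 1 / p := by field_simp
        generalize 3 ^ K * (C₃ * C₂) ^ q * C₂ * D = Z
        rw [ENNReal.mul_rpow_of_nonneg _ _ hiq, ENNReal.mul_rpow_of_nonneg _ _ hiq,
          ENNReal.mul_rpow_of_nonneg _ _ hiq, ENNReal.ofReal_rpow_of_pos (by positivity),
          ← Real.rpow_mul hrs.le, e1, ← ENNReal.rpow_mul, e2, ← ENNReal.rpow_mul,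
          mul_one_div_cancel hq0.ne', ENNReal.rpow_one]

end Local

end Caccioppoli

namespace Caccioppoli

/-! ### The Caccioppoli inequality. -/

section Caccioppoli

theorem avg_const_mul {X : Type*} [MetricSpace X] [MeasurableSpace X] (μ : Measure X) {q : ℝ}
    (hq : 0 < q) (c : ℂ) (f : X → ℂ) (s : Set X) :
    avg μ q (fun y => c * f y) s = ‖c‖ₑ * avg μ q f s := by
  rw [avg_eq hq, avg_eq hq, show (fun y => c * f y) = c • f from rfl, eLpNorm_const_smul]
  ring

theorem dilatedSum_eq {X : Type*} [MetricSpace X] [MeasurableSpace X] (μ : Measure X) {q : ℝ}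
    (hq : 0 < q) (N : ℝ) {r : ℝ} (hr : 0 < r) (M : ℕ) (x : X) (f g : X → ℂ) :
    dilatedSum μ q N r M x f g =
      (∑' l : ℕ, (2 : ℝ≥0∞) ^ (-(l * N)) * avg μ q f (Metric.ball x (2 ^ l * r))) +
      ENNReal.ofReal (r ^ (2 * M)) *
        ∑' l : ℕ, (2 : ℝ≥0∞) ^ (-(l * N)) * avg μ q g (Metric.ball x (2 ^ l * r)) := by
  rw [dilatedSum, ← ENNReal.tsum_mul_left, ← ENNReal.tsum_add]
  refine tsum_congr fun l => ?_
  have e : ‖((r : ℂ) ^ 2) ^ M‖ₑ = ENNReal.ofReal (r ^ (2 * M)) := by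
    rw [← ofReal_norm, norm_pow, norm_pow, Complex.norm_real, Real.norm_of_nonneg hr.le,
      pow_mul]
  rw [avg_const_mul μ hq, ofReal_two_rpow, e]
  ring

variable {X : Type*} [MetricSpace X] [LocallyCompactSpace X] [TopologicalSpace.SeparableSpace X]
  [MeasurableSpace X] [BorelSpace X] {μ : Measure X} [IsFiniteMeasureOnCompacts μ]
  [μ.IsOpenPosMeasure] {Γ : SublinearOperator μ} {L : L2 μ →ₗ.[ℂ] L2 μ} {ω : ℝ}

theorem exists_gradient_local_of_mem_Icc (hS : IsSetting μ Γ L ω) {p p₀ : ℝ} (hp : 2 < p)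
    (hpp₀ : p < p₀) (hp₀L : ENNReal.ofReal p₀ < upperExponent L) (hG : GradientBound Γ L p₀)
    {ν : ℝ} (hν : 0 < ν) (hgrow : VolumeGrowth μ ν) {q : ℝ} (hq : 2 ≤ q) (hqp : q ≤ p)
    {A : ℝ} (hA : 0 ≤ A) :
    ∃ C : ℝ≥0∞, C ≠ ⊤ ∧ ∀ r a : ℝ, 0 < r → 0 < a → ∀ σ ∈ Icc a (2 * r ^ 2),
      ∀ (x : X) (g : L2 μ),
      eLpNorm (Γ.toFun (semigroup L σ g)) (ENNReal.ofReal p) (μ.restrict (Metric.ball x r)) ≤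
      C * (ENNReal.ofReal (r⁻¹ * (2 * r ^ 2 / a) ^ (ν / 2 * (1 / q - 1 / p) + 1 / 2)) *
        μ (Metric.ball x r) ^ (1 / p) *
        ∑' l : ℕ, (2 : ℝ≥0∞) ^ (-(l * A)) * avg μ q g (Metric.ball x (2 ^ l * r))) := by
  obtain ⟨C, hC, h⟩ := exists_gradient_local hS hp hpp₀ hp₀L hG hν hgrow hq hqp hA
  refine ⟨C, hC, fun r a hr ha σ hσ x g => ?_⟩
  have hσ0 : 0 < σ := ha.trans_le hσ.1
  -- So `σ = 2s²`, and `σ ≤ 2r²` says exactly `s ≤ r`. The bound has a nonnegative power of `2r²/σ`,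
  -- so `σ` may be replaced by its lower bound `a`.
  set s := √(σ / 2) with hs_def
  have hs : 0 < s := Real.sqrt_pos.2 (by positivity)
  have hs2 : s ^ 2 = σ / 2 := Real.sq_sqrt (by positivity)
  have hsr : s ≤ r := Real.sqrt_le_iff.2 ⟨hr.le, by linarith [hσ.2]⟩
  have h1 := h s r hs hsr x g
  rw [show 2 * s ^ 2 = σ by rw [hs2]; ring] at h1
  set γ := ν * (1 / q - 1 / p) with hγ
  have hγ0 : 0 ≤ γ := mul_nonneg hν.le
    (sub_nonneg.2 (one_div_le_one_div_of_le (by linarith) hqp))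
  have e : s⁻¹ * (r / s) ^ γ = r⁻¹ * (2 * r ^ 2 / σ) ^ (ν / 2 * (1 / q - 1 / p) + 1 / 2) := by
    have h2 : 2 * r ^ 2 / σ = (r / s) ^ (2 : ℝ) := by
      rw [Real.rpow_two, div_pow, hs2]
      field_simp
    rw [h2, ← Real.rpow_mul (by positivity),
      show 2 * (ν / 2 * (1 / q - 1 / p) + 1 / 2) = γ + 1 by rw [hγ]; ring,
      Real.rpow_add_one (by positivity)]
    field_simp
  calc _ = ENNReal.ofReal s⁻¹ * (ENNReal.ofReal s * eLpNorm (Γ.toFun (semigroup L σ g))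
        (ENNReal.ofReal p) (μ.restrict (Metric.ball x r))) := by
        rw [← mul_assoc, ← ENNReal.ofReal_mul (by positivity), inv_mul_cancel₀ hs.ne',
          ENNReal.ofReal_one, one_mul]
    _ ≤ _ := mul_le_mul_right h1 _
    _ = C * (ENNReal.ofReal (s⁻¹ * (r / s) ^ γ) * μ (Metric.ball x r) ^ (1 / p) *
        ∑' l : ℕ, (2 : ℝ≥0∞) ^ (-(l * A)) * avg μ q g (Metric.ball x (2 ^ l * r))) := by
        rw [ENNReal.ofReal_mul (by positivity)]
        ring
    _ ≤ _ := by
        rw [e]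
        gcongr
        · rw [show ν / 2 * (1 / q - 1 / p) = γ / 2 by rw [hγ]; ring]
          positivity
        · exact hσ.1

/-- The `L^p` Caccioppoli inequality with `L^q` averages on the right-hand side, `2 ≤ q ≤ p`. -/
theorem exists_avg_le_dilatedSum (hS : IsSetting μ Γ L ω) {p p₀ : ℝ} (hp : 2 < p)
    (hpp₀ : p < p₀) (hp₀L : ENNReal.ofReal p₀ < upperExponent L) (hG : GradientBound Γ L p₀)
    {ν : ℝ} (hν : 0 < ν) (hgrow : VolumeGrowth μ ν) {q : ℝ} (hq : 2 ≤ q) (hqp : q ≤ p)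
    {M : ℕ} (hM : 1 ≤ M) (hMν : ν / 2 * (1 / q - 1 / p) + 1 / 2 < M) {N : ℝ} (hN : 0 ≤ N) :
    ∃ C : ℝ≥0, ∀ (f : (opPow L M).domain) (x : X) (r : ℝ), 0 < r →
      avg μ p (fun y => (r : ℂ) * Γ.toFun f y) (Metric.ball x r) ≤
        C * dilatedSum μ q N r M x (f : L2 μ) (opPow L M f) := by
  obtain ⟨C, hC, h⟩ :=
    exists_gradient_local_of_mem_Icc hS hp hpp₀ hp₀L hG hν hgrow hq hqp hN
  set β := ν / 2 * (1 / q - 1 / p) + 1 / 2 with hβ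
  have hκ : 0 < M - β := sub_pos.2 hMν
  have hM0 : (1 : ℝ) ≤ M := by exact_mod_cast hM
  have hp0 : 0 < p := by linarith
  set D : ℝ≥0∞ := ∑' k : ℕ, (2 : ℝ≥0∞) ^ (-(k * (M - β))) with hD
  have hDt : D ≠ ⊤ := tsum_two_rpow_neg_ne_top hκ
  have hβ0 : 0 ≤ β := by
    have := sub_nonneg.2 (one_div_le_one_div_of_le (by linarith : 0 < q) hqp)
    positivity
  set m : ℝ≥0∞ := ENNReal.ofReal ((2 * M) ^ β) with hm
  have hCt : 2 ^ M * (C * m) * (1 + D) ≠ ⊤ :=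
    ENNReal.mul_ne_top (ENNReal.mul_ne_top (ENNReal.pow_ne_top ENNReal.ofNat_ne_top)
      (ENNReal.mul_ne_top hC ENNReal.ofReal_ne_top))
      (ENNReal.add_ne_top.2 ⟨ENNReal.one_ne_top, hDt⟩)
  refine ⟨(2 ^ M * (C * m) * (1 + D)).toNNReal, fun f x r hr => ?_⟩
  rw [ENNReal.coe_toNNReal hCt, avg_const_mul μ hp0, dilatedSum_eq μ (by linarith) N hr, avg_eq hp0,
    ← ofReal_norm, Complex.norm_real, Real.norm_of_nonneg hr.le]
  set V := μ (Metric.ball x r) with hV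
  have hV0 : V ≠ 0 := (Metric.measure_ball_pos μ x hr).ne'
  have hVt : V ≠ ⊤ := hS.doubling.measure_ball_ne_top x r
  set S : L2 μ → ℝ≥0∞ := fun g =>
    ∑' l : ℕ, (2 : ℝ≥0∞) ^ (-(l * N)) * avg μ q g (Metric.ball x (2 ^ l * r)) with hS_def
  -- With this `τ`, both `Mτ` and `2Ma` for `a ≤ τ/2` are at most `r²`, hence within the range of
  -- the local estimate.
  set τ : ℝ := r ^ 2 / M with hτ_def
  have hMpos : (0 : ℝ) < M := by linarith
  have hτ : 0 < τ := by positivity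
  have hMτ : M * τ = r ^ 2 := by rw [hτ_def]; field_simp
  have hmain := (hS.isGraphSeminorm (p := ENNReal.ofReal p)
    (ENNReal.one_le_ofReal.2 (by linarith)) (Metric.ball x r)).le_tsum
    (hS.accretive.isSemigroupOf_semigroup hS.omega_lt) hS.accretive hS.omega_lt hS.cos_pos hM f hτ
    (A := C * (ENNReal.ofReal (r⁻¹ * (2 * r ^ 2 / τ) ^ β) * V ^ (1 / p) * S f))
    (b := fun a => C * (ENNReal.ofReal (r⁻¹ * (2 * r ^ 2 / a) ^ β) * V ^ (1 / p) *
      S (opPow L M f)))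
    (fun σ hσ => h r τ hr hτ σ ⟨hσ.1, hσ.2.trans (by rw [hMτ]; nlinarith)⟩ x f)
    (fun a ha ha2 σ hσ => h r a hr ha σ ⟨hσ.1, hσ.2.trans (by nlinarith)⟩ x _)
  have eτ : 2 * r ^ 2 / τ = 2 * M := by rw [hτ_def]; field_simp
  -- The factor `a^M` beats the loss `a^{-β}`. The shift from `k + 1` to `k` in the exponent is
  -- harmless since `M > β`.
  have hterm : ∀ k : ℕ, (τ / 2 ^ (k + 1)) ^ M * (r⁻¹ * (2 * r ^ 2 / (τ / 2 ^ (k + 1))) ^ β) ≤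
      r ^ (2 * M) * (r⁻¹ * ((2 * M) ^ β * 2 ^ (-(k * (M - β))))) := by
    intro k
    have e1 : 2 * r ^ 2 / (τ / 2 ^ (k + 1)) = 2 * M * 2 ^ (k + 1) := by
      rw [hτ_def]; field_simp
    have e2 : τ / 2 ^ (k + 1) ≤ r ^ 2 / 2 ^ (k + 1) := by
      gcongr
      exact div_le_self (by positivity) hM0
    have e3 : ((2 : ℝ) ^ (k + 1)) ^ β / ((2 : ℝ) ^ (k + 1)) ^ M ≤ 2 ^ (-(k * (M - β))) := by
      rw [← Real.rpow_natCast _ M, ← Real.rpow_sub (by positivity), ← Real.rpow_natCast_mul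
        zero_le_two]
      refine Real.rpow_le_rpow_of_exponent_le one_le_two ?_
      push_cast
      nlinarith
    rw [e1, Real.mul_rpow (by positivity) (by positivity)]
    calc _ ≤ (r ^ 2 / 2 ^ (k + 1)) ^ M * (r⁻¹ * ((2 * M) ^ β * (2 ^ (k + 1)) ^ β)) := by gcongr
      _ = r ^ (2 * M) * (r⁻¹ * ((2 * M) ^ β * ((2 ^ (k + 1)) ^ β / (2 ^ (k + 1)) ^ M))) := by
          rw [div_pow, ← pow_mul]
          ring
      _ ≤ _ := by gcongr
  have hsum : ∑' k : ℕ, 2 ^ M * (ENNReal.ofReal ((τ / 2 ^ (k + 1)) ^ M) *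
      (C * (ENNReal.ofReal (r⁻¹ * (2 * r ^ 2 / (τ / 2 ^ (k + 1))) ^ β) * V ^ (1 / p) *
        S (opPow L M f)))) ≤
      2 ^ M * (C * m) * D * (ENNReal.ofReal r⁻¹ * V ^ (1 / p)) *
        (ENNReal.ofReal (r ^ (2 * M)) * S (opPow L M f)) := by
    calc _ ≤ ∑' k : ℕ, 2 ^ M * (C * m) * (ENNReal.ofReal r⁻¹ * V ^ (1 / p)) *
        (ENNReal.ofReal (r ^ (2 * M)) * S (opPow L M f)) * (2 : ℝ≥0∞) ^ (-(k * (M - β))) := by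
          refine ENNReal.tsum_le_tsum fun k => ?_
          calc _ = 2 ^ M * C * V ^ (1 / p) * S (opPow L M f) *
              ENNReal.ofReal ((τ / 2 ^ (k + 1)) ^ M *
                (r⁻¹ * (2 * r ^ 2 / (τ / 2 ^ (k + 1))) ^ β)) := by
                rw [ENNReal.ofReal_mul (p := (τ / 2 ^ (k + 1)) ^ M) (by positivity)]
                ring
            _ ≤ _ := mul_le_mul_right (ENNReal.ofReal_le_ofReal (hterm k)) _
            _ = _ := by
                rw [ENNReal.ofReal_mul (by positivity), ENNReal.ofReal_mul (by positivity),
                  ENNReal.ofReal_mul (by positivity), ofReal_two_rpow]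
                ring
      _ = _ := by
          rw [ENNReal.tsum_mul_left]
          ring
  have hr1 : ENNReal.ofReal r * ENNReal.ofReal r⁻¹ = 1 := by
    rw [← ENNReal.ofReal_mul hr.le, mul_inv_cancel₀ hr.ne', ENNReal.ofReal_one]
  have hV1 : V ^ (-(1 / p)) * V ^ (1 / p) = 1 := by
    rw [← ENNReal.rpow_add _ _ hV0 hVt, neg_add_cancel, ENNReal.rpow_zero]
  rw [eτ, ENNReal.ofReal_mul (by positivity)] at hmain
  calc _ ≤ ENNReal.ofReal r * (V ^ (-(1 / p)) *
        (2 ^ M * (C * (ENNReal.ofReal r⁻¹ * m * V ^ (1 / p) * S f)) +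
          2 ^ M * (C * m) * D * (ENNReal.ofReal r⁻¹ * V ^ (1 / p)) *
            (ENNReal.ofReal (r ^ (2 * M)) * S (opPow L M f)))) := by
        gcongr
        exact hmain.trans (add_le_add_right hsum _)
    _ = (ENNReal.ofReal r * ENNReal.ofReal r⁻¹) * (V ^ (-(1 / p)) * V ^ (1 / p)) *
        (2 ^ M * (C * m) * 1 * S f +
          2 ^ M * (C * m) * D * (ENNReal.ofReal (r ^ (2 * M)) * S (opPow L M f))) := by ring
    _ ≤ 2 ^ M * (C * m) * (1 + D) * S f +
          2 ^ M * (C * m) * (1 + D) * (ENNReal.ofReal (r ^ (2 * M)) * S (opPow L M f)) := by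
        rw [hr1, hV1, one_mul, one_mul]
        gcongr
        · exact le_self_add
        · exact le_add_self
    _ = _ := (mul_add _ _ _).symm

end Caccioppoli

end Caccioppoli

theorem mainTheorem12 {X : Type*} [MetricSpace X] [LocallyCompactSpace X]
    [TopologicalSpace.SeparableSpace X] [MeasurableSpace X] [BorelSpace X]
    (μ : Measure X) [IsFiniteMeasureOnCompacts μ] [μ.IsOpenPosMeasure]
    (Γ : Caccioppoli.SublinearOperator μ)
    (L : Caccioppoli.L2 μ →ₗ.[ℂ] Caccioppoli.L2 μ) (ω : ℝ)
    (hS : Caccioppoli.IsSetting μ Γ L ω)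
    (p₀ : ℝ) (hp₀ : 2 < p₀) (hp₀L : ENNReal.ofReal p₀ < Caccioppoli.upperExponent L)
    (hG : Caccioppoli.GradientBound Γ L p₀)
    (p : ℝ) (hp : 2 < p) (hpp₀ : p < p₀) (M : ℕ) (hM : 1 ≤ M) (N : ℝ) (hN : 0 < N) :
    (∃ C : ℝ≥0, ∀ (f : (Caccioppoli.opPow L M).domain) (x : X) (r : ℝ), 0 < r →
      Caccioppoli.avg μ p (fun y => (r : ℂ) * Γ.toFun f y) (Metric.ball x r) ≤
        C * Caccioppoli.dilatedSum μ p N r M x (f : Caccioppoli.L2 μ)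
          (Caccioppoli.opPow L M f)) ∧
    (∀ ν : ℝ, 0 < ν → Caccioppoli.VolumeGrowth μ ν →
      ν / 2 * (1 / 2 - 1 / p) + 1 / 2 < (M : ℝ) →
      ∃ C : ℝ≥0, ∀ (f : (Caccioppoli.opPow L M).domain) (x : X) (r : ℝ), 0 < r →
        Caccioppoli.avg μ p (fun y => (r : ℂ) * Γ.toFun f y) (Metric.ball x r) ≤
          C * Caccioppoli.dilatedSum μ 2 N r M x (f : Caccioppoli.L2 μ)
            (Caccioppoli.opPow L M f)) := by
  constructor
  -- For `q = p` there is no volume loss: any growth exponent will do, and the condition reads `M >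
  -- 1/2`.
  · obtain ⟨ν, hν, hgrow⟩ := hS.doubling.exists_growthBound
    have hM' : (1 : ℝ) ≤ M := by exact_mod_cast hM
    exact Caccioppoli.exists_avg_le_dilatedSum hS hp hpp₀ hp₀L hG hν hgrow hp.le le_rfl hM
      (by rw [sub_self, mul_zero]; linarith) hN.le
  · intro ν hν hgrow hMν
    exact Caccioppoli.exists_avg_le_dilatedSum hS hp hpp₀ hp₀L hG hν hgrow le_rfl hp.le hM hMν hN.le
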